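/- Let $\mathbf{k}$ be a field of characteristic zero and let $\mathcal{A}$ be a $\mathbb{Z}$-graded $A_\infty$-category over $\mathbf{k}$ (units are not required), with operations $$\mu^d\colon \hom(X_{d-1},X_d)\otimes\cdots\otimes\hom(X_0,X_1)\to\hom(X_0,X_d),\qquad d\ge 1,$$ of degree $2-d$. Put $\dagger_i=\sum_{l\le i}(|a_l|-1)$. The $A_\infty$-equations are $$\sum_{i,j}(-1)^{\dagger_i}\mu^{d-j+1}(a_d,\dots,\mu^j(a_{i+j},\dots,a_{i+1}),a_i,\dots,a_1)=0 .$$ An nc-vector field is a Hochschild cocycle $b\in CC^1(\mathcal{A},\mathcal{A})$: a family $b=(b^d)_{d\ge 0}$ of multilinear maps $b^d\colon\hom(X_{d-1},X_d)\otimes\cdots\otimes\hom(X_0,X_1)\to\hom(X_0,X_d)$ of degree $1-d$ with $$\sum_{i,j}\mu^{d-j+1}(a_d,\dots,b^j(a_{i+j},\dots,a_{i+1}),\dots,a_1)-\sum_{i,j}(-1)^{\dagger_i}b^{d-j+1}(a_d,\dots,\mu^j(a_{i+j},\dots,a_{i+1}),\dots,a_1)=0 .$$ Its constant term gives an element $b^0|_L\in\hom^1(L,L)$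 for every object $L$, and an (infinitesimally) equivariant structure on $L$ is an element $c_L\in\hom^0(L,L)$ with $\mu^1(c_L)=b^0|_L$. Given equivariant structures on $L$ and $L'$, the map $$\Phi\colon\hom(L,L')\to\hom(L,L'),\qquad \Phi(\phi)=b^1(\phi)-\mu^2(\phi,c_L)+(-1)^{|\phi|}\mu^2(c_{L'},\phi),$$ is a chain map of degree zero for $\mu^1$. The category $\mathcal{A}$ is called pure if there are an nc-vector field $b$ and equivariant structures $c_L$ on all objects $L$ such that for all $L,L'$ and all $n\in\mathbb{Z}$ the endomorphism of $H^n(\hom(L,L'))$ induced by $\Phi$ is multiplication by $n$ (the Euler field). If $\mathcal{A}$ is pure, then $\mathcal{A}$ is formal: there is an $A_\infty$-functor from $\mathcal{A}$ to its cohomological category $H(\mathcal{A})$ (the same objects, morphism spaces $H^*(\hom(L,L'))$, $\mu^2([g],[f])=[\mu^2(g,f)]$ and $\mu^j=0$ for $j\ne 2$) which is a quasi-isomorphism, i.e. bijective on objects and inducing isomorphisms on the cohomology of all morphism spaces. -/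

import Mathlib

open scoped DirectSum

universe u v w u' v'

namespace AInf

/-! ### Chains of composable morphisms -/

/-- A chain of composable morphisms `X = X₀ ⟶ X₁ ⟶ ⋯ ⟶ X_d = Y` (with `d ≥ 0`), where `H X Y`
is the type of morphisms from `X` to `Y`. The chain consisting of `a₁ : X₀ ⟶ X₁`, …,
`a_d : X_{d-1} ⟶ X_d` is written `(a_d, …, a₁)` in the doc comments. -/
inductive Chain {Ob : Type u} (H : Ob → Ob → Type v) : Ob → Ob → Type (max u v)
  | nil (X : Ob) : Chain H X X
  | cons {X Y Z : Ob} (p : Chain H X Y) (f : H Y Z) : Chain H X Z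

namespace Chain

variable {Ob : Type u} {H : Ob → Ob → Type v}

/-- The chain `(f)` of length one. -/
def single {X Y : Ob} (f : H X Y) : Chain H X Y := (nil X).cons f

/-- The chain `(g, f)` of length two: first `f`, then `g`. -/
def pair {X Y Z : Ob} (g : H Y Z) (f : H X Y) : Chain H X Z := ((nil X).cons f).cons g

/-- Concatenation: first the morphisms of `p`, then those of `q`. -/
def comp {X Y Z : Ob} (p : Chain H X Y) : Chain H Y Z → Chain H X Z
  | nil _ => p
  | cons q f => cons (comp p q) f

/-- The number of morphisms of a chain. -/
def length {X Y : Ob} : Chain H X Y → ℕ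
  | nil _ => 0
  | cons p _ => p.length + 1

/-- Apply a map to all the morphisms of a chain. -/
def map {Ob' : Type u'} {H' : Ob' → Ob' → Type v'} (o : Ob → Ob')
    (g : ∀ {X Y : Ob}, H X Y → H' (o X) (o Y)) {X Y : Ob} : Chain H X Y → Chain H' (o X) (o Y)
  | nil X => nil (o X)
  | cons p f => cons (map o g p) (g f)

/-- All the ways `(p, q)` of writing a chain as a concatenation `p.comp q`
(both pieces may be empty); a chain of length `d` has `d + 1` of them. -/
def splits {X Z : Ob} : Chain H X Z → List (Σ Y : Ob, Chain H X Y × Chain H Y Z)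
  | nil X => [⟨X, nil X, nil X⟩]
  | cons (Z := Z) p f =>
      ⟨Z, p.cons f, nil Z⟩ :: p.splits.map fun s => ⟨s.1, s.2.1, s.2.2.cons f⟩

/-- The two ways (one way if there is no block yet) of adding one more morphism at the end of
a sequence of blocks: enlarging the last block, or opening a new one. -/
def addToBlocks {X Y Z : Ob} : Chain (fun A B => Chain H A B) X Y → H Y Z →
    List (Chain (fun A B => Chain H A B) X Z)
  | nil X, f => [cons (nil X) (single f)]
  | cons P q, f => [cons P (q.cons f), cons (cons P q) (single f)]

/-- All the ways of cutting a chain into consecutive non-empty blocks; a chain of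
length `d ≥ 1` has `2 ^ (d - 1)` of them. -/
def blocks {X Y : Ob} : Chain H X Y → List (Chain (fun A B => Chain H A B) X Y)
  | nil X => [nil X]
  | cons p f => p.blocks.flatMap fun P => addToBlocks P f

theorem length_splits {X Z : Ob} (a : Chain H X Z) :
    ∀ s ∈ a.splits, s.2.1.length + s.2.2.length = a.length := by
  induction a with
  | nil => simp [splits, length]
  | cons p f ih =>
    intro s hs
    simp only [splits, List.mem_cons, List.mem_map] at hs
    rcases hs with rfl | ⟨t, ht, rfl⟩
    · simp [length]
    · have := ih t ht
      simp only [length]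
      omega

theorem length_comp {X Y Z : Ob} (p : Chain H X Y) (q : Chain H Y Z) :
    (p.comp q).length = p.length + q.length := by
  induction q with
  | nil => simp [comp, length]
  | cons q f ih => simp [comp, length, ih, add_assoc]

theorem length_map {Ob' : Type u'} {H' : Ob' → Ob' → Type v'} (o : Ob → Ob')
    (g : ∀ {X Y : Ob}, H X Y → H' (o X) (o Y)) {X Y : Ob} (p : Chain H X Y) :
    (p.map o g).length = p.length := by
  induction p with
  | nil => simp [map, length]
  | cons q f ih => simp [map, length, ih]

end Chain

/-! ### Families of multilinear operations -/

/-- A family of `k`-multilinear maps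
`σ^d : H(X_{d-1}, X_d) × ⋯ × H(X₀, X₁) → M(X₀, X_d)`, one for every `d ≥ 0` and all
`X₀, …, X_d`, as a single function on chains which is linear in every entry. -/
structure MultiMap (k : Type w) [Field k] {Ob : Type u} (H : Ob → Ob → Type v)
    (M : Ob → Ob → Type v') [∀ X Y, AddCommGroup (H X Y)] [∀ X Y, Module k (H X Y)]
    [∀ X Y, AddCommGroup (M X Y)] [∀ X Y, Module k (M X Y)] where
  app : ∀ {X Y : Ob}, Chain H X Y → M X Y
  app_add : ∀ {W X Y Z : Ob} (p : Chain H W X) (f g : H X Y) (r : Chain H Y Z),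
    app ((p.cons (f + g)).comp r) = app ((p.cons f).comp r) + app ((p.cons g).comp r)
  app_smul : ∀ {W X Y Z : Ob} (p : Chain H W X) (t : k) (f : H X Y) (r : Chain H Y Z),
    app ((p.cons (t • f)).comp r) = t • app ((p.cons f).comp r)

namespace MultiMap

variable {k : Type w} [Field k] {Ob : Type u} {H : Ob → Ob → Type v}
    {M : Ob → Ob → Type v'} [∀ X Y, AddCommGroup (H X Y)] [∀ X Y, Module k (H X Y)]
    [∀ X Y, AddCommGroup (M X Y)] [∀ X Y, Module k (M X Y)]

theorem app_zero (σ : MultiMap k H M) {W X Y Z : Ob} (p : Chain H W X) (r : Chain H Y Z) :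
    σ.app ((p.cons (0 : H X Y)).comp r) = 0 := by
  have := σ.app_smul p 0 (0 : H X Y) r
  simpa using this

/-- The linear part `σ¹ : H(X, Y) → M(X, Y)`. -/
def lin (σ : MultiMap k H M) (X Y : Ob) : H X Y →ₗ[k] M X Y where
  toFun f := σ.app (Chain.single f)
  map_add' f g := σ.app_add (Chain.nil X) f g (Chain.nil Y)
  map_smul' t f := σ.app_smul (Chain.nil X) t f (Chain.nil Y)

/-- The bilinear part `σ² : H(Y, Z) × H(X, Y) → M(X, Z)`. -/
def bilin (σ : MultiMap k H M) (X Y Z : Ob) : H Y Z →ₗ[k] H X Y →ₗ[k] M X Z :=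
  LinearMap.mk₂ k (fun g f => σ.app (Chain.pair g f))
    (fun g g' f => σ.app_add ((Chain.nil X).cons f) g g' (Chain.nil Z))
    (fun t g f => σ.app_smul ((Chain.nil X).cons f) t g (Chain.nil Z))
    (fun g f f' => σ.app_add (Chain.nil X) f f' ((Chain.nil Y).cons g))
    (fun t g f => σ.app_smul (Chain.nil X) t f ((Chain.nil Y).cons g))

end MultiMap

/-! ### Graded morphism spaces -/

/-- Objects together with `ℤ`-graded `k`-vector spaces of morphisms `hom X Y = (hom X Y n)_n`. -/
structure GradedQuiver (k : Type w) [Field k] where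
  Ob : Type u
  hom : Ob → Ob → ℤ → Type v
  [homAddCommGroup : ∀ X Y n, AddCommGroup (hom X Y n)]
  [homModule : ∀ X Y n, Module k (hom X Y n)]

attribute [instance] GradedQuiver.homAddCommGroup GradedQuiver.homModule

namespace GradedQuiver

variable {k : Type w} [Field k] (Q : GradedQuiver.{u, v, w} k)

/-- The total morphism space `⨁ n, hom X Y n`. -/
abbrev Hom (X Y : Q.Ob) : Type v := ⨁ n : ℤ, Q.hom X Y n

/-- The inclusion of the degree `n` part. -/
abbrev of {X Y : Q.Ob} (n : ℤ) : Q.hom X Y n →ₗ[k] Q.Hom X Y :=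
  DirectSum.lof k ℤ (fun n => Q.hom X Y n) n

/-- The projection to the degree `n` part. -/
abbrev proj {X Y : Q.Ob} (n : ℤ) : Q.Hom X Y →ₗ[k] Q.hom X Y n :=
  DirectSum.component k ℤ (fun n => Q.hom X Y n) n

/-- The operator `a ↦ (-1)^{e (|a| - 1)} a`. -/
def koszul (e : ℤ) {X Y : Q.Ob} : Q.Hom X Y →ₗ[k] Q.Hom X Y :=
  DirectSum.toModule k ℤ _ fun n => ((-1 : k) ^ (e * (n - 1))) • Q.of n

theorem koszul_of (e n : ℤ) {X Y : Q.Ob} (f : Q.hom X Y n) :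
    Q.koszul e (Q.of n f) = ((-1 : k) ^ (e * (n - 1))) • Q.of n f := by
  simp [koszul, of]

/-- `IsHomog p n` says that all the entries of the chain `p = (a_d, …, a₁)` are homogeneous and
that their reduced degrees `|a_i| - 1` add up to `n`. -/
inductive IsHomog : ∀ {X Y : Q.Ob}, Chain Q.Hom X Y → ℤ → Prop
  | nil (X : Q.Ob) : IsHomog (Chain.nil X) 0
  | cons {X Y Z : Q.Ob} {p : Chain Q.Hom X Y} {n : ℤ} (hp : IsHomog p n) (m : ℤ)
      (f : Q.hom Y Z m) : IsHomog (p.cons (Q.of m f)) (n + (m - 1))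

/-- The convolution of two families of operations, where `e` is the reduced degree `|τ| - 1`
of `τ`: with `†_i = ∑_{l ≤ i} (|a_l| - 1)`,
`(σ ∘ τ)(a_d, …, a₁) = ∑_{i, j} (-1)^{e †_i} σ(a_d, …, τ(a_{i+j}, …, a_{i+1}), a_i, …, a₁)`.
The sign is put in by applying `koszul e` to each of `a₁, …, a_i`. -/
def conv {M : Q.Ob → Q.Ob → Type v'} [∀ X Y, AddCommGroup (M X Y)] (e : ℤ)
    [∀ X Y, Module k (M X Y)] (σ : MultiMap k Q.Hom M) (τ : MultiMap k Q.Hom Q.Hom)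
    {X Y : Q.Ob} (a : Chain Q.Hom X Y) : M X Y :=
  (a.splits.map fun s => (s.2.1.splits.map fun t =>
    σ.app (((t.2.1.map id fun f => Q.koszul e f).cons (τ.app t.2.2)).comp s.2.2)).sum).sum

/-- The operations `σ` have degree `d` with respect to the reduced degrees of the inputs and the
unreduced degree of the output, i.e. `σ^s` has degree `d - s`. -/
def HasDegree {Q' : GradedQuiver.{u', v', w} k} {o : Q.Ob → Q'.Ob}
    (σ : MultiMap k Q.Hom fun X Y => Q'.Hom (o X) (o Y)) (d : ℤ) : Prop :=
  ∀ {X Y : Q.Ob} (p : Chain Q.Hom X Y) (n : ℤ), Q.IsHomog p n →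
    σ.app p ∈ LinearMap.range (Q'.of (X := o X) (Y := o Y) (n + d))

end GradedQuiver

/-! ### A∞-categories -/

/-- A `ℤ`-graded `A∞`-category over `k` (units are not required): operations `μ^d`, `d ≥ 1`, of
degree `2 - d`, with `μ ∘ μ = 0`. -/
structure AInfCategory (k : Type w) [Field k] extends GradedQuiver.{u, v, w} k where
  μ : MultiMap k toGradedQuiver.Hom toGradedQuiver.Hom
  μ_degree : toGradedQuiver.HasDegree (Q' := toGradedQuiver) (o := id) μ 2
  μ_nil : ∀ X, μ.app (Chain.nil X) = 0
  μ_conv : ∀ {X Y : Ob} (a : Chain toGradedQuiver.Hom X Y),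
    toGradedQuiver.conv 1 μ μ a = 0

namespace GradedQuiver

variable {k : Type w} [Field k] (Q : GradedQuiver.{u, v, w} k)

/-- The family of operations whose only non-zero term is a given binary operation. -/
def binaryApp (m : ∀ X Y Z, Q.Hom Y Z →ₗ[k] Q.Hom X Y →ₗ[k] Q.Hom X Z) {X Y : Q.Ob} :
    Chain Q.Hom X Y → Q.Hom X Y
  | .cons (.cons (.nil _) f) g => m _ _ _ g f
  | _ => 0

theorem binaryApp_of_length (m : ∀ X Y Z, Q.Hom Y Z →ₗ[k] Q.Hom X Y →ₗ[k] Q.Hom X Z)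
    {X Y : Q.Ob} (a : Chain Q.Hom X Y) (h : a.length ≠ 2) : Q.binaryApp m a = 0 := by
  rcases a with _ | ⟨_ | ⟨_ | ⟨p, c⟩, b⟩, a⟩ <;> simp_all [binaryApp, Chain.length]

/-- The family of operations whose only non-zero term is a given binary operation. -/
def binary (m : ∀ X Y Z, Q.Hom Y Z →ₗ[k] Q.Hom X Y →ₗ[k] Q.Hom X Z) :
    MultiMap k Q.Hom Q.Hom where
  app a := Q.binaryApp m a
  app_add p f g r := by
    by_cases h : p.length + 1 + r.length = 2
    · rcases p with _ | ⟨_ | ⟨p, c⟩, b⟩ <;> rcases r with _ | ⟨_ | ⟨r, c'⟩, b'⟩ <;>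
        first
        | (simp [Chain.length] at h; done)
        | (simp only [Chain.length] at h; omega)
        | simp [Chain.comp, binaryApp]
    · rw [binaryApp_of_length, binaryApp_of_length, binaryApp_of_length, add_zero] <;>
        simpa only [Chain.length_comp, Chain.length] using h
  app_smul p f g r := by
    by_cases h : p.length + 1 + r.length = 2
    · rcases p with _ | ⟨_ | ⟨p, c⟩, b⟩ <;> rcases r with _ | ⟨_ | ⟨r, c'⟩, b'⟩ <;>
        first
        | (simp [Chain.length] at h; done)
        | (simp only [Chain.length] at h; omega)
        | simp [Chain.comp, binaryApp]
    · rw [binaryApp_of_length, binaryApp_of_length, smul_zero] <;>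
        simpa only [Chain.length_comp, Chain.length] using h

/-- The `A∞`-category with `μ^d = 0` for `d ≠ 2` given by a binary operation of degree zero
which is associative in the sense of the `A∞`-equation
`μ²(c, μ²(b, a)) + (-1)^{|a| - 1} μ²(μ²(c, b), a) = 0`. -/
abbrev toAInf (m : ∀ X Y Z, Q.Hom Y Z →ₗ[k] Q.Hom X Y →ₗ[k] Q.Hom X Z)
    (hdeg : ∀ (X Y Z : Q.Ob) (i j : ℤ) (g : Q.hom Y Z i) (f : Q.hom X Y j),
      m X Y Z (Q.of i g) (Q.of j f) ∈ LinearMap.range (Q.of (X := X) (Y := Z) (i + j)))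
    (hassoc : ∀ (W X Y Z : Q.Ob) (c : Q.Hom Y Z) (b : Q.Hom X Y) (a : Q.Hom W X),
      m W Y Z c (m W X Y b a) + m W X Z (m X Y Z c b) (Q.koszul 1 a) = 0) :
    AInfCategory.{u, v, w} k where
  toGradedQuiver := Q
  μ := Q.binary m
  μ_degree := by
    intro X Y p n hp
    rcases hp with _ | ⟨_ | ⟨_ | ⟨hp, i, c⟩, j, b⟩, l, a⟩
    · exact Submodule.zero_mem _
    · exact Submodule.zero_mem _
    · have := hdeg _ _ _ _ _ a b
      have e : (0 + (j - 1) + (l - 1) + 2 : ℤ) = l + j := by ring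
      rw [e]
      exact this
    · exact Submodule.zero_mem _
  μ_nil X := rfl
  μ_conv := by
    intro X Y a
    by_cases h : a.length = 3
    · rcases a with _ | ⟨_ | ⟨_ | ⟨_ | ⟨p, d⟩, c⟩, b⟩, a⟩
      · simp [Chain.length] at h
      · simp [Chain.length] at h
      · simp [Chain.length] at h
      · simpa [conv, Chain.splits, Chain.map, Chain.comp, binary, binaryApp, add_comm]
          using hassoc _ _ _ _ a b c
      · simp [Chain.length] at h
    · unfold conv
      apply List.sum_eq_zero
      intro x hx
      obtain ⟨s, hs, rfl⟩ := List.mem_map.1 hx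
      apply List.sum_eq_zero
      intro x hx
      obtain ⟨t, ht, rfl⟩ := List.mem_map.1 hx
      have h1 := Chain.length_splits _ s hs
      have h2 := Chain.length_splits _ t ht
      by_cases h3 : t.2.2.length = 2
      · apply Q.binaryApp_of_length
        simp only [Chain.length_comp, Chain.length, Chain.length_map]
        omega
      · have h4 : (Q.binary m).app t.2.2 = 0 := Q.binaryApp_of_length m _ h3
        simp only [h4]
        exact (Q.binary m).app_zero _ _

end GradedQuiver

namespace AInfCategory

variable {k : Type w} [Field k] (A : AInfCategory.{u, v, w} k)

/-- The differential `μ¹`. -/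
abbrev d (X Y : A.Ob) : A.Hom X Y →ₗ[k] A.Hom X Y := A.μ.lin X Y

/-- The product `μ²(g, f)`, for `f : X ⟶ Y` and `g : Y ⟶ Z`. -/
abbrev mul {X Y Z : A.Ob} (g : A.Hom Y Z) (f : A.Hom X Y) : A.Hom X Z := A.μ.bilin X Y Z g f

/-- The cocycles of degree `n` in `hom X Y`. -/
def cocycles (X Y : A.Ob) (n : ℤ) : Submodule k (A.hom X Y n) :=
  LinearMap.ker (A.d X Y ∘ₗ A.of n)

/-- The coboundaries of degree `n` in `hom X Y`. -/
def coboundaries (X Y : A.Ob) (n : ℤ) : Submodule k (A.hom X Y n) :=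
  (LinearMap.range (A.d X Y)).comap (A.of n)

/-- The cohomology `Hⁿ(hom X Y)` of the morphism complex with differential `μ¹`. -/
abbrev Cohomology (X Y : A.Ob) (n : ℤ) : Type v :=
  A.cocycles X Y n ⧸ (A.coboundaries X Y n).submoduleOf (A.cocycles X Y n)

theorem d_of_mem {X Y : A.Ob} {n : ℤ} (f : A.hom X Y n) :
    A.d X Y (A.of n f) ∈ LinearMap.range (A.of (X := X) (Y := Y) (n + 1)) := by
  have h := A.μ_degree _ _ (GradedQuiver.IsHomog.cons (.nil X) n f)
  have e : (0 + (n - 1) + 2 : ℤ) = n + 1 := by ring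
  rw [e] at h
  exact h

theorem mul_of_mem {X Y Z : A.Ob} {m n : ℤ} (g : A.hom Y Z m) (f : A.hom X Y n) :
    A.mul (A.of m g) (A.of n f) ∈ LinearMap.range (A.of (X := X) (Y := Z) (m + n)) := by
  have h := A.μ_degree _ _ (GradedQuiver.IsHomog.cons (.cons (.nil X) n f) m g)
  have e : (0 + (n - 1) + (m - 1) + 2 : ℤ) = m + n := by ring
  rw [e] at h
  exact h

theorem μ_zero {W X Y Z : A.Ob} (p : Chain A.Hom W X) (r : Chain A.Hom Y Z) :
    A.μ.app ((p.cons (0 : A.Hom X Y)).comp r) = 0 := A.μ.app_zero p r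

theorem d_apply {X Y : A.Ob} (f : A.Hom X Y) :
    A.d X Y f = A.μ.app ((Chain.nil X).cons f) := rfl

theorem mul_apply {X Y Z : A.Ob} (g : A.Hom Y Z) (f : A.Hom X Y) :
    A.mul g f = A.μ.app (((Chain.nil X).cons f).cons g) := rfl

theorem add_mul {X Y Z : A.Ob} (g g' : A.Hom Y Z) (f : A.Hom X Y) :
    A.mul (g + g') f = A.mul g f + A.mul g' f := by
  simp only [mul, map_add, LinearMap.add_apply]

theorem smul_mul {X Y Z : A.Ob} (t : k) (g : A.Hom Y Z) (f : A.Hom X Y) :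
    A.mul (t • g) f = t • A.mul g f := by
  simp only [mul, map_smul, LinearMap.smul_apply]

theorem zero_mul {X Y Z : A.Ob} (f : A.Hom X Y) : A.mul (0 : A.Hom Y Z) f = 0 := by
  simp only [mul, map_zero, LinearMap.zero_apply]

theorem d_d {X Y : A.Ob} (f : A.Hom X Y) : A.d X Y (A.d X Y f) = 0 := by
  have h := A.μ_conv (Chain.single f)
  have h1 := A.μ_zero (Chain.nil X) (Chain.single f)
  have h2 := A.μ_zero (Chain.single (A.koszul 1 f)) (Chain.nil Y)
  simp only [Chain.single, Chain.comp] at h1 h2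
  simp only [d_apply]
  simpa [GradedQuiver.conv, Chain.single, Chain.splits, Chain.map, Chain.comp, A.μ_nil, h1, h2]
    using h

/-- The Leibniz equation. -/
theorem d_mul {X Y Z : A.Ob} (g : A.Hom Y Z) (f : A.Hom X Y) :
    A.d X Z (A.mul g f) + A.mul g (A.d X Y f) + A.mul (A.d Y Z g) (A.koszul 1 f) = 0 := by
  have h := A.μ_conv (Chain.pair g f)
  have h1 := A.μ_zero (Chain.nil X) (Chain.pair g f)
  have h2 := A.μ_zero (Chain.single (A.koszul 1 f)) (Chain.single g)
  have h3 := A.μ_zero (Chain.pair (A.koszul 1 g) (A.koszul 1 f)) (Chain.nil Z)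
  simp only [Chain.single, Chain.pair, Chain.comp] at h1 h2 h3
  simp [GradedQuiver.conv, Chain.pair, Chain.splits, Chain.map, Chain.comp, A.μ_nil,
    h1, h2, h3] at h
  rw [← h]
  simp only [d_apply, mul_apply]
  abel

/-- The associativity of `μ²` on cocycles, up to a coboundary. -/
theorem mul_mul {W X Y Z : A.Ob} (h : A.Hom Y Z) (g : A.Hom X Y) (f : A.Hom W X)
    (dh : A.d Y Z h = 0) (dg : A.d X Y g = 0) (df : A.d W X f = 0) :
    A.mul h (A.mul g f) + A.mul (A.mul h g) (A.koszul 1 f) ∈ LinearMap.range (A.d W Z) := by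
  refine ⟨- A.μ.app (((Chain.single f).cons g).cons h), ?_⟩
  have e := A.μ_conv (((Chain.single f).cons g).cons h)
  have h1 := A.μ_zero (Chain.nil W) (((Chain.single f).cons g).cons h)
  have h2 := A.μ_zero (Chain.single (A.koszul 1 f)) (Chain.pair h g)
  have h3 := A.μ_zero (Chain.pair (A.koszul 1 g) (A.koszul 1 f)) (Chain.single h)
  have h4 := A.μ_zero ((Chain.pair (A.koszul 1 g) (A.koszul 1 f)).cons (A.koszul 1 h))
    (Chain.nil Z)
  have h5 := A.μ_zero (X := W) (Y := X) (Chain.nil W) (Chain.pair h g)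
  have h6 := A.μ_zero (X := X) (Y := Y) (Chain.single (A.koszul 1 f)) (Chain.single h)
  have h7 := A.μ_zero (X := Y) (Y := Z) (Chain.pair (A.koszul 1 g) (A.koszul 1 f)) (Chain.nil Z)
  change A.μ.app ((Chain.nil _).cons _) = 0 at dh dg df
  simp only [Chain.single, Chain.pair, Chain.comp] at h1 h2 h3 h4 h5 h6 h7
  simp [GradedQuiver.conv, Chain.single, Chain.splits, Chain.map, Chain.comp, A.μ_nil,
    h1, h2, h3, h4, dh, dg, df, h5, h6, h7] at e
  rw [map_neg, neg_eq_iff_add_eq_zero, ← e]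
  simp only [d_apply, mul_apply, Chain.single]
  abel

theorem of_proj {X Y : A.Ob} {n : ℤ} {x : A.Hom X Y}
    (h : x ∈ LinearMap.range (A.of (X := X) (Y := Y) n)) : A.of n (A.proj n x) = x := by
  obtain ⟨y, rfl⟩ := h
  simp [GradedQuiver.of, GradedQuiver.proj, DirectSum.component.lof_self]

theorem d_of_cocycle {X Y : A.Ob} {n : ℤ} (z : A.cocycles X Y n) :
    A.d X Y (A.of n (z : A.hom X Y n)) = 0 :=
  z.2

theorem mul_cocycle {X Y Z : A.Ob} {m n : ℤ} (g : A.cocycles Y Z m) (f : A.cocycles X Y n) :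
    A.d X Z (A.mul (A.of m (g : A.hom Y Z m)) (A.of n (f : A.hom X Y n))) = 0 := by
  have h := A.d_mul (A.of m (g : A.hom Y Z m)) (A.of n (f : A.hom X Y n))
  rw [A.d_of_cocycle, A.d_of_cocycle, zero_mul] at h
  simpa using h

/-- The product of two cocycles. -/
def cocycleMul (X Y Z : A.Ob) (m n : ℤ) :
    A.cocycles Y Z m →ₗ[k] A.cocycles X Y n →ₗ[k] A.cocycles X Z (m + n) :=
  LinearMap.mk₂ k
    (fun g f => ⟨A.proj (m + n) (A.mul (A.of m (g : A.hom Y Z m)) (A.of n (f : A.hom X Y n))), by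
      change A.d X Z (A.of (m + n) (A.proj (m + n) _)) = 0
      rw [A.of_proj (A.mul_of_mem _ _), A.mul_cocycle]⟩)
    (fun g g' f => by ext1; simp [add_mul]) (fun t g f => by ext1; simp [smul_mul])
    (fun g f f' => by ext1; simp) (fun t g f => by ext1; simp)

theorem of_cocycleMul {X Y Z : A.Ob} {m n : ℤ} (g : A.cocycles Y Z m) (f : A.cocycles X Y n) :
    A.of (m + n) (A.cocycleMul X Y Z m n g f : A.hom X Z (m + n)) =
      A.mul (A.of m (g : A.hom Y Z m)) (A.of n (f : A.hom X Y n)) :=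
  A.of_proj (A.mul_of_mem _ _)

/-- The cohomology class of a cocycle. -/
abbrev cls {X Y : A.Ob} (n : ℤ) : A.cocycles X Y n →ₗ[k] A.Cohomology X Y n :=
  Submodule.mkQ _

theorem cls_eq_zero {X Y : A.Ob} {n : ℤ} {z : A.cocycles X Y n} :
    A.cls n z = 0 ↔ A.of n (z : A.hom X Y n) ∈ LinearMap.range (A.d X Y) := by
  rw [Submodule.mkQ_apply, Submodule.Quotient.mk_eq_zero]
  rfl

/-- The product `[g][f] = [μ²(g, f)]` on cohomology. -/
def cohomologyMul (X Y Z : A.Ob) (m n : ℤ) :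
    A.Cohomology Y Z m →ₗ[k] A.Cohomology X Y n →ₗ[k] A.Cohomology X Z (m + n) :=
  (Submodule.liftQ _ (Submodule.liftQ _
    ((A.cocycleMul X Y Z m n).compr₂ (A.cls (m + n))) (by
      intro g hg
      obtain ⟨x, hx⟩ : A.of m (g : A.hom Y Z m) ∈ LinearMap.range (A.d Y Z) := hg
      rw [LinearMap.mem_ker]
      ext f
      change A.cls (m + n) _ = 0
      rw [cls_eq_zero, of_cocycleMul, ← hx]
      have h := A.d_mul x (A.koszul 1 (A.of n (f : A.hom X Y n)))
      have e : A.koszul 1 (A.of n (f : A.hom X Y n)) = ((-1 : k) ^ (1 * (n - 1))) • A.of n (f : A.hom X Y n) :=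
        A.koszul_of _ _ _
      have e2 : ((-1 : k) ^ (1 * (n - 1))) * ((-1 : k) ^ (1 * (n - 1))) = 1 := by
        rw [← mul_zpow]; simp
      simp only [e, map_smul, A.d_of_cocycle, smul_zero, map_zero, add_zero, smul_smul, e2,
        one_smul] at h
      rw [← neg_eq_of_add_eq_zero_right h]
      exact Submodule.neg_mem _ (Submodule.smul_mem _ _ ⟨_, rfl⟩))).flip (by
    intro f hf
    obtain ⟨x, hx⟩ : A.of n (f : A.hom X Y n) ∈ LinearMap.range (A.d X Y) := hf
    rw [LinearMap.mem_ker]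
    ext g
    change A.cls (m + n) _ = 0
    rw [cls_eq_zero, of_cocycleMul, ← hx]
    have h := A.d_mul (A.of m (g : A.hom Y Z m)) x
    simp only [A.d_of_cocycle, zero_mul, add_zero] at h
    rw [← neg_eq_of_add_eq_zero_right h]
    exact Submodule.neg_mem _ ⟨_, rfl⟩)).flip

theorem cohomologyMul_cls {X Y Z : A.Ob} {m n : ℤ} (g : A.cocycles Y Z m)
    (f : A.cocycles X Y n) :
    A.cohomologyMul X Y Z m n (A.cls m g) (A.cls n f) =
      A.cls (m + n) (A.cocycleMul X Y Z m n g f) := rfl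

/-- The objects of `A` with the graded vector spaces `H^*(hom X Y)` as morphisms. -/
abbrev cohomologyQuiver : GradedQuiver.{u, v, w} k where
  Ob := A.Ob
  hom X Y n := A.Cohomology X Y n

/-- The product on cohomology, extended bilinearly to sums of elements of different degrees. -/
def cohomologyTotalMul (X Y Z : A.Ob) :
    A.cohomologyQuiver.Hom Y Z →ₗ[k] A.cohomologyQuiver.Hom X Y →ₗ[k]
      A.cohomologyQuiver.Hom X Z :=
  DirectSum.toModule k ℤ _ fun m => LinearMap.flip <|
    DirectSum.toModule k ℤ _ fun n => LinearMap.flip <|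
      (A.cohomologyMul X Y Z m n).compr₂ (A.cohomologyQuiver.of (X := X) (Y := Z) (m + n))

theorem cohomologyTotalMul_of {X Y Z : A.Ob} {m n : ℤ} (g : A.Cohomology Y Z m)
    (f : A.Cohomology X Y n) :
    A.cohomologyTotalMul X Y Z (A.cohomologyQuiver.of (X := Y) (Y := Z) m g)
        (A.cohomologyQuiver.of (X := X) (Y := Y) n f) =
      A.cohomologyQuiver.of (X := X) (Y := Z) (m + n) (A.cohomologyMul X Y Z m n g f) := by
  unfold cohomologyTotalMul GradedQuiver.of
  rw [DirectSum.toModule_lof, LinearMap.flip_apply, DirectSum.toModule_lof]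
  rfl

theorem of_cls_add {X Y : A.Ob} {m n : ℤ} (e : m = n) (t : k) (y : A.cocycles X Y m)
    (z : A.cocycles X Y n)
    (h : A.of m (y : A.hom X Y m) + t • A.of n (z : A.hom X Y n) ∈ LinearMap.range (A.d X Y)) :
    A.cohomologyQuiver.of (X := X) (Y := Y) m (A.cls m y) +
      t • A.cohomologyQuiver.of (X := X) (Y := Y) n (A.cls n z) = 0 := by
  subst e
  have h0 : A.cls m (y + t • z) = 0 := by
    rw [cls_eq_zero]
    simpa using h
  have h1 : A.cohomologyQuiver.of (X := X) (Y := Y) m (A.cls m (y + t • z)) = 0 := by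
    rw [h0]; exact map_zero _
  rw [map_add, map_smul] at h1
  erw [map_add, map_smul] at h1
  exact h1

/-- The cohomological category `H(A)`, as an `A∞`-category: the same objects, the morphism
spaces `H^*(hom X Y)`, the operation `μ²([g], [f]) = [μ²(g, f)]`, and `μ^j = 0` for `j ≠ 2`. -/
abbrev cohomologyCategory : AInfCategory.{u, v, w} k :=
  A.cohomologyQuiver.toAInf A.cohomologyTotalMul
    (by
      intro X Y Z i j g f
      rw [A.cohomologyTotalMul_of]
      exact ⟨_, rfl⟩)
    (by
      intro W X Y Z c b a
      induction c using DirectSum.induction_on with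
      | zero => simp
      | add x y hx hy =>
        simp only [map_add, LinearMap.add_apply]
        rw [add_add_add_comm, hx, hy, add_zero]
      | of l c =>
      induction b using DirectSum.induction_on with
      | zero => simp
      | add x y hx hy =>
        simp only [map_add, LinearMap.add_apply]
        rw [add_add_add_comm, hx, hy, add_zero]
      | of m b =>
      induction a using DirectSum.induction_on with
      | zero => simp
      | add x y hx hy =>
        simp only [map_add]
        rw [add_add_add_comm, hx, hy, add_zero]
      | of n a =>
      obtain ⟨c, rfl⟩ := Submodule.mkQ_surjective _ c
      obtain ⟨b, rfl⟩ := Submodule.mkQ_surjective _ b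
      obtain ⟨a, rfl⟩ := Submodule.mkQ_surjective _ a
      have hk := A.cohomologyQuiver.koszul_of (X := W) (Y := X) 1 n (A.cls n a)
      have h1 := A.cohomologyTotalMul_of (A.cls m b) (A.cls n a)
      have h2 := A.cohomologyTotalMul_of (A.cls l c) (A.cls m b)
      change A.cohomologyTotalMul W Y Z (A.cohomologyQuiver.of (X := Y) (Y := Z) l (A.cls l c))
          (A.cohomologyTotalMul W X Y (A.cohomologyQuiver.of (X := X) (Y := Y) m (A.cls m b))
            (A.cohomologyQuiver.of (X := W) (Y := X) n (A.cls n a))) +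
        A.cohomologyTotalMul W X Z (A.cohomologyTotalMul X Y Z
          (A.cohomologyQuiver.of (X := Y) (Y := Z) l (A.cls l c))
          (A.cohomologyQuiver.of (X := X) (Y := Y) m (A.cls m b)))
          (A.cohomologyQuiver.koszul 1
            (A.cohomologyQuiver.of (X := W) (Y := X) n (A.cls n a))) = 0
      rw [hk, h1, h2, map_smul, A.cohomologyTotalMul_of, A.cohomologyTotalMul_of,
        cohomologyMul_cls, cohomologyMul_cls, cohomologyMul_cls, cohomologyMul_cls]
      apply A.of_cls_add (add_assoc l m n).symm
      rw [of_cocycleMul, of_cocycleMul, of_cocycleMul, of_cocycleMul, ← map_smul,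
        ← A.koszul_of]
      exact A.mul_mul _ _ _ (A.d_of_cocycle c) (A.d_of_cocycle b) (A.d_of_cocycle a))

end AInfCategory

/-! ### A∞-functors and formality -/

/-- An `A∞`-functor `F : A ⟶ B`: a map on objects and operations `F^d`, `d ≥ 1`, of degree `1 - d`
with
`∑ μ_B^r(F^{s_r}(a_d, …), …, F^{s_1}(a_{s_1}, …, a_1))
  = ∑ (-1)^{†_i} F(a_d, …, μ_A^j(a_{i+j}, …, a_{i+1}), a_i, …, a_1)`,
where the left sum is over `r ≥ 1` and `s_1 + ⋯ + s_r = d` with `s_i ≥ 1`. -/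
structure AInfFunctor {k : Type w} [Field k] (A : AInfCategory.{u, v, w} k)
    (B : AInfCategory.{u', v', w} k) where
  obj : A.Ob → B.Ob
  F : MultiMap k A.Hom fun X Y => B.Hom (obj X) (obj Y)
  F_degree : A.HasDegree (Q' := B.toGradedQuiver) (o := obj) F 1
  F_nil : ∀ X, F.app (Chain.nil X) = 0
  F_eq : ∀ {X Y : A.Ob} (a : Chain A.Hom X Y),
    (a.blocks.map fun P => B.μ.app (P.map obj fun q => F.app q)).sum = A.conv 1 F A.μ a

/-- A quasi-isomorphism of `A∞`-categories is an `A∞`-functor which is bijective on objects and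
whose linear part induces isomorphisms `Hⁿ(hom_A(X, Y)) ≅ Hⁿ(hom_B(FX, FY))` for all `X`, `Y`
and `n`; injectivity and surjectivity are spelled out for cocycles. -/
structure AInfFunctor.IsQuasiIso {k : Type w} [Field k] {A : AInfCategory.{u, v, w} k}
    {B : AInfCategory.{u', v', w} k} (F : AInfFunctor A B) : Prop where
  obj_bijective : Function.Bijective F.obj
  injective : ∀ (X Y : A.Ob) (n : ℤ) (x : A.cocycles X Y n),
    F.F.lin X Y (A.of n (x : A.hom X Y n)) ∈ LinearMap.range (B.d (F.obj X) (F.obj Y)) →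
      A.of n (x : A.hom X Y n) ∈ LinearMap.range (A.d X Y)
  surjective : ∀ (X Y : A.Ob) (n : ℤ) (y : B.cocycles (F.obj X) (F.obj Y) n),
    ∃ x : A.cocycles X Y n, F.F.lin X Y (A.of n (x : A.hom X Y n)) -
      B.of n (y : B.hom (F.obj X) (F.obj Y) n) ∈ LinearMap.range (B.d (F.obj X) (F.obj Y))

namespace AInfCategory

variable {k : Type w} [Field k] (A : AInfCategory.{u, v, w} k)

/-- `A` is formal if it is quasi-isomorphic to its cohomological category, on which all `μ^j`
with `j ≠ 2` vanish. -/
def IsFormal : Prop :=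
  ∃ F : AInfFunctor A A.cohomologyCategory, F.IsQuasiIso

/-! ### nc-vector fields and purity -/

/-- The differential of the Hochschild complex on a cochain `σ` of degree `|σ| = e`:
`(δσ)(a_d, …, a₁) = ∑ (-1)^{(e - 1) †_i} μ(a_d, …, σ(a_{i+j}, …, a_{i+1}), …, a₁)
  + ∑ (-1)^{e + †_i} σ(a_d, …, μ(a_{i+j}, …, a_{i+1}), …, a₁)`. -/
def hochschildDiff (e : ℤ) (σ : MultiMap k A.Hom A.Hom) {X Y : A.Ob} (a : Chain A.Hom X Y) :
    A.Hom X Y :=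
  A.conv (e - 1) A.μ σ a + (-1 : k) ^ e • A.conv 1 σ A.μ a

/-- An nc-vector field: a cocycle `b ∈ CC¹(A, A)`. -/
structure NCVectorField where
  b : MultiMap k A.Hom A.Hom
  b_degree : A.HasDegree (Q' := A.toGradedQuiver) (o := id) b 1
  b_closed : ∀ {X Y : A.Ob} (a : Chain A.Hom X Y), A.hochschildDiff 1 b a = 0

namespace NCVectorField

variable {A} (V : A.NCVectorField)

/-- The constant term `b⁰` at the object `X`. -/
def const (X : A.Ob) : A.Hom X X := V.b.app (Chain.nil X)

/-- An infinitesimally equivariant structure on the object `X`: an element `c` of `hom⁰(X, X)`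
with `μ¹(c) = b⁰` at `X`. -/
structure EquivariantStructure (X : A.Ob) where
  c : A.hom X X 0
  d_c : A.d X X (A.of 0 c) = V.const X

/-- The endomorphism of `hom(X, Y)` determined by equivariant structures on `X` and `Y`:
`φ ↦ b¹(φ) - μ²(φ, c_X) + (-1)^{|φ|} μ²(c_Y, φ)` for homogeneous `φ`
(`koszul 1` multiplies `φ` by `(-1)^{|φ| - 1}`). -/
def endo {X Y : A.Ob} (c : V.EquivariantStructure X) (c' : V.EquivariantStructure Y)
    (φ : A.Hom X Y) : A.Hom X Y :=
  V.b.lin X Y φ - A.mul φ (A.of 0 c.c) - A.mul (A.of 0 c'.c) (A.koszul 1 φ)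

end NCVectorField

/-- `A` is pure: there are an nc-vector field and equivariant structures on all objects such that
on the cohomology of each morphism space the associated endomorphism is the Euler field, i.e.
`[endo z] = n [z]` for each cocycle `z` of degree `n`. -/
def IsPure : Prop :=
  ∃ (V : A.NCVectorField) (c : ∀ X : A.Ob, V.EquivariantStructure X),
    ∀ (X Y : A.Ob) (n : ℤ) (z : A.cocycles X Y n),
      V.endo (c X) (c Y) (A.of n (z : A.hom X Y n)) - (n : k) • A.of n (z : A.hom X Y n) ∈
        LinearMap.range (A.d X Y)

end AInfCategory

end AInf

/-!
Why a pure `A∞`-category `A` is formal.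

Subtracting from the nc-vector field the Hochschild differential of the equivariant structures, one
obtains a derivation `b` of `A` without constant term, closed by the pre-Lie identity
(`NCVectorField.reduced_closed`), whose linear part acts on `Hⁿ` as multiplication by `n`. The
target `H(A)` has the strict Euler derivation `eu`.

An `A∞`-functor `F : A → H(A)` is built arity by arity, starting from a chain map which sends each
cocycle to its class, together with a homotopy `T` between `eu ∘ F` and `F ∘ b`. Two defects are
to be killed:
`E = F ⋆ F - F{μ}` (`functorDefect`) and
`S = eu F - F{b} - F ⋆ T - T ⋆ (±F) - T{μ}` (`eulerDefect`), where `⋆` is the product of operations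
induced by that of `H(A)` (`MultiMap.star`) and `σ{τ}` is the insertion of `τ` into `σ`
(`MultiMap.ins`). The Leibniz rule `star_ins`, the pre-Lie identity `ins_ins` and the associativity
of the product show that `E` is closed (`ins_functorDefect`), and that the differential of `S` is
`-(eu E - E{b})` up to products involving `E`, `S` (`ins_eulerDefect`).

Suppose that `E` and `S` vanish in arities below `d`. In arity `d` only `μ¹` and `b¹` contribute,
so `E` is a cocycle for the differential induced by `μ¹`, and `eu E - E{b¹}` is a coboundary. On
cohomology, `E{b¹}` is `E` times the total degree of the arguments, and `E` has degree `2 - d`;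
hence `(2 - d) [E] = 0`, and `E` is a coboundary if `d ≥ 3` (`functorDefect_app_π`). For `d = 2`
this is the definition of the product of `H(A)`. So `F` can be corrected in arity `d` to make `E`
vanish there. Then `S` is closed; adding to `F` the cocycle `S / (d - 1)` changes the class of `S`
by `(1 - d) / (d - 1) = -1` times itself (`exists_left`), and then `T` can be corrected to make
`S` vanish (`exists_right`). This uses that `k` has characteristic zero.

Over a field, closed multilinear operations which vanish on cocycles are coboundaries by the
explicit homotopy `Chain.insLin_homotopy`: if `h` is a partial inverse of the differential `d`, so
that `d h d = d`, then `π = 1 - d h - h d` takes values in cocycles and kills coboundaries, and `σ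
↦ ∑ ± σ(π, …, π, h, 1, …, 1)` is a homotopy between the identity and `σ ↦ σ(π, …, π)`.
-/

namespace AInf

/-! ### Sums over decompositions of a chain -/

namespace Chain

variable {Ob : Type u} {H : Ob → Ob → Type v}

theorem nil_comp {X Y : Ob} (p : Chain H X Y) : (nil X).comp p = p := by
  induction p with
  | nil => rfl
  | cons p f ih => simp [comp, ih]

theorem comp_assoc {W X Y Z : Ob} (p : Chain H W X) (q : Chain H X Y) (r : Chain H Y Z) :
    (p.comp q).comp r = p.comp (q.comp r) := by
  induction r with
  | nil => rfl
  | cons r f ih => simp [comp, ih]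

/-- The sum of `G p q` over all the ways of writing a chain as `p.comp q`. -/
def sumSplits {N : Type*} [AddCommMonoid N] {X Z : Ob} (a : Chain H X Z)
    (G : ∀ Y, Chain H X Y → Chain H Y Z → N) : N :=
  (a.splits.map fun s => G s.1 s.2.1 s.2.2).sum

/-- The sum of `G p f r` over all the ways of writing a chain as `(p.cons f).comp r`, i.e. over
the entries `f` of the chain. -/
def sumEntries {N : Type*} [AddCommMonoid N] {X Z : Ob} : Chain H X Z →
    (∀ V W, Chain H X V → H V W → Chain H W Z → N) → N
  | nil _, _ => 0
  | cons p f, G => sumEntries p (fun V W p' g r => G V W p' g (r.cons f)) + G _ _ p f (nil _)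

/-- Every entry of the chain satisfies `P`. -/
def All (P : ∀ X Y, H X Y → Prop) {X Y : Ob} : Chain H X Y → Prop
  | nil _ => True
  | cons p f => All P p ∧ P _ _ f

theorem All.of_cons_comp {P : ∀ X Y, H X Y → Prop} {W X Y Z : Ob} {p : Chain H W X} {f : H X Y}
    {r : Chain H Y Z} (h : ((p.cons f).comp r).All P) : p.All P ∧ P _ _ f ∧ r.All P := by
  induction r with
  | nil => exact ⟨h.1, h.2, trivial⟩
  | cons r g ih => exact ⟨(ih h.1).1, (ih h.1).2.1, (ih h.1).2.2, h.2⟩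

theorem All.cons_comp {P : ∀ X Y, H X Y → Prop} {W X Y Z : Ob} {p : Chain H W X} {f : H X Y}
    {r : Chain H Y Z} (hp : p.All P) (hf : P _ _ f) (hr : r.All P) :
    ((p.cons f).comp r).All P := by
  induction r with
  | nil => exact ⟨hp, hf⟩
  | cons r g ih => exact ⟨ih hr.1, hr.2⟩

section Sums

variable {N N' : Type*} [AddCommMonoid N] [AddCommMonoid N']

theorem sumSplits_nil (X : Ob) (G : ∀ Y, Chain H X Y → Chain H Y X → N) :
    (nil X).sumSplits G = G X (nil X) (nil X) := by
  simp [sumSplits, splits]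

theorem sumSplits_cons {X Y Z : Ob} (p : Chain H X Y) (f : H Y Z)
    (G : ∀ Y, Chain H X Y → Chain H Y Z → N) :
    (p.cons f).sumSplits G =
      G Z (p.cons f) (nil Z) + p.sumSplits fun W p q => G W p (q.cons f) := by
  simp [sumSplits, splits, Function.comp_def]

theorem sumSplits_congr {X Z : Ob} (a : Chain H X Z)
    {G G' : ∀ Y, Chain H X Y → Chain H Y Z → N}
    (h : ∀ Y (p : Chain H X Y) (q : Chain H Y Z), p.comp q = a → G Y p q = G' Y p q) :
    a.sumSplits G = a.sumSplits G' := by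
  induction a with
  | nil => rw [sumSplits_nil, sumSplits_nil, h _ _ _ rfl]
  | cons p f ih =>
    rw [sumSplits_cons, sumSplits_cons, h _ _ _ rfl, ih]
    intro Y p' q hq
    exact h _ _ _ (by rw [comp, hq])

theorem sumSplits_zero {X Z : Ob} (a : Chain H X Z) :
    (a.sumSplits fun _ _ _ => (0 : N)) = 0 := by
  simp [sumSplits]

theorem sumSplits_add {X Z : Ob} (a : Chain H X Z)
    (G G' : ∀ Y, Chain H X Y → Chain H Y Z → N) :
    (a.sumSplits fun Y p q => G Y p q + G' Y p q) = a.sumSplits G + a.sumSplits G' := by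
  simp [sumSplits, List.sum_map_add]

theorem map_sumSplits (φ : N →+ N') {X Z : Ob} (a : Chain H X Z)
    (G : ∀ Y, Chain H X Y → Chain H Y Z → N) :
    φ (a.sumSplits G) = a.sumSplits fun Y p q => φ (G Y p q) := by
  simp [sumSplits, map_list_sum, Function.comp_def]

theorem sumSplits_mem {S : Type*} [SetLike S N] [AddSubmonoidClass S N] (s : S) {X Z : Ob}
    (a : Chain H X Z) {G : ∀ Y, Chain H X Y → Chain H Y Z → N}
    (h : ∀ Y (p : Chain H X Y) (q : Chain H Y Z), p.comp q = a → G Y p q ∈ s) :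
    a.sumSplits G ∈ s := by
  induction a with
  | nil => rw [sumSplits_nil]; exact h _ _ _ rfl
  | cons p f ih =>
    rw [sumSplits_cons]
    exact add_mem (h _ _ _ rfl) (ih fun Y p' q hq => h _ _ _ (by rw [comp, hq]))

theorem sumSplits_comm {X Z X' Z' : Ob} (a : Chain H X Z) (b : Chain H X' Z')
    (G : ∀ Y, Chain H X Y → Chain H Y Z → ∀ Y', Chain H X' Y' → Chain H Y' Z' → N) :
    (a.sumSplits fun Y p q => b.sumSplits fun Y' p' q' => G Y p q Y' p' q') =
      b.sumSplits fun Y' p' q' => a.sumSplits fun Y p q => G Y p q Y' p' q' := by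
  induction a with
  | nil => simp only [sumSplits_nil]
  | cons p f ih => simp only [sumSplits_cons, sumSplits_add, ih]

/-- Cutting a chain in three pieces, in either order. -/
theorem sumSplits_assoc {X Z : Ob} (a : Chain H X Z)
    (G : ∀ V W, Chain H X V → Chain H V W → Chain H W Z → N) :
    (a.sumSplits fun W s r => s.sumSplits fun V p q => G V W p q r) =
      a.sumSplits fun V p s => s.sumSplits fun W q r => G V W p q r := by
  induction a with
  | nil => simp only [sumSplits_nil]
  | cons p f ih =>
    simp only [sumSplits_cons, sumSplits_nil, sumSplits_add]
    rw [ih fun V W p q r => G V W p q (r.cons f)]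
    abel

/-- The cuts of a concatenation `(p.cons f).comp r` lie either before or after `f`. -/
theorem sumSplits_cons_comp {W X Y Z : Ob} (p : Chain H W X) (f : H X Y) (r : Chain H Y Z)
    (G : ∀ V, Chain H W V → Chain H V Z → N) :
    ((p.cons f).comp r).sumSplits G =
      (p.sumSplits fun V p₁ p₂ => G V p₁ ((p₂.cons f).comp r)) +
        r.sumSplits fun V r₁ r₂ => G V ((p.cons f).comp r₁) r₂ := by
  induction r with
  | nil => simp only [comp, sumSplits_cons, sumSplits_nil, add_comm]
  | cons r g ih =>
    simp only [comp, sumSplits_cons]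
    rw [ih fun V p₁ p₂ => G V p₁ (p₂.cons g)]
    abel

theorem sumSplits_eq_of_ne_nil {X Z : Ob} (a : Chain H X Z)
    (G : ∀ Y, Chain H X Y → Chain H Y Z → N)
    (h : ∀ Y (p : Chain H X Y) (q : Chain H Y Z), p.comp q = a → q.length ≠ 0 → G Y p q = 0) :
    a.sumSplits G = G Z a (nil Z) := by
  cases a with
  | nil => rw [sumSplits_nil]
  | cons p f =>
    rw [sumSplits_cons, sumSplits_congr p (G' := fun _ _ _ => 0), sumSplits_zero, add_zero]
    intro Y p' q hq
    exact h _ _ _ (by rw [comp, hq]) (by simp [length])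

/-- The sum of `G p q r` over all the ways of writing a chain as `(p.comp q).comp r`. -/
def sumSplits₃ {X Z : Ob} (a : Chain H X Z)
    (G : ∀ V W, Chain H X V → Chain H V W → Chain H W Z → N) : N :=
  a.sumSplits fun W s r => s.sumSplits fun V p q => G V W p q r

theorem sumSplits₃_congr {X Z : Ob} (a : Chain H X Z)
    {G G' : ∀ V W, Chain H X V → Chain H V W → Chain H W Z → N}
    (h : ∀ V W (p : Chain H X V) (q : Chain H V W) (r : Chain H W Z),
      (p.comp q).comp r = a → G V W p q r = G' V W p q r) :
    a.sumSplits₃ G = a.sumSplits₃ G' :=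
  sumSplits_congr a fun _ _ _ hs => sumSplits_congr _ fun _ _ _ ht => h _ _ _ _ _ (by rw [ht, hs])

theorem sumSplits₃_add {X Z : Ob} (a : Chain H X Z)
    (G G' : ∀ V W, Chain H X V → Chain H V W → Chain H W Z → N) :
    (a.sumSplits₃ fun V W p q r => G V W p q r + G' V W p q r) =
      a.sumSplits₃ G + a.sumSplits₃ G' := by
  simp only [sumSplits₃, sumSplits_add]

theorem sumSplits₃_zero {X Z : Ob} (a : Chain H X Z) :
    (a.sumSplits₃ fun _ _ _ _ _ => (0 : N)) = 0 := by
  simp only [sumSplits₃, sumSplits_zero]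

theorem map_sumSplits₃ (φ : N →+ N') {X Z : Ob} (a : Chain H X Z)
    (G : ∀ V W, Chain H X V → Chain H V W → Chain H W Z → N) :
    φ (a.sumSplits₃ G) = a.sumSplits₃ fun V W p q r => φ (G V W p q r) := by
  simp only [sumSplits₃, map_sumSplits]

theorem sumSplits₃_mem {S : Type*} [SetLike S N] [AddSubmonoidClass S N] (s : S) {X Z : Ob}
    (a : Chain H X Z) {G : ∀ V W, Chain H X V → Chain H V W → Chain H W Z → N}
    (h : ∀ V W (p : Chain H X V) (q : Chain H V W) (r : Chain H W Z),
      (p.comp q).comp r = a → G V W p q r ∈ s) :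
    a.sumSplits₃ G ∈ s :=
  sumSplits_mem s a fun _ _ _ hs => sumSplits_mem s _ fun _ _ _ ht => h _ _ _ _ _ (by rw [ht, hs])

/-- The position of the middle piece of a cut in three relative to a given entry `f`: before,
around, or after it. -/
theorem sumSplits₃_cons_comp {A B C D : Ob} (p : Chain H A B) (f : H B C) (r : Chain H C D)
    (G : ∀ V W, Chain H A V → Chain H V W → Chain H W D → N) :
    ((p.cons f).comp r).sumSplits₃ G =
      (p.sumSplits₃ fun V W p₁ p₂ p₃ => G V W p₁ p₂ ((p₃.cons f).comp r)) +
      (p.sumSplits fun V p₁ p₂ => r.sumSplits fun W r₁ r₂ =>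
        G V W p₁ ((p₂.cons f).comp r₁) r₂) +
      r.sumSplits₃ fun V W r₁ r₂ r₃ => G V W ((p.cons f).comp r₁) r₂ r₃ := by
  simp only [sumSplits₃, sumSplits_cons_comp, sumSplits_add]
  rw [sumSplits_comm p r, add_assoc]

theorem sumSplits₃_cons {X Y Z : Ob} (p : Chain H X Y) (f : H Y Z)
    (G : ∀ V W, Chain H X V → Chain H V W → Chain H W Z → N) :
    (p.cons f).sumSplits₃ G =
      ((p.cons f).sumSplits fun V p q => G V Z p q (nil Z)) +
        p.sumSplits₃ fun V W p q r => G V W p q (r.cons f) := by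
  simp only [sumSplits₃, sumSplits_cons]

theorem sumSplits₃_eq_sumEntries {X Z : Ob} (a : Chain H X Z)
    (G : ∀ V W, Chain H X V → Chain H V W → Chain H W Z → N)
    (h : ∀ V W (p : Chain H X V) (q : Chain H V W) (r : Chain H W Z),
      (p.comp q).comp r = a → q.length ≠ 1 → G V W p q r = 0) :
    a.sumSplits₃ G = a.sumEntries fun V W p f r => G V W p (single f) r := by
  induction a with
  | nil =>
    simp only [sumSplits₃, sumSplits_nil, sumEntries]
    exact h _ _ _ _ _ rfl (by simp [length])
  | cons p f ih =>
    rw [sumSplits₃_cons, sumSplits_cons, h _ _ _ _ _ rfl (by simp [length]), zero_add,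
      sumSplits_eq_of_ne_nil, sumEntries, add_comm, ih]
    · rfl
    · intro V W p' q r hq
      exact h _ _ _ _ _ (by rw [← hq]; rfl)
    · intro V p' q hq hl
      exact h _ _ _ _ _ (by rw [← hq]; rfl) (by simpa [length] using hl)

theorem sumEntries_congr {X Z : Ob} (a : Chain H X Z)
    {G G' : ∀ V W, Chain H X V → H V W → Chain H W Z → N}
    (h : ∀ V W (p : Chain H X V) (f : H V W) (r : Chain H W Z),
      (p.cons f).comp r = a → G V W p f r = G' V W p f r) :
    a.sumEntries G = a.sumEntries G' := by
  induction a with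
  | nil => rfl
  | cons p f ih =>
    simp only [sumEntries]
    rw [h _ _ _ _ _ rfl, ih fun V W p' g r hq => h _ _ _ _ _ (by rw [← hq]; rfl)]

theorem sumEntries_zero {X Z : Ob} (a : Chain H X Z) :
    (a.sumEntries fun _ _ _ _ _ => (0 : N)) = 0 := by
  induction a with
  | nil => rfl
  | cons p f ih => simp only [sumEntries, ih, add_zero]

theorem sumEntries_add {X Z : Ob} (a : Chain H X Z)
    (G G' : ∀ V W, Chain H X V → H V W → Chain H W Z → N) :
    (a.sumEntries fun V W p f r => G V W p f r + G' V W p f r) =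
      a.sumEntries G + a.sumEntries G' := by
  induction a with
  | nil => simp only [sumEntries, add_zero]
  | cons p f ih =>
    simp only [sumEntries]
    rw [ih]
    abel

theorem map_sumEntries (φ : N →+ N') {X Z : Ob} (a : Chain H X Z)
    (G : ∀ V W, Chain H X V → H V W → Chain H W Z → N) :
    φ (a.sumEntries G) = a.sumEntries fun V W p f r => φ (G V W p f r) := by
  induction a with
  | nil => simp only [sumEntries, map_zero]
  | cons p f ih => simp only [sumEntries, map_add, ih]

theorem smul_sumSplits {k N : Type*} [Field k] [AddCommGroup N] [Module k N] (c : k) {X Z : Ob}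
    (a : Chain H X Z) (G : ∀ Y, Chain H X Y → Chain H Y Z → N) :
    c • a.sumSplits G = a.sumSplits fun Y p q => c • G Y p q :=
  map_sumSplits (DistribSMul.toAddMonoidHom N c) a G

theorem smul_sumSplits₃ {k N : Type*} [Field k] [AddCommGroup N] [Module k N] (c : k) {X Z : Ob}
    (a : Chain H X Z) (G : ∀ V W, Chain H X V → Chain H V W → Chain H W Z → N) :
    c • a.sumSplits₃ G = a.sumSplits₃ fun V W p q r => c • G V W p q r :=
  map_sumSplits₃ (DistribSMul.toAddMonoidHom N c) a G

theorem sumSplits₃_front {X Z : Ob} (a : Chain H X Z)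
    (G : ∀ U V W, Chain H X U → Chain H U V → Chain H V W → Chain H W Z → N) :
    (a.sumSplits₃ fun V W p q r => p.sumSplits fun U p₁ p₂ => G U V W p₁ p₂ q r) =
      a.sumSplits fun U p s => s.sumSplits₃ fun V W q₁ q₂ q₃ => G U V W p q₁ q₂ q₃ := by
  simp only [sumSplits₃]
  rw [← sumSplits_assoc]
  refine sumSplits_congr _ fun W s r _ => ?_
  exact sumSplits_assoc s fun U V p₁ p₂ q => G U V W p₁ p₂ q r

theorem sumSplits₃_back {X Z : Ob} (a : Chain H X Z)
    (G : ∀ U V W, Chain H X U → Chain H U V → Chain H V W → Chain H W Z → N) :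
    (a.sumSplits₃ fun U V p q r => r.sumSplits fun W r₁ r₂ => G U V W p q r₁ r₂) =
      a.sumSplits fun W s r => s.sumSplits₃ fun U V p₁ p₂ p₃ => G U V W p₁ p₂ p₃ r := by
  simp only [sumSplits₃]
  refine (sumSplits_congr a fun V s r _ => sumSplits_comm s r fun U p q W r₁ r₂ =>
    G U V W p q r₁ r₂).trans ?_
  exact (sumSplits_assoc a fun V W s r₁ r₂ => s.sumSplits fun U p q => G U V W p q r₁ r₂).symm

theorem sumSplits₃_middle {X Z : Ob} (a : Chain H X Z)
    (G : ∀ T U V W, Chain H X T → Chain H T U → Chain H U V → Chain H V W → Chain H W Z → N) :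
    (a.sumSplits₃ fun U V p q r => p.sumSplits fun T p₁ p₂ => r.sumSplits fun W r₁ r₂ =>
      G T U V W p₁ p₂ q r₁ r₂) =
      a.sumSplits₃ fun T W p s r => s.sumSplits₃ fun U V q₁ q₂ q₃ =>
        G T U V W p q₁ q₂ q₃ r := by
  have h : ∀ U V (p : Chain H X U) (q : Chain H U V) (r : Chain H V Z),
      (p.sumSplits fun T p₁ p₂ => r.sumSplits fun W r₁ r₂ => G T U V W p₁ p₂ q r₁ r₂) =
        r.sumSplits fun W r₁ r₂ => p.sumSplits fun T p₁ p₂ => G T U V W p₁ p₂ q r₁ r₂ :=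
    fun U V p q r => sumSplits_comm p r _
  simp only [h]
  rw [sumSplits₃_back]
  exact sumSplits_congr _ fun W s r _ => sumSplits₃_front s _

theorem sumSplits₃_sumSplits₃ {X Z : Ob} (a : Chain H X Z)
    (G : ∀ T U V W, Chain H X T → Chain H T U → Chain H U V → Chain H V W → Chain H W Z → N) :
    (a.sumSplits₃ fun T U p q r => r.sumSplits₃ fun V W r₁ r₂ r₃ => G T U V W p q r₁ r₂ r₃) =
      a.sumSplits₃ fun V W s q r => s.sumSplits₃ fun T U p₁ p₂ p₃ =>
        G T U V W p₁ p₂ p₃ q r := by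
  have h := sumSplits₃_back a fun T U W p q s r₃ =>
    s.sumSplits fun V r₁ r₂ => G T U V W p q r₁ r₂ r₃
  refine h.trans (sumSplits_congr _ fun W s r _ => ?_)
  exact sumSplits₃_back s fun T U V p q r₁ r₂ => G T U V W p q r₁ r₂ r

end Sums

/-! ### Applying endomorphisms to the entries of a chain -/

/-- Families of endomorphisms of the morphism spaces; they form a ring. -/
abbrev EndFam (k : Type w) [Field k] (H : Ob → Ob → Type v) [∀ X Y, AddCommGroup (H X Y)]
    [∀ X Y, Module k (H X Y)] : Type (max u v) :=
  ∀ X Y, Module.End k (H X Y)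

variable {k : Type w} [Field k] [∀ X Y, AddCommGroup (H X Y)] [∀ X Y, Module k (H X Y)]

/-- Apply a family of endomorphisms to all the entries of a chain. -/
def mapEnd (α : EndFam k H) {X Y : Ob} : Chain H X Y → Chain H X Y
  | nil X => nil X
  | cons p f => cons (mapEnd α p) (α _ _ f)

theorem map_id_eq_mapEnd (α : EndFam k H) {X Y : Ob} (p : Chain H X Y) :
    p.map id (fun {X Y} f => α X Y f) = p.mapEnd α := by
  induction p with
  | nil => rfl
  | cons p f ih => simp only [map, mapEnd, ih, id]

theorem mapEnd_comp (α : EndFam k H) {X Y Z : Ob} (p : Chain H X Y) (q : Chain H Y Z) :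
    (p.comp q).mapEnd α = (p.mapEnd α).comp (q.mapEnd α) := by
  induction q with
  | nil => rfl
  | cons q f ih => simp only [comp, mapEnd, ih]

theorem mapEnd_mul (α β : EndFam k H) {X Y : Ob} (p : Chain H X Y) :
    p.mapEnd (α * β) = (p.mapEnd β).mapEnd α := by
  induction p with
  | nil => rfl
  | cons p f ih => simp only [mapEnd, ih]; rfl

theorem mapEnd_one {X Y : Ob} (p : Chain H X Y) : p.mapEnd (1 : EndFam k H) = p := by
  induction p with
  | nil => rfl
  | cons p f ih => simp only [mapEnd, ih]; rfl

theorem length_mapEnd (α : EndFam k H) {X Y : Ob} (p : Chain H X Y) :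
    (p.mapEnd α).length = p.length := by
  induction p with
  | nil => rfl
  | cons p f ih => simp only [mapEnd, length, ih]

section Sums

variable {N : Type*} [AddCommMonoid N]

theorem sumSplits_mapEnd (α : EndFam k H) {X Z : Ob} (a : Chain H X Z)
    (G : ∀ Y, Chain H X Y → Chain H Y Z → N) :
    (a.mapEnd α).sumSplits G = a.sumSplits fun Y p q => G Y (p.mapEnd α) (q.mapEnd α) := by
  induction a with
  | nil => simp only [mapEnd, sumSplits_nil]
  | cons p f ih => simp only [mapEnd, sumSplits_cons, ih]

theorem sumSplits₃_mapEnd (α : EndFam k H) {X Z : Ob} (a : Chain H X Z)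
    (G : ∀ V W, Chain H X V → Chain H V W → Chain H W Z → N) :
    (a.mapEnd α).sumSplits₃ G =
      a.sumSplits₃ fun V W p q r => G V W (p.mapEnd α) (q.mapEnd α) (r.mapEnd α) := by
  simp only [sumSplits₃, sumSplits_mapEnd]

theorem sumEntries_mapEnd (α : EndFam k H) {X Z : Ob} (a : Chain H X Z)
    (G : ∀ V W, Chain H X V → H V W → Chain H W Z → N) :
    (a.mapEnd α).sumEntries G =
      a.sumEntries fun V W p f r => G V W (p.mapEnd α) (α _ _ f) (r.mapEnd α) := by
  induction a with
  | nil => rfl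
  | cons p f ih => simp only [mapEnd, sumEntries, ih]

end Sums

end Chain

end AInf

namespace AInf

/-! ### Multilinear operations -/

namespace MultiMap

open Chain

variable {k : Type w} [Field k] {Ob : Type u} {H : Ob → Ob → Type v}
    {M : Ob → Ob → Type v'} [∀ X Y, AddCommGroup (H X Y)] [∀ X Y, Module k (H X Y)]
    [∀ X Y, AddCommGroup (M X Y)] [∀ X Y, Module k (M X Y)]
    {M' : Ob → Ob → Type u'} [∀ X Y, AddCommGroup (M' X Y)] [∀ X Y, Module k (M' X Y)]

theorem ext_app {σ τ : MultiMap k H M} (h : ∀ X Y (a : Chain H X Y), σ.app a = τ.app a) :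
    σ = τ := by
  cases σ; cases τ
  congr
  funext X Y a
  exact h X Y a

instance : Zero (MultiMap k H M) :=
  ⟨{ app := fun _ => 0, app_add := by simp, app_smul := by simp }⟩

instance : Add (MultiMap k H M) :=
  ⟨fun σ τ =>
    { app := fun a => σ.app a + τ.app a
      app_add := fun p f g r => by rw [σ.app_add, τ.app_add]; abel
      app_smul := fun p t f r => by rw [σ.app_smul, τ.app_smul, smul_add] }⟩

instance : Neg (MultiMap k H M) :=
  ⟨fun σ =>
    { app := fun a => -σ.app a
      app_add := fun p f g r => by rw [σ.app_add, neg_add]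
      app_smul := fun p t f r => by rw [σ.app_smul, smul_neg] }⟩

theorem zero_app {X Y : Ob} (a : Chain H X Y) : (0 : MultiMap k H M).app a = 0 := rfl

theorem add_app (σ τ : MultiMap k H M) {X Y : Ob} (a : Chain H X Y) :
    (σ + τ).app a = σ.app a + τ.app a := rfl

theorem neg_app (σ : MultiMap k H M) {X Y : Ob} (a : Chain H X Y) : (-σ).app a = -σ.app a := rfl

instance : AddCommGroup (MultiMap k H M) where
  add_assoc σ τ ρ := ext_app fun _ _ _ => add_assoc _ _ _
  zero_add σ := ext_app fun _ _ _ => zero_add _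
  add_zero σ := ext_app fun _ _ _ => add_zero _
  add_comm σ τ := ext_app fun _ _ _ => add_comm _ _
  neg_add_cancel σ := ext_app fun _ _ _ => neg_add_cancel _
  nsmul := nsmulRec
  zsmul := zsmulRec

theorem sub_app (σ τ : MultiMap k H M) {X Y : Ob} (a : Chain H X Y) :
    (σ - τ).app a = σ.app a - τ.app a := by
  rw [sub_eq_add_neg, add_app, neg_app, sub_eq_add_neg]

/-- The additive map obtained by fixing all the arguments but one. -/
def slot (σ : MultiMap k H M) {W X Y Z : Ob} (p : Chain H W X) (r : Chain H Y Z) :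
    H X Y →+ M W Z where
  toFun f := σ.app ((p.cons f).comp r)
  map_zero' := σ.app_zero p r
  map_add' f g := σ.app_add p f g r

/-- The values of `ofLin t`. -/
def ofLinApp (t : ∀ X Y, H X Y →ₗ[k] M X Y) {X Y : Ob} : Chain H X Y → M X Y
  | .cons (.nil _) f => t _ _ f
  | _ => 0

theorem ofLinApp_of_length (t : ∀ X Y, H X Y →ₗ[k] M X Y) {X Y : Ob} (a : Chain H X Y)
    (h : a.length ≠ 1) : ofLinApp t a = 0 := by
  rcases a with _ | ⟨_ | ⟨p, c⟩, b⟩ <;> simp_all [ofLinApp, length]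

/-- The family of operations whose only non-zero term is a given unary operation. -/
def ofLin (t : ∀ X Y, H X Y →ₗ[k] M X Y) : MultiMap k H M where
  app a := ofLinApp t a
  app_add p f g r := by
    by_cases h : p.length + 1 + r.length = 1
    · rcases p with _ | ⟨p, b⟩ <;> rcases r with _ | ⟨r, b'⟩ <;>
        first
        | (simp only [length] at h; omega)
        | simp [comp, ofLinApp]
    · rw [ofLinApp_of_length, ofLinApp_of_length, ofLinApp_of_length, add_zero] <;>
        simpa only [length_comp, length] using h
  app_smul p c f r := by
    by_cases h : p.length + 1 + r.length = 1
    · rcases p with _ | ⟨p, b⟩ <;> rcases r with _ | ⟨r, b'⟩ <;>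
        first
        | (simp only [length] at h; omega)
        | simp [comp, ofLinApp]
    · rw [ofLinApp_of_length, ofLinApp_of_length, smul_zero] <;>
        simpa only [length_comp, length] using h

theorem ofLin_app_of_length (t : ∀ X Y, H X Y →ₗ[k] M X Y) {X Y : Ob} {a : Chain H X Y}
    (h : a.length ≠ 1) : (ofLin t).app a = 0 :=
  ofLinApp_of_length t a h

/-- The family of operations assembled from the arity `n` terms of `σ n`. -/
def glue (σ : ℕ → MultiMap k H M) : MultiMap k H M where
  app a := (σ a.length).app a
  app_add p f g r := by
    simp only [length_comp, length, (σ _).app_add]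
  app_smul p c f r := by
    simp only [length_comp, length, (σ _).app_smul]

/-- The arity `n` term of `σ`. -/
def part (n : ℕ) (σ : MultiMap k H M) : MultiMap k H M := glue fun m => if m = n then σ else 0

theorem part_app_self (σ : MultiMap k H M) {n : ℕ} {X Y : Ob} {a : Chain H X Y}
    (h : a.length = n) : (part n σ).app a = σ.app a := by
  simp only [part, glue, h, if_true]

theorem part_app_of_ne (σ : MultiMap k H M) {n : ℕ} {X Y : Ob} {a : Chain H X Y}
    (h : a.length ≠ n) : (part n σ).app a = 0 := by
  simp only [part, glue, h, if_false, zero_app]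

/-- Postcomposition with linear maps. -/
def post (L : ∀ X Y, M X Y →ₗ[k] M' X Y) (σ : MultiMap k H M) : MultiMap k H M' where
  app a := L _ _ (σ.app a)
  app_add p f g r := by rw [σ.app_add, map_add]
  app_smul p c f r := by rw [σ.app_smul, map_smul]

/-- Precomposition with endomorphisms of all the arguments. -/
def pre (σ : MultiMap k H M) (α : EndFam k H) : MultiMap k H M where
  app a := σ.app (a.mapEnd α)
  app_add p f g r := by simp only [mapEnd_comp, mapEnd, map_add, σ.app_add]
  app_smul p c f r := by simp only [mapEnd_comp, mapEnd, map_smul, σ.app_smul]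

theorem app_lin (σ : MultiMap k H M) {W X Y Z : Ob} (p : Chain H W X) (c : k) (f g : H X Y)
    (r : Chain H Y Z) :
    σ.app ((p.cons (c • f + g)).comp r) = c • σ.app ((p.cons f).comp r) +
      σ.app ((p.cons g).comp r) := by
  rw [σ.app_add, σ.app_smul]

/-- A function on chains which is linear in every entry, as a `MultiMap`; it is enough to test
linearity on combinations `c • f + g`. -/
def ofLinear (app : ∀ {X Y : Ob}, Chain H X Y → M X Y)
    (h : ∀ {W X Y Z : Ob} (p : Chain H W X) (c : k) (f g : H X Y) (r : Chain H Y Z),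
      app ((p.cons (c • f + g)).comp r) =
        c • app ((p.cons f).comp r) + app ((p.cons g).comp r)) : MultiMap k H M where
  app := app
  app_add p f g r := by simpa using h p 1 f g r
  app_smul p c f r := by
    have h0 := h p 1 (0 : H _ _) 0 r
    have h1 := h p c f 0 r
    rw [one_smul, one_smul, add_zero, left_eq_add] at h0
    rwa [add_zero, h0, add_zero] at h1

/-- Insertion of `τ` into `σ`, with `α` applied to the arguments in front of the insertion and `β`
to those behind it: `a ↦ ∑ σ(β r, τ(q), α p)` over all decompositions `a = (r, q, p)`. -/
def ins (α : EndFam k H) (σ : MultiMap k H M) (τ : MultiMap k H H) (β : EndFam k H) :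
    MultiMap k H M :=
  ofLinear
    (fun a => a.sumSplits₃ fun _ _ p q r =>
      σ.app (((p.mapEnd α).cons (τ.app q)).comp (r.mapEnd β)))
    fun p c f g r => by
      simp only [sumSplits₃_cons_comp, smul_add, smul_sumSplits₃, smul_sumSplits]
      have e : ∀ {A B : Ob} (x₁ x₂ x₃ y₁ y₂ y₃ : M A B),
          x₁ + y₁ + (x₂ + y₂) + (x₃ + y₃) = x₁ + x₂ + x₃ + (y₁ + y₂ + y₃) := by
        intros; abel
      refine Eq.trans ?_ (e _ _ _ _ _ _)
      rw [← sumSplits₃_add, ← sumSplits₃_add, ← sumSplits_add]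
      simp only [← sumSplits_add]
      congr 1
      · congr 1
        · refine sumSplits₃_congr _ fun V W p₁ p₂ p₃ _ => ?_
          simp only [mapEnd_comp, mapEnd, map_add, map_smul, ← comp_assoc]
          exact σ.app_lin _ c _ _ _
        · simp only [τ.app_lin, σ.app_lin]
      · refine sumSplits₃_congr _ fun V W r₁ r₂ r₃ _ => ?_
        have e : ∀ x, ((((p.cons x).comp r₁).mapEnd α).cons (τ.app r₂)).comp (r₃.mapEnd β) =
            ((p.mapEnd α).cons (α _ _ x)).comp (((r₁.mapEnd α).cons (τ.app r₂)).comp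
              (r₃.mapEnd β)) := fun x => by
          rw [mapEnd_comp, mapEnd, ← comp_assoc]; rfl
        rw [e, e, e, map_add, map_smul]
        exact σ.app_lin _ c _ _ _

theorem ins_app (α : EndFam k H) (σ : MultiMap k H M) (τ : MultiMap k H H) (β : EndFam k H)
    {X Y : Ob} (a : Chain H X Y) :
    (ins α σ τ β).app a = a.sumSplits₃ fun _ _ p q r =>
      σ.app (((p.mapEnd α).cons (τ.app q)).comp (r.mapEnd β)) := rfl

/-- The product of two families of operations with respect to a bilinear composition `m`:
`a ↦ ∑ m(φ(q), ψ(p))` over all decompositions `a = (q, p)`. -/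
def star (m : ∀ X Y Z, M Y Z →ₗ[k] M X Y →ₗ[k] M X Z) (φ ψ : MultiMap k H M) : MultiMap k H M :=
  ofLinear (fun a => a.sumSplits fun _ p q => m _ _ _ (φ.app q) (ψ.app p))
    fun p c f g r => by
      simp only [sumSplits_cons_comp, smul_add, smul_sumSplits]
      refine Eq.trans ?_ (add_add_add_comm _ _ _ _)
      rw [← sumSplits_add, ← sumSplits_add]
      simp only [φ.app_lin, ψ.app_lin, map_add, map_smul, LinearMap.add_apply,
        LinearMap.smul_apply]

theorem star_app (m : ∀ X Y Z, M Y Z →ₗ[k] M X Y →ₗ[k] M X Z) (φ ψ : MultiMap k H M) {X Y : Ob}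
    (a : Chain H X Y) :
    (star m φ ψ).app a = a.sumSplits fun _ p q => m _ _ _ (φ.app q) (ψ.app p) := rfl

section Additivity

variable (m : ∀ X Y Z, M Y Z →ₗ[k] M X Y →ₗ[k] M X Z)

theorem add_star (φ φ' ψ : MultiMap k H M) :
    star m (φ + φ') ψ = star m φ ψ + star m φ' ψ :=
  ext_app fun _ _ _ => by
    simp only [add_app, star_app, map_add, LinearMap.add_apply, sumSplits_add]

theorem star_add (φ ψ ψ' : MultiMap k H M) :
    star m φ (ψ + ψ') = star m φ ψ + star m φ ψ' :=
  ext_app fun _ _ _ => by simp only [add_app, star_app, map_add, sumSplits_add]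

theorem add_ins (α β : EndFam k H) (σ σ' : MultiMap k H M) (τ : MultiMap k H H) :
    ins α (σ + σ') τ β = ins α σ τ β + ins α σ' τ β :=
  ext_app fun _ _ _ => by simp only [add_app, ins_app, sumSplits₃_add]

theorem ins_add (α β : EndFam k H) (σ : MultiMap k H M) (τ τ' : MultiMap k H H) :
    ins α σ (τ + τ') β = ins α σ τ β + ins α σ τ' β :=
  ext_app fun _ _ _ => by simp only [add_app, ins_app, σ.app_add, sumSplits₃_add]

theorem post_add (L : ∀ X Y, M X Y →ₗ[k] M' X Y) (σ σ' : MultiMap k H M) :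
    post L (σ + σ') = post L σ + post L σ' :=
  ext_app fun _ _ _ => map_add _ _ _

theorem neg_star (φ ψ : MultiMap k H M) : star m (-φ) ψ = -star m φ ψ := by
  rw [eq_neg_iff_add_eq_zero, ← add_star, neg_add_cancel]
  simpa using add_star m 0 0 ψ

theorem sub_star (φ φ' ψ : MultiMap k H M) :
    star m (φ - φ') ψ = star m φ ψ - star m φ' ψ := by
  rw [sub_eq_add_neg, add_star, neg_star, sub_eq_add_neg]

theorem star_neg (φ ψ : MultiMap k H M) : star m φ (-ψ) = -star m φ ψ := by
  rw [eq_neg_iff_add_eq_zero, ← star_add, neg_add_cancel]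
  simpa using star_add m φ 0 0

theorem star_sub (φ ψ ψ' : MultiMap k H M) :
    star m φ (ψ - ψ') = star m φ ψ - star m φ ψ' := by
  rw [sub_eq_add_neg, star_add, star_neg, sub_eq_add_neg]

theorem neg_ins (α β : EndFam k H) (σ : MultiMap k H M) (τ : MultiMap k H H) :
    ins α (-σ) τ β = -ins α σ τ β := by
  rw [eq_neg_iff_add_eq_zero, ← add_ins, neg_add_cancel]
  simpa using add_ins α β (0 : MultiMap k H M) 0 τ

theorem sub_ins (α β : EndFam k H) (σ σ' : MultiMap k H M) (τ : MultiMap k H H) :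
    ins α (σ - σ') τ β = ins α σ τ β - ins α σ' τ β := by
  rw [sub_eq_add_neg, add_ins, neg_ins, sub_eq_add_neg]

theorem ins_zero (α β : EndFam k H) (σ : MultiMap k H M) : ins α σ 0 β = 0 := by
  simpa using ins_add α β σ 0 (0 : MultiMap k H H)

theorem ins_neg (α β : EndFam k H) (σ : MultiMap k H M) (τ : MultiMap k H H) :
    ins α σ (-τ) β = -ins α σ τ β := by
  rw [eq_neg_iff_add_eq_zero, ← ins_add, neg_add_cancel, ins_zero]

theorem ins_sub (α β : EndFam k H) (σ : MultiMap k H M) (τ τ' : MultiMap k H H) :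
    ins α σ (τ - τ') β = ins α σ τ β - ins α σ τ' β := by
  rw [sub_eq_add_neg, ins_add, ins_neg, sub_eq_add_neg]

theorem post_neg (L : ∀ X Y, M X Y →ₗ[k] M' X Y) (σ : MultiMap k H M) :
    post L (-σ) = -post L σ :=
  ext_app fun _ _ _ => map_neg _ _

theorem post_sub (L : ∀ X Y, M X Y →ₗ[k] M' X Y) (σ σ' : MultiMap k H M) :
    post L (σ - σ') = post L σ - post L σ' := by
  rw [sub_eq_add_neg, post_add, post_neg, sub_eq_add_neg]

theorem post_ins (L : ∀ X Y, M X Y →ₗ[k] M' X Y) (α β : EndFam k H) (σ : MultiMap k H M)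
    (τ : MultiMap k H H) : post L (ins α σ τ β) = ins α (post L σ) τ β :=
  ext_app fun X Y a => map_sumSplits₃ (L X Y).toAddMonoidHom a
    fun _ _ p q r => σ.app (((p.mapEnd α).cons (τ.app q)).comp (r.mapEnd β))

theorem pre_one (σ : MultiMap k H M) : σ.pre 1 = σ :=
  ext_app fun _ _ a => congrArg σ.app a.mapEnd_one

end Additivity

/-! ### The Leibniz rule and the pre-Lie identity -/

/-- Insertion is a derivation of the product, up to the twist by `α`. -/
theorem star_ins (m : ∀ X Y Z, M Y Z →ₗ[k] M X Y →ₗ[k] M X Z) (α : EndFam k H)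
    (φ ψ : MultiMap k H M) (τ : MultiMap k H H) :
    ins α (star m φ ψ) τ 1 = star m (ins α φ τ 1) (ψ.pre α) + star m φ (ins α ψ τ 1) := by
  refine ext_app fun X Z a => ?_
  have h1 : ∀ Y (p : Chain H X Y) (q : Chain H Y Z),
      m _ _ _ ((ins α φ τ 1).app q) ((ψ.pre α).app p) = q.sumSplits₃ fun _ _ q₁ q₂ q₃ =>
        m _ _ _ (φ.app (((q₁.mapEnd α).cons (τ.app q₂)).comp q₃)) (ψ.app (p.mapEnd α)) := by
    intro Y p q
    rw [ins_app]
    simp only [mapEnd_one]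
    exact map_sumSplits₃ ((m _ _ _).flip _).toAddMonoidHom _ _
  have h2 : ∀ Y (p : Chain H X Y) (q : Chain H Y Z),
      m _ _ _ (φ.app q) ((ins α ψ τ 1).app p) = p.sumSplits₃ fun _ _ p₁ p₂ p₃ =>
        m _ _ _ (φ.app q) (ψ.app (((p₁.mapEnd α).cons (τ.app p₂)).comp p₃)) := by
    intro Y p q
    rw [ins_app]
    simp only [mapEnd_one]
    exact map_sumSplits₃ (m _ _ _ _).toAddMonoidHom _ _
  rw [ins_app, add_app, star_app, star_app]
  simp only [star_app, sumSplits_cons_comp, h1, h2, mapEnd_one, sumSplits_mapEnd]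
  rw [sumSplits₃_add]
  congr 1
  · rw [← sumSplits₃_front]
  · rw [← sumSplits₃_back]

/-- The terms in which `τ` and `ρ` are inserted into two different entries of `σ`, that of `τ`
being in front of that of `ρ`. -/
def insTwo (α β : EndFam k H) (σ : MultiMap k H M) (τ ρ : MultiMap k H H) {X Y : Ob}
    (a : Chain H X Y) : M X Y :=
  a.sumSplits₃ fun _ _ s q r => s.sumSplits₃ fun _ _ p₁ p₂ p₃ =>
    σ.app (((p₁.mapEnd (α * β)).cons (β _ _ (τ.app p₂))).comp
      (((p₃.mapEnd β).cons (ρ.app q)).comp r))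

theorem ins_ins_app (α β : EndFam k H) (hαβ : α * β = β * α) (s : k)
    (σ : MultiMap k H M) (τ ρ : MultiMap k H H)
    (hτ : ∀ X Y (a : Chain H X Y), τ.app (a.mapEnd β) = s • β X Y (τ.app a))
    {X Y : Ob} (a : Chain H X Y) :
    (ins β (ins α σ τ 1) ρ 1).app a = (ins (α * β) σ (ins β τ ρ 1) 1).app a +
      s • insTwo α β σ τ ρ a + insTwo β α σ ρ τ a := by
  have h1 : s • insTwo α β σ τ ρ a = a.sumSplits₃ fun _ _ p q r =>
      (p.mapEnd β).sumSplits₃ fun _ _ p₁ p₂ p₃ =>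
        σ.app (((p₁.mapEnd α).cons (τ.app p₂)).comp ((p₃.cons (ρ.app q)).comp r)) := by
    simp only [insTwo, smul_sumSplits₃, sumSplits₃_mapEnd, hτ, ← mapEnd_mul, σ.app_smul]
  have h2 : insTwo β α σ ρ τ a = a.sumSplits₃ fun _ _ p q r => r.sumSplits₃ fun _ _ r₁ r₂ r₃ =>
      σ.app ((((((p.mapEnd β).cons (ρ.app q)).comp r₁).mapEnd α).cons (τ.app r₂)).comp r₃) := by
    rw [insTwo, ← sumSplits₃_sumSplits₃]
    simp only [mapEnd_comp, mapEnd, ← mapEnd_mul, hαβ, ← comp_assoc]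
    rfl
  have h3 : (ins (α * β) σ (ins β τ ρ 1) 1).app a = a.sumSplits₃ fun _ _ p q r =>
      (p.mapEnd β).sumSplits fun _ p₁ p₂ => r.sumSplits fun _ r₁ r₂ =>
        σ.app (((p₁.mapEnd α).cons (τ.app ((p₂.cons (ρ.app q)).comp r₁))).comp r₂) := by
    simp only [sumSplits_mapEnd]
    rw [sumSplits₃_middle, ins_app]
    refine sumSplits₃_congr _ fun V W p q r _ => ?_
    rw [ins_app, mapEnd_one]
    refine (map_sumSplits₃ (σ.slot _ r) q _).trans ?_
    simp only [mapEnd_one, mapEnd_mul]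
    rfl
  rw [h1, h2, h3, ← sumSplits₃_add, ← sumSplits₃_add, ins_app]
  refine sumSplits₃_congr _ fun V W p q r _ => ?_
  rw [mapEnd_one, ins_app, sumSplits₃_cons_comp]
  simp only [mapEnd_one]
  abel

/-- The pre-Lie identity: the associator of insertion is symmetric in the two inserted
operations. Here `s = ±1` is the Koszul sign of exchanging `τ` and `ρ`. -/
theorem ins_ins (α β : EndFam k H) (hαβ : α * β = β * α) (s : k) (hs : s * s = 1)
    (σ : MultiMap k H M) (τ ρ : MultiMap k H H)
    (hτ : ∀ X Y (a : Chain H X Y), τ.app (a.mapEnd β) = s • β X Y (τ.app a))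
    (hρ : ∀ X Y (a : Chain H X Y), ρ.app (a.mapEnd α) = s • α X Y (ρ.app a))
    {X Y : Ob} (a : Chain H X Y) :
    (ins β (ins α σ τ 1) ρ 1).app a - s • (ins α (ins β σ ρ 1) τ 1).app a =
      (ins (α * β) σ (ins β τ ρ 1) 1).app a - s • (ins (α * β) σ (ins α ρ τ 1) 1).app a := by
  rw [ins_ins_app α β hαβ s σ τ ρ hτ, ins_ins_app β α hαβ.symm s σ ρ τ hρ, hαβ]
  simp only [smul_add, smul_smul, hs, one_smul]
  abel

end MultiMap

end AInf

namespace AInf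

/-! ### The contracting homotopy on chains -/

namespace Chain

variable {k : Type w} [Field k] {Ob : Type u} {H : Ob → Ob → Type v}
  [∀ X Y, AddCommGroup (H X Y)] [∀ X Y, Module k (H X Y)]

/-- A function on chains with given end points is additive in each entry. -/
def IsAdditive {N : Type*} [AddCommGroup N] {X Z : Ob} (σ : Chain H X Z → N) : Prop :=
  ∀ ⦃V W : Ob⦄ (p : Chain H X V) (f g : H V W) (r : Chain H W Z),
    σ ((p.cons (f + g)).comp r) = σ ((p.cons f).comp r) + σ ((p.cons g).comp r)

namespace IsAdditive

variable {N : Type*} [AddCommGroup N] {X Y Z : Ob}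

omit [Field k] [∀ X Y, Module k (H X Y)] in
theorem fix {σ : Chain H X Z → N} (hσ : IsAdditive σ) (f : H Y Z) :
    IsAdditive fun p : Chain H X Y => σ (p.cons f) :=
  fun _ _ p g g' r => hσ p g g' (r.cons f)

theorem zero {σ : Chain H X Z → N} (hσ : IsAdditive σ) {V W : Ob} (p : Chain H X V)
    (r : Chain H W Z) : σ ((p.cons 0).comp r) = 0 := by
  simpa using hσ p 0 0 r

theorem neg {σ : Chain H X Z → N} (hσ : IsAdditive σ) {V W : Ob} (p : Chain H X V) (f : H V W)
    (r : Chain H W Z) : σ ((p.cons (-f)).comp r) = -σ ((p.cons f).comp r) := by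
  rw [eq_neg_iff_add_eq_zero, ← hσ, neg_add_cancel, hσ.zero]

theorem last_zero {σ : Chain H X Z → N} (hσ : IsAdditive σ) (p : Chain H X Y) :
    σ (p.cons 0) = 0 :=
  hσ.zero p (nil Z)

theorem last_add {σ : Chain H X Z → N} (hσ : IsAdditive σ) (p : Chain H X Y) (f g : H Y Z) :
    σ (p.cons (f + g)) = σ (p.cons f) + σ (p.cons g) :=
  hσ p f g (nil Z)

end IsAdditive

variable {N : Type*} [AddCommGroup N]

/-- The sum of the values of `σ` on the chains obtained from `a` by applying `t` to one entry, `α`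
to those in front of it, and `β` to those behind it. -/
def insLin (α t β : EndFam k H) {X Z : Ob} (σ : Chain H X Z → N) (a : Chain H X Z) : N :=
  a.sumEntries fun _ _ p f r => σ (((p.mapEnd α).cons (t _ _ f)).comp (r.mapEnd β))

theorem insLin_cons (α t β : EndFam k H) {X Y Z : Ob} (σ : Chain H X Z → N) (p : Chain H X Y)
    (f : H Y Z) :
    insLin α t β σ (p.cons f) =
      insLin α t β (fun q => σ (q.cons (β _ _ f))) p + σ ((p.mapEnd α).cons (t _ _ f)) := rfl

theorem insLin_add (α t β : EndFam k H) {X Z : Ob} (σ σ' : Chain H X Z → N) (a : Chain H X Z) :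
    insLin α t β (fun b => σ b + σ' b) a = insLin α t β σ a + insLin α t β σ' a :=
  sumEntries_add a _ _

theorem insLin_zero (α t β : EndFam k H) {X Z : Ob} (a : Chain H X Z) :
    insLin α t β (fun _ : Chain H X Z => (0 : N)) a = 0 :=
  sumEntries_zero a

/-- If `α` anticommutes with `t`, then the insertion of `t` anticommutes with `α`. -/
theorem insLin_comp_mapEnd (α t : EndFam k H) (h : α * t = -(t * α)) {X Z : Ob}
    (σ : Chain H X Z → N) (hσ : IsAdditive σ) (a : Chain H X Z) :
    insLin α t 1 (fun b => σ (b.mapEnd α)) a + insLin α t 1 σ (a.mapEnd α) = 0 := by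
  rw [insLin, insLin, sumEntries_mapEnd, ← sumEntries_add]
  refine (sumEntries_congr a fun V W p f r _ => ?_).trans (sumEntries_zero a)
  have e : α V W (t V W f) = -(t V W (α V W f)) := LinearMap.congr_fun (congrFun₂ h V W) f
  rw [mapEnd_one, mapEnd_one, mapEnd_comp, mapEnd, e, hσ.neg, neg_add_cancel]

/-- The tensor homotopy: if `h` is a homotopy between the identity and `π` for the differential
`d`, then `K σ (a_d, …, a₁) = ∑ ± σ(π a_d, …, h a_i, …, a₁)` is a homotopy between the identity and
the pullback by `π`, for the induced differential on multilinear functions. -/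
theorem insLin_homotopy (κ d h π : EndFam k H) (hκ : κ * κ = 1) (hd : κ * d = -(d * κ))
    (hπ : π = 1 - d * h - h * d) (hπd : π * d = 0) (hdπ : d * π = 0) {X Z : Ob}
    (σ : Chain H X Z → N) (hσ : IsAdditive σ) (a : Chain H X Z) :
    insLin κ d 1 (insLin κ h π σ) a + insLin κ h π (insLin κ d 1 σ) a =
      σ a - σ (a.mapEnd π) := by
  induction a with
  | nil => simp [insLin, sumEntries, mapEnd]
  | cons p f ih =>
    rename_i Y Z
    have eκ : (p.mapEnd κ).mapEnd κ = p := by rw [← mapEnd_mul, hκ, mapEnd_one]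
    have e1 : π Y Z (d Y Z f) = 0 := LinearMap.congr_fun (congrFun₂ hπd Y Z) f
    have e2 : d Y Z (π Y Z f) = 0 := LinearMap.congr_fun (congrFun₂ hdπ Y Z) f
    have e3 : f = π Y Z f + (d Y Z (h Y Z f) + h Y Z (d Y Z f)) := by
      rw [hπ]
      change f = f - d Y Z (h Y Z f) - h Y Z (d Y Z f) + _
      abel
    have h1 : insLin κ d 1 (insLin κ h π σ) (p.cons f) =
        insLin κ d 1 (insLin κ h π fun q => σ (q.cons (π _ _ f))) p +
          insLin κ d 1 (fun q => σ ((q.mapEnd κ).cons (h _ _ f))) p +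
          σ (p.cons (h _ _ (d _ _ f))) := by
      rw [insLin_cons]
      simp only [insLin_cons κ h π, e1, eκ, hσ.last_zero]
      rw [insLin_zero, zero_add, insLin_add]
      rfl
    have h2 : insLin κ h π (insLin κ d 1 σ) (p.cons f) =
        insLin κ h π (insLin κ d 1 fun q => σ (q.cons (π _ _ f))) p +
          insLin κ d 1 (fun q => σ (q.cons (h _ _ f))) (p.mapEnd κ) +
          σ (p.cons (d _ _ (h _ _ f))) := by
      rw [insLin_cons]
      simp only [insLin_cons κ d 1, e2, eκ, hσ.last_zero, add_zero]
      rw [add_assoc]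
      rfl
    have h3 := insLin_comp_mapEnd κ d hd _ (hσ.fix (h _ _ f)) p
    have h4 := ih _ (hσ.fix (π _ _ f))
    have h5 : σ (p.cons f) = σ (p.cons (π _ _ f)) + (σ (p.cons (d _ _ (h _ _ f))) +
        σ (p.cons (h _ _ (d _ _ f)))) := by
      rw [← hσ.last_add, ← hσ.last_add, ← e3]
    rw [h1, h2, h5]
    calc _ = (insLin κ d 1 (insLin κ h π fun q => σ (q.cons (π _ _ f))) p +
          insLin κ h π (insLin κ d 1 fun q => σ (q.cons (π _ _ f))) p) +
          (insLin κ d 1 (fun q => σ ((q.mapEnd κ).cons (h _ _ f))) p +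
          insLin κ d 1 (fun q => σ (q.cons (h _ _ f))) (p.mapEnd κ)) +
          (σ (p.cons (d _ _ (h _ _ f))) + σ (p.cons (h _ _ (d _ _ f)))) := by abel
      _ = _ := by
        rw [h3, h4, mapEnd]
        abel

end Chain

end AInf

namespace AInf

/-! ### Degrees and Koszul signs -/

namespace GradedQuiver

open Chain MultiMap

variable {k : Type w} [Field k] (Q : GradedQuiver.{u, v, w} k) (Q' : GradedQuiver.{u', v', w} k)

/-- The sign operators `koszul e` of all the morphism spaces. -/
def koszulEnd (e : ℤ) : EndFam k Q.Hom := fun _ _ => Q.koszul e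

/-- The Euler operator, multiplication by `n` in degree `n`. -/
def euler (X Y : Q.Ob) : Q.Hom X Y →ₗ[k] Q.Hom X Y :=
  DirectSum.toModule k ℤ _ fun n => (n : k) • Q.of n

variable {Q Q'}

theorem mem_range_of_congr {X Y : Q.Ob} {n n' : ℤ} {x : Q.Hom X Y}
    (h : x ∈ LinearMap.range (Q.of (X := X) (Y := Y) n)) (e : n = n') :
    x ∈ LinearMap.range (Q.of (X := X) (Y := Y) n') := e ▸ h

theorem euler_of {X Y : Q.Ob} (n : ℤ) (f : Q.hom X Y n) :
    Q.euler X Y (Q.of n f) = (n : k) • Q.of n f := by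
  simp [euler, of]

theorem euler_of_mem {X Y : Q.Ob} {n : ℤ} {x : Q.Hom X Y}
    (hx : x ∈ LinearMap.range (Q.of (X := X) (Y := Y) n)) : Q.euler X Y x = (n : k) • x := by
  obtain ⟨f, rfl⟩ := hx
  exact euler_of n f

theorem koszul_of_mem (e : ℤ) {X Y : Q.Ob} {n : ℤ} {x : Q.Hom X Y}
    (hx : x ∈ LinearMap.range (Q.of (X := X) (Y := Y) n)) :
    Q.koszul e x = ((-1 : k) ^ (e * (n - 1))) • x := by
  obtain ⟨f, rfl⟩ := hx
  exact Q.koszul_of e n f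

theorem linearMap_ext {X Y : Q.Ob} {N : Type*} [AddCommGroup N] [Module k N]
    {L L' : Q.Hom X Y →ₗ[k] N} (h : ∀ n f, L (Q.of n f) = L' (Q.of n f)) : L = L' :=
  DirectSum.linearMap_ext k fun n => LinearMap.ext fun f => h n f

theorem koszulEnd_mul (e e' : ℤ) : Q.koszulEnd e * Q.koszulEnd e' = Q.koszulEnd (e + e') := by
  funext X Y
  refine linearMap_ext fun n f => ?_
  change Q.koszul e (Q.koszul e' (Q.of n f)) = Q.koszul (e + e') (Q.of n f)
  rw [koszul_of, map_smul, koszul_of, koszul_of, smul_smul, ← zpow_add₀ (by simp)]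
  congr 2
  ring

theorem koszulEnd_of_even {e : ℤ} (he : Even e) : Q.koszulEnd e = 1 := by
  funext X Y
  refine linearMap_ext fun n f => ?_
  change Q.koszul e (Q.of n f) = Q.of n f
  rw [koszul_of, (he.mul_right _).neg_one_zpow, one_smul]

theorem koszulEnd_one_mul_self : Q.koszulEnd 1 * Q.koszulEnd 1 = 1 := by
  rw [koszulEnd_mul, koszulEnd_of_even (by decide)]

theorem conv_eq_ins {M : Q.Ob → Q.Ob → Type v'} [∀ X Y, AddCommGroup (M X Y)]
    [∀ X Y, Module k (M X Y)] (e : ℤ) (σ : MultiMap k Q.Hom M) (τ : MultiMap k Q.Hom Q.Hom)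
    {X Y : Q.Ob} (a : Chain Q.Hom X Y) :
    Q.conv e σ τ a = (ins (Q.koszulEnd e) σ τ 1).app a := by
  rw [ins_app]
  simp only [mapEnd_one]
  simp only [← map_id_eq_mapEnd]
  rfl

/-- The endomorphisms preserve degrees. -/
def IsGraded (α : EndFam k Q.Hom) : Prop :=
  ∀ X Y (n : ℤ) (f : Q.hom X Y n), α X Y (Q.of n f) ∈ LinearMap.range (Q.of (X := X) (Y := Y) n)

theorem isGraded_one : IsGraded (1 : EndFam k Q.Hom) := fun _ _ _ f => ⟨f, rfl⟩

theorem isGraded_koszulEnd (e : ℤ) : IsGraded (Q.koszulEnd e) := fun X Y n f => by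
  change Q.koszul e _ ∈ _
  rw [koszul_of]
  exact Submodule.smul_mem _ _ ⟨f, rfl⟩

theorem IsHomog.congr {X Y : Q.Ob} {p : Chain Q.Hom X Y} {n n' : ℤ} (h : Q.IsHomog p n)
    (e : n = n') : Q.IsHomog p n' := e ▸ h

theorem IsHomog.cons_mem {X Y Z : Q.Ob} {p : Chain Q.Hom X Y} {n : ℤ} (hp : Q.IsHomog p n)
    {m : ℤ} {f : Q.Hom Y Z} (hf : f ∈ LinearMap.range (Q.of (X := Y) (Y := Z) m)) :
    Q.IsHomog (p.cons f) (n + (m - 1)) := by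
  obtain ⟨f, rfl⟩ := hf
  exact hp.cons m f

theorem IsHomog.exists_of_cons {X Y Z : Q.Ob} {p : Chain Q.Hom X Y} {f : Q.Hom Y Z} {n : ℤ}
    (h : Q.IsHomog (p.cons f) n) : ∃ n' m, Q.IsHomog p n' ∧
      f ∈ LinearMap.range (Q.of (X := Y) (Y := Z) m) ∧ n' + (m - 1) = n := by
  cases h with
  | cons hp m f => exact ⟨_, m, hp, ⟨f, rfl⟩, rfl⟩

theorem IsHomog.comp {X Y Z : Q.Ob} {p : Chain Q.Hom X Y} {q : Chain Q.Hom Y Z} {m n : ℤ}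
    (hp : Q.IsHomog p m) (hq : Q.IsHomog q n) : Q.IsHomog (p.comp q) (m + n) := by
  induction hq with
  | nil => exact hp.congr (add_zero m).symm
  | cons _ l f ih => exact (ih.cons l f).congr (add_assoc _ _ _)

theorem IsHomog.exists_of_comp {X Y Z : Q.Ob} {p : Chain Q.Hom X Y} {q : Chain Q.Hom Y Z} {n : ℤ}
    (h : Q.IsHomog (p.comp q) n) :
    ∃ n₁ n₂, Q.IsHomog p n₁ ∧ Q.IsHomog q n₂ ∧ n₁ + n₂ = n := by
  induction q generalizing n with
  | nil => exact ⟨n, 0, h, .nil _, add_zero n⟩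
  | cons q f ih =>
    obtain ⟨n', m, hp, hf, rfl⟩ := IsHomog.exists_of_cons h
    obtain ⟨n₁, n₂, h₁, h₂, rfl⟩ := ih hp
    exact ⟨n₁, _, h₁, h₂.cons_mem hf, by ring⟩

theorem IsHomog.mapEnd {α : EndFam k Q.Hom} (hα : IsGraded α) {X Y : Q.Ob}
    {p : Chain Q.Hom X Y} {n : ℤ} (hp : Q.IsHomog p n) : Q.IsHomog (p.mapEnd α) n := by
  induction hp with
  | nil => exact .nil _
  | cons _ m f ih => exact ih.cons_mem (hα _ _ m f)

/-- Operations which agree on homogeneous arguments are equal. -/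
theorem ext_homog {M : Q.Ob → Q.Ob → Type v'} [∀ X Y, AddCommGroup (M X Y)]
    [∀ X Y, Module k (M X Y)] {σ τ : MultiMap k Q.Hom M}
    (h : ∀ X Y (a : Chain Q.Hom X Y) (n : ℤ), Q.IsHomog a n → σ.app a = τ.app a) : σ = τ := by
  suffices H : ∀ {X Y Z : Q.Ob} (q : Chain Q.Hom X Y) (r : Chain Q.Hom Y Z) (n : ℤ),
      Q.IsHomog r n → σ.app (q.comp r) = τ.app (q.comp r) from
    ext_app fun X Y a => H a (.nil Y) 0 (.nil Y)
  intro X Y Z q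
  induction q with
  | nil =>
    intro r n hr
    rw [nil_comp]
    exact h _ _ _ _ hr
  | cons q f ih =>
    intro r n hr
    induction f using DirectSum.induction_on with
    | zero => rw [σ.app_zero, τ.app_zero]
    | add x y hx hy => rw [σ.app_add, τ.app_add, hx, hy]
    | of m x =>
      have e := ih ((single (Q.of m x)).comp r) _
        (((IsHomog.nil _).cons m x).comp hr)
      rw [← comp_assoc] at e
      exact e

theorem app_mapEnd_koszulEnd {M : Q.Ob → Q.Ob → Type v'} [∀ X Y, AddCommGroup (M X Y)]
    [∀ X Y, Module k (M X Y)] (σ : MultiMap k Q.Hom M) (e : ℤ) {X Y : Q.Ob}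
    {a : Chain Q.Hom X Y} {n : ℤ} (ha : Q.IsHomog a n) :
    σ.app (a.mapEnd (Q.koszulEnd e)) = ((-1 : k) ^ (e * n)) • σ.app a := by
  suffices H : ∀ {Z : Q.Ob} (r : Chain Q.Hom Y Z), σ.app ((a.mapEnd (Q.koszulEnd e)).comp r) =
      ((-1 : k) ^ (e * n)) • σ.app (a.comp r) from H (.nil Y)
  intro Z r
  induction ha with
  | nil => simp [mapEnd]
  | @cons Y Y' p n hp m f ih =>
    rw [mapEnd]
    change σ.app ((Chain.cons _ (Q.koszul e (Q.of m f))).comp r) = _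
    rw [koszul_of, σ.app_smul]
    have e1 := ih ((single (Q.of m f)).comp r)
    rw [← comp_assoc, ← comp_assoc] at e1
    refine (congrArg _ e1).trans ?_
    rw [smul_smul, ← zpow_add₀ (by simp)]
    congr 2
    ring

/-! ### Degrees of operations -/

namespace HasDegree

variable {o : Q.Ob → Q'.Ob} {σ σ' : MultiMap k Q.Hom fun X Y => Q'.Hom (o X) (o Y)} {D : ℤ}

theorem congr (h : Q.HasDegree (Q' := Q') (o := o) σ D) {D' : ℤ} (e : D = D') :
    Q.HasDegree (Q' := Q') (o := o) σ D' := e ▸ h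

theorem add (h : Q.HasDegree (Q' := Q') (o := o) σ D)
    (h' : Q.HasDegree (Q' := Q') (o := o) σ' D) :
    Q.HasDegree (Q' := Q') (o := o) (σ + σ') D :=
  fun p n hp => add_mem (h p n hp) (h' p n hp)

theorem neg (h : Q.HasDegree (Q' := Q') (o := o) σ D) :
    Q.HasDegree (Q' := Q') (o := o) (-σ) D :=
  fun p n hp => neg_mem (h p n hp)

theorem sub (h : Q.HasDegree (Q' := Q') (o := o) σ D)
    (h' : Q.HasDegree (Q' := Q') (o := o) σ' D) :
    Q.HasDegree (Q' := Q') (o := o) (σ - σ') D := by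
  rw [sub_eq_add_neg]
  exact h.add h'.neg

theorem zero : Q.HasDegree (Q' := Q') (o := o) 0 D := fun _ _ _ => zero_mem _

theorem glue {σ : ℕ → MultiMap k Q.Hom fun X Y => Q'.Hom (o X) (o Y)}
    (h : ∀ n, Q.HasDegree (Q' := Q') (o := o) (σ n) D) :
    Q.HasDegree (Q' := Q') (o := o) (MultiMap.glue σ) D :=
  fun p n hp => h p.length p n hp

theorem part (h : Q.HasDegree (Q' := Q') (o := o) σ D) (d : ℕ) :
    Q.HasDegree (Q' := Q') (o := o) (MultiMap.part d σ) D :=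
  glue fun n => by
    split_ifs
    · exact h
    · exact zero

theorem post (h : Q.HasDegree (Q' := Q') (o := o) σ D)
    {L : ∀ X Y : Q.Ob, Q'.Hom (o X) (o Y) →ₗ[k] Q'.Hom (o X) (o Y)}
    (hL : ∀ X Y (n : ℤ) (f : Q'.hom (o X) (o Y) n), L X Y (Q'.of n f) ∈
      LinearMap.range (Q'.of (X := o X) (Y := o Y) n)) :
    Q.HasDegree (Q' := Q') (o := o) (MultiMap.post L σ) D := fun p n hp => by
  obtain ⟨f, hf⟩ := h p n hp
  change L _ _ (σ.app p) ∈ _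
  rw [← hf]
  exact hL _ _ _ f

theorem ofLin {t : ∀ X Y : Q.Ob, Q.Hom X Y →ₗ[k] Q'.Hom (o X) (o Y)}
    (ht : ∀ X Y (n : ℤ) (f : Q.hom X Y n), t X Y (Q.of n f) ∈
      LinearMap.range (Q'.of (X := o X) (Y := o Y) (n - 1 + D))) :
    Q.HasDegree (Q' := Q') (o := o)
      (MultiMap.ofLin (M := fun X Y => Q'.Hom (o X) (o Y)) t) D := by
  intro X Y p n hp
  rcases hp with _ | ⟨_ | ⟨hp, j, b⟩, l, a⟩
  · exact zero_mem _
  · rw [zero_add]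
    exact ht _ _ _ _
  · exact zero_mem _

theorem ins (h : Q.HasDegree (Q' := Q') (o := o) σ D) {α β : EndFam k Q.Hom} (hα : IsGraded α)
    (hβ : IsGraded β) {τ : MultiMap k Q.Hom Q.Hom} {e : ℤ}
    (hτ : Q.HasDegree (Q' := Q) (o := id) τ e) :
    Q.HasDegree (Q' := Q') (o := o) (MultiMap.ins α σ τ β) (D + (e - 1)) := by
  intro X Y a n ha
  rw [ins_app]
  refine sumSplits₃_mem _ a ?_
  rintro V W p q r rfl
  obtain ⟨n', n₃, h', h₃, rfl⟩ := ha.exists_of_comp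
  obtain ⟨n₁, n₂, h₁, h₂, rfl⟩ := h'.exists_of_comp
  have := h _ _ (((h₁.mapEnd hα).cons_mem (hτ _ _ h₂)).comp (h₃.mapEnd hβ))
  exact mem_range_of_congr this (by ring)

theorem star (h : Q.HasDegree (Q' := Q') (o := o) σ D) {D' : ℤ}
    (h' : Q.HasDegree (Q' := Q') (o := o) σ' D')
    {m : ∀ X Y Z, Q'.Hom Y Z →ₗ[k] Q'.Hom X Y →ₗ[k] Q'.Hom X Z}
    (hm : ∀ (X Y Z : Q'.Ob) (i j : ℤ) (g : Q'.hom Y Z i) (f : Q'.hom X Y j),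
      m X Y Z (Q'.of i g) (Q'.of j f) ∈ LinearMap.range (Q'.of (X := X) (Y := Z) (i + j))) :
    Q.HasDegree (Q' := Q') (o := o) (MultiMap.star (M := fun X Y => Q'.Hom (o X) (o Y))
      (fun X Y Z => m (o X) (o Y) (o Z)) σ σ') (D + D') := by
  intro X Y a n ha
  rw [star_app]
  refine sumSplits_mem _ a ?_
  rintro V p q rfl
  obtain ⟨n₁, n₂, h₁, h₂, rfl⟩ := ha.exists_of_comp
  obtain ⟨x, hx⟩ := h _ _ h₂
  obtain ⟨y, hy⟩ := h' _ _ h₁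
  rw [← hx, ← hy]
  exact mem_range_of_congr (hm _ _ _ _ _ x y) (by ring)

/-- Operations of degree `D` commute with the sign operators up to sign. -/
theorem app_mapEnd_koszulEnd (h : Q.HasDegree (Q' := Q') (o := o) σ D) (e : ℤ) {X Y : Q.Ob}
    (a : Chain Q.Hom X Y) : σ.app (a.mapEnd (Q.koszulEnd e)) =
      ((-1 : k) ^ (e * (D - 1))) • Q'.koszul e (σ.app a) := by
  have H : σ.pre (Q.koszulEnd e) = MultiMap.post (M := fun X Y => Q'.Hom (o X) (o Y))
      (fun _ _ => ((-1 : k) ^ (e * (D - 1))) • Q'.koszul e) σ := by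
    refine ext_homog fun X Y a n ha => ?_
    change σ.app _ = ((-1 : k) ^ (e * (D - 1))) • Q'.koszul e (σ.app a)
    rw [GradedQuiver.app_mapEnd_koszulEnd σ e ha, koszul_of_mem e (h a n ha), smul_smul,
      ← zpow_add₀ (by simp)]
    congr 1
    have e1 : e * (D - 1) + e * (n + D - 1) = e * n + (e * (D - 1) + e * (D - 1)) := by ring
    rw [e1, zpow_add₀ (by simp), (Even.add_self _).neg_one_zpow, mul_one]
  exact congrArg (fun τ => τ.app a) H

end HasDegree

end GradedQuiver

end AInf

namespace AInf

/-! ### Functors to a graded associative category and their Euler defect -/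

/-- A composition of degree zero on a graded quiver, associative in the sign convention of
`A∞`-categories in which only `μ²` is non-zero. -/
structure AssocProduct {k : Type w} [Field k] (Q : GradedQuiver.{u, v, w} k) where
  mul : ∀ X Y Z, Q.Hom Y Z →ₗ[k] Q.Hom X Y →ₗ[k] Q.Hom X Z
  mul_mem : ∀ (X Y Z : Q.Ob) (i j : ℤ) (g : Q.hom Y Z i) (f : Q.hom X Y j),
    mul X Y Z (Q.of i g) (Q.of j f) ∈ LinearMap.range (Q.of (X := X) (Y := Z) (i + j))
  assoc : ∀ (W X Y Z : Q.Ob) (c : Q.Hom Y Z) (b : Q.Hom X Y) (a : Q.Hom W X),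
    mul W Y Z c (mul W X Y b a) + mul W X Z (mul X Y Z c b) (Q.koszul 1 a) = 0

namespace AssocProduct

open Chain MultiMap GradedQuiver

variable {k : Type w} [Field k] {Q' : GradedQuiver.{u', v', w} k} (P : AssocProduct Q')

theorem koszul_mul {X Y Z : Q'.Ob} (g : Q'.Hom Y Z) (f : Q'.Hom X Y) :
    Q'.koszul 1 (P.mul X Y Z g f) = -P.mul X Y Z (Q'.koszul 1 g) (Q'.koszul 1 f) := by
  induction g using DirectSum.induction_on with
  | zero => simp
  | add x y hx hy => simp only [map_add, LinearMap.add_apply, hx, hy, neg_add]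
  | of i g =>
  induction f using DirectSum.induction_on with
  | zero => simp
  | add x y hx hy => simp only [map_add, hx, hy, neg_add]
  | of j f =>
  change Q'.koszul 1 (P.mul X Y Z (Q'.of i g) (Q'.of j f)) =
    -P.mul X Y Z (Q'.koszul 1 (Q'.of i g)) (Q'.koszul 1 (Q'.of j f))
  rw [koszul_of_mem 1 (P.mul_mem _ _ _ _ _ g f), koszul_of, koszul_of, map_smul, map_smul,
    LinearMap.smul_apply, smul_smul, ← zpow_add₀ (by simp), ← neg_one_smul k (_ • _), smul_smul]
  congr 1
  have e : 1 * (i + j - 1) = 1 + (1 * (j - 1) + 1 * (i - 1)) := by ring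
  rw [e, zpow_add₀ (by simp), zpow_one]

theorem euler_mul {X Y Z : Q'.Ob} (g : Q'.Hom Y Z) (f : Q'.Hom X Y) :
    Q'.euler X Z (P.mul X Y Z g f) =
      P.mul X Y Z (Q'.euler Y Z g) f + P.mul X Y Z g (Q'.euler X Y f) := by
  induction g using DirectSum.induction_on with
  | zero => simp
  | add x y hx hy =>
    simp only [map_add, LinearMap.add_apply, hx, hy]
    abel
  | of i g =>
  induction f using DirectSum.induction_on with
  | zero => simp
  | add x y hx hy =>
    simp only [map_add, hx, hy]
    abel
  | of j f =>
  change Q'.euler X Z (P.mul X Y Z (Q'.of i g) (Q'.of j f)) =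
    P.mul X Y Z (Q'.euler Y Z (Q'.of i g)) (Q'.of j f) +
      P.mul X Y Z (Q'.of i g) (Q'.euler X Y (Q'.of j f))
  rw [euler_of_mem (P.mul_mem _ _ _ _ _ g f), euler_of, euler_of, map_smul, map_smul,
    LinearMap.smul_apply, ← add_smul]
  push_cast
  rfl

variable {Q : GradedQuiver.{u, v, w} k} {o : Q.Ob → Q'.Ob}

/-- The product of two families of operations with values in `Q'`. -/
def starMul (φ ψ : MultiMap k Q.Hom fun X Y => Q'.Hom (o X) (o Y)) :
    MultiMap k Q.Hom fun X Y => Q'.Hom (o X) (o Y) :=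
  star (M := fun X Y => Q'.Hom (o X) (o Y)) (fun X Y Z => P.mul (o X) (o Y) (o Z)) φ ψ

/-- The operations `±σ`, the sign being that of `koszul 1` on the values. -/
def _root_.AInf.MultiMap.sgn (φ : MultiMap k Q.Hom fun X Y => Q'.Hom (o X) (o Y)) :
    MultiMap k Q.Hom fun X Y => Q'.Hom (o X) (o Y) :=
  post (M := fun X Y => Q'.Hom (o X) (o Y)) (fun X Y => Q'.koszul 1 (X := o X) (Y := o Y)) φ

/-- Postcomposition with the Euler operator. -/
def _root_.AInf.MultiMap.eul (φ : MultiMap k Q.Hom fun X Y => Q'.Hom (o X) (o Y)) :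
    MultiMap k Q.Hom fun X Y => Q'.Hom (o X) (o Y) :=
  post (M := fun X Y => Q'.Hom (o X) (o Y)) (fun X Y => Q'.euler (o X) (o Y)) φ

variable (φ ψ χ : MultiMap k Q.Hom fun X Y => Q'.Hom (o X) (o Y))

theorem star_assoc : P.starMul φ (P.starMul ψ χ) = -P.starMul (P.starMul φ ψ) χ.sgn := by
  rw [eq_neg_iff_add_eq_zero]
  refine ext_app fun X Y a => ?_
  have h1 : (P.starMul φ (P.starMul ψ χ)).app a = a.sumSplits fun _ s r =>
      s.sumSplits fun _ p q => P.mul _ _ _ (φ.app r) (P.mul _ _ _ (ψ.app q) (χ.app p)) :=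
    sumSplits_congr a fun V s r _ => map_sumSplits (P.mul _ _ _ (φ.app r)).toAddMonoidHom s
      fun _ p q => P.mul _ _ _ (ψ.app q) (χ.app p)
  have h2 : (P.starMul (P.starMul φ ψ) χ.sgn).app a = a.sumSplits fun _ p s =>
      s.sumSplits fun _ q r => P.mul _ _ _ (P.mul _ _ _ (φ.app r) (ψ.app q))
        (Q'.koszul 1 (χ.app p)) :=
    sumSplits_congr a fun V p s _ =>
      map_sumSplits ((P.mul _ _ _).flip (Q'.koszul 1 (χ.app p))).toAddMonoidHom s
        fun _ q r => P.mul _ _ _ (φ.app r) (ψ.app q)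
  rw [add_app, h1, h2, sumSplits_assoc a fun V W p q r =>
    P.mul (o X) (o W) (o Y) (φ.app r) (P.mul (o X) (o V) (o W) (ψ.app q) (χ.app p)),
    ← sumSplits_add]
  simp only [← sumSplits_add, P.assoc, sumSplits_zero]
  rfl

theorem sgn_sgn : φ.sgn.sgn = φ := by
  refine ext_app fun X Y a => ?_
  exact LinearMap.congr_fun (congrFun₂ (Q'.koszulEnd_one_mul_self) (o X) (o Y)) (φ.app a)

theorem sgn_star : (P.starMul φ ψ).sgn = -P.starMul φ.sgn ψ.sgn := by
  refine ext_app fun X Y a => ?_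
  rw [neg_app]
  refine (map_sumSplits (Q'.koszul 1 (X := o X) (Y := o Y)).toAddMonoidHom a _).trans ?_
  change _ = -(a.sumSplits fun V p q => P.mul _ _ _ (Q'.koszul 1 (φ.app q))
    (Q'.koszul 1 (ψ.app p)))
  refine (sumSplits_congr a fun V p q _ => P.koszul_mul (φ.app q) (ψ.app p)).trans ?_
  exact (map_sumSplits (negAddMonoidHom : Q'.Hom (o X) (o Y) →+ _) a _).symm

theorem eul_star : (P.starMul φ ψ).eul = P.starMul φ.eul ψ + P.starMul φ ψ.eul := by
  refine ext_app fun X Y a => ?_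
  refine (map_sumSplits (Q'.euler (o X) (o Y)).toAddMonoidHom a _).trans ?_
  refine (sumSplits_congr a fun V p q _ => P.euler_mul (φ.app q) (ψ.app p)).trans ?_
  exact sumSplits_add a _ _

theorem _root_.AInf.GradedQuiver.HasDegree.pre_koszulEnd_one
    {φ : MultiMap k Q.Hom fun X Y => Q'.Hom (o X) (o Y)}
    (h : Q.HasDegree (Q' := Q') (o := o) φ 1) : φ.pre (Q.koszulEnd 1) = φ.sgn :=
  ext_app fun X Y a => (h.app_mapEnd_koszulEnd 1 a).trans (by simp; rfl)

theorem _root_.AInf.GradedQuiver.HasDegree.pre_koszulEnd_zero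
    {φ : MultiMap k Q.Hom fun X Y => Q'.Hom (o X) (o Y)}
    (h : Q.HasDegree (Q' := Q') (o := o) φ 0) : φ.pre (Q.koszulEnd 1) = -φ.sgn :=
  ext_app fun X Y a => (h.app_mapEnd_koszulEnd 1 a).trans (by simp; rfl)

end AssocProduct

namespace AInfCategory

open Chain MultiMap GradedQuiver

variable {k : Type w} [Field k] (A : AInfCategory.{u, v, w} k)

theorem ins_μ_μ : ins (A.koszulEnd 1) A.μ A.μ 1 = 0 :=
  ext_app fun _ _ a => (A.conv_eq_ins 1 A.μ A.μ a).symm.trans (A.μ_conv a)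

theorem μ_app_mapEnd {X Y : A.Ob} (a : Chain A.Hom X Y) :
    A.μ.app (a.mapEnd (A.koszulEnd 1)) = (-1 : k) • A.koszulEnd 1 X Y (A.μ.app a) :=
  (HasDegree.app_mapEnd_koszulEnd (o := id) A.μ_degree 1 a).trans (by norm_num; rfl)

variable {M : A.Ob → A.Ob → Type v'} [∀ X Y, AddCommGroup (M X Y)] [∀ X Y, Module k (M X Y)]

theorem ins_ins_μ_μ (σ : MultiMap k A.Hom M) :
    ins (A.koszulEnd 1) (ins (A.koszulEnd 1) σ A.μ 1) A.μ 1 = 0 := by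
  refine ext_app fun X Y a => ?_
  rw [ins_ins_app (A.koszulEnd 1) (A.koszulEnd 1) rfl (-1) σ A.μ A.μ
    (fun _ _ => A.μ_app_mapEnd) a, ins_μ_μ, ins_zero, neg_one_smul, zero_app, zero_add,
    neg_add_cancel]

/-- Insertion of a closed `b` commutes with insertion of `μ`. -/
theorem ins_ins_of_closed (b : MultiMap k A.Hom A.Hom)
    (hb : A.HasDegree (Q' := A.toGradedQuiver) (o := id) b 1)
    (hc : ins 1 A.μ b 1 = ins (A.koszulEnd 1) b A.μ 1) (σ : MultiMap k A.Hom M) :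
    ins (A.koszulEnd 1) (ins 1 σ b 1) A.μ 1 = ins 1 (ins (A.koszulEnd 1) σ A.μ 1) b 1 := by
  refine ext_app fun X Y a => ?_
  have h := ins_ins 1 (A.koszulEnd 1) (by rw [one_mul, mul_one]) 1 (by ring) σ b A.μ
    (fun _ _ a => (HasDegree.app_mapEnd_koszulEnd (o := id) hb 1 a).trans (by norm_num; rfl))
    (fun _ _ a => by rw [mapEnd_one, one_smul]; rfl) a
  rw [hc, one_smul, one_smul, sub_self, sub_eq_zero] at h
  exact h

variable {Q' : GradedQuiver.{u', v', w} k} (P : AssocProduct Q') {o : A.Ob → Q'.Ob}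
  (b : MultiMap k A.Hom A.Hom) (F T : MultiMap k A.Hom fun X Y => Q'.Hom (o X) (o Y))

/-- The failure of `F` to be an `A∞`-functor to `Q'` with the product `P`. -/
def functorDefect : MultiMap k A.Hom fun X Y => Q'.Hom (o X) (o Y) :=
  P.starMul F F - ins (A.koszulEnd 1) F A.μ 1

/-- The failure of `T` to be a homotopy between the composites of `F` with the Euler derivation
on the target and with the derivation `b` on the source. -/
def eulerDefect : MultiMap k A.Hom fun X Y => Q'.Hom (o X) (o Y) :=
  F.eul - ins 1 F b 1 - P.starMul F T - P.starMul T F.sgn - ins (A.koszulEnd 1) T A.μ 1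

variable {A P b F T}

/-- The functor defect is closed. -/
theorem ins_functorDefect (hF : A.HasDegree (Q' := Q') (o := o) F 1) :
    ins (A.koszulEnd 1) (A.functorDefect P F) A.μ 1 =
      -P.starMul (A.functorDefect P F) F.sgn - P.starMul F (A.functorDefect P F) := by
  have h1 : ins (A.koszulEnd 1) (P.starMul F F) A.μ 1 =
      P.starMul (ins (A.koszulEnd 1) F A.μ 1) F.sgn +
        P.starMul F (ins (A.koszulEnd 1) F A.μ 1) := by
    rw [← hF.pre_koszulEnd_one]
    exact star_ins _ _ _ _ _
  have h2 := P.star_assoc F F F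
  have h3 : ∀ φ φ' ψ : MultiMap k A.Hom fun X Y => Q'.Hom (o X) (o Y),
      P.starMul (φ - φ') ψ = P.starMul φ ψ - P.starMul φ' ψ := sub_star _
  have h4 : ∀ φ ψ ψ' : MultiMap k A.Hom fun X Y => Q'.Hom (o X) (o Y),
      P.starMul φ (ψ - ψ') = P.starMul φ ψ - P.starMul φ ψ' := star_sub _
  rw [functorDefect, sub_ins, ins_ins_μ_μ, h1, h3, h4, h2]
  abel

/-- The differential of the Euler defect is the Lie derivative of the functor defect along the
Euler derivation, up to terms which are products with the homotopy `T`. -/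
theorem ins_eulerDefect (hb : A.HasDegree (Q' := A.toGradedQuiver) (o := id) b 1)
    (hc : ins 1 A.μ b 1 = ins (A.koszulEnd 1) b A.μ 1)
    (hF : A.HasDegree (Q' := Q') (o := o) F 1) (hT : A.HasDegree (Q' := Q') (o := o) T 0) :
    ins (A.koszulEnd 1) (A.eulerDefect P b F T) A.μ 1 =
      P.starMul F (A.eulerDefect P b F T) + P.starMul (A.eulerDefect P b F T) F -
        ((A.functorDefect P F).eul - ins 1 (A.functorDefect P F) b 1 -
          P.starMul T (A.functorDefect P F).sgn + P.starMul (A.functorDefect P F) T.sgn) := by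
  have sub_l : ∀ φ φ' ψ : MultiMap k A.Hom fun X Y => Q'.Hom (o X) (o Y),
      P.starMul (φ - φ') ψ = P.starMul φ ψ - P.starMul φ' ψ := sub_star _
  have sub_r : ∀ φ ψ ψ' : MultiMap k A.Hom fun X Y => Q'.Hom (o X) (o Y),
      P.starMul φ (ψ - ψ') = P.starMul φ ψ - P.starMul φ ψ' := star_sub _
  have neg_r : ∀ φ ψ : MultiMap k A.Hom fun X Y => Q'.Hom (o X) (o Y),
      P.starMul φ (-ψ) = -P.starMul φ ψ := star_neg _
  have leib : ∀ φ ψ : MultiMap k A.Hom fun X Y => Q'.Hom (o X) (o Y),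
      ins (A.koszulEnd 1) (P.starMul φ ψ) A.μ 1 =
        P.starMul (ins (A.koszulEnd 1) φ A.μ 1) (ψ.pre (A.koszulEnd 1)) +
          P.starMul φ (ins (A.koszulEnd 1) ψ A.μ 1) := fun φ ψ => star_ins _ _ _ _ _
  have leib_b : ins 1 (P.starMul F F) b 1 =
      P.starMul (ins 1 F b 1) F + P.starMul F (ins 1 F b 1) :=
    (star_ins _ _ _ _ _).trans (by rw [pre_one]; rfl)
  have sgn_ins : ins (A.koszulEnd 1) F.sgn A.μ 1 = (ins (A.koszulEnd 1) F A.μ 1).sgn :=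
    (post_ins (M := fun X Y => Q'.Hom (o X) (o Y)) _ _ _ _ _).symm
  have eul_ins : ins (A.koszulEnd 1) F.eul A.μ 1 = (ins (A.koszulEnd 1) F A.μ 1).eul :=
    (post_ins (M := fun X Y => Q'.Hom (o X) (o Y)) _ _ _ _ _).symm
  have pre_sgn : F.sgn.pre (A.koszulEnd 1) = F := by
    have : F.sgn.pre (A.koszulEnd 1) = (F.pre (A.koszulEnd 1)).sgn := rfl
    rw [this, hF.pre_koszulEnd_one, AssocProduct.sgn_sgn]
  have sgn_sub : (P.starMul F F - ins (A.koszulEnd 1) F A.μ 1).sgn =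
      (P.starMul F F).sgn - (ins (A.koszulEnd 1) F A.μ 1).sgn :=
    post_sub (M := fun X Y => Q'.Hom (o X) (o Y)) _ _ _
  have eul_sub : (P.starMul F F - ins (A.koszulEnd 1) F A.μ 1).eul =
      (P.starMul F F).eul - (ins (A.koszulEnd 1) F A.μ 1).eul :=
    post_sub (M := fun X Y => Q'.Hom (o X) (o Y)) _ _ _
  -- the three ways in which two products can be composed
  have a1 := P.star_assoc F F T
  have a2 := P.star_assoc F T F.sgn
  have a3 := P.star_assoc T F.sgn F.sgn
  rw [AssocProduct.sgn_sgn] at a2 a3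
  have l1 := leib F T
  have l2 := leib T F.sgn
  rw [hT.pre_koszulEnd_zero, neg_r] at l1
  rw [pre_sgn, sgn_ins] at l2
  have e1 := P.eul_star F F
  have e2 := P.sgn_star F F
  have c1 := A.ins_ins_of_closed b hb hc F
  simp only [eulerDefect, functorDefect, sub_ins, sub_l, sub_r, sgn_sub, eul_sub, leib_b, eul_ins,
    c1, l1, l2, e1, e2, ins_ins_μ_μ, a1, a2, neg_r]
  have a3' : P.starMul (P.starMul T F.sgn) F = -P.starMul T (P.starMul F.sgn F.sgn) := by
    rw [a3, neg_neg]
  rw [a3']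
  abel

end AInfCategory

end AInf

namespace AInf

/-! ### Terms of lowest arity -/

namespace MultiMap

open Chain

variable {k : Type w} [Field k] {Ob : Type u} {H : Ob → Ob → Type v}
    {M : Ob → Ob → Type v'} [∀ X Y, AddCommGroup (H X Y)] [∀ X Y, Module k (H X Y)]
    [∀ X Y, AddCommGroup (M X Y)] [∀ X Y, Module k (M X Y)]

/-- The operations vanish in arities less than `d`. -/
def VanishBelow (d : ℕ) (σ : MultiMap k H M) : Prop :=
  ∀ ⦃X Y : Ob⦄ (a : Chain H X Y), a.length < d → σ.app a = 0

theorem isAdditive (σ : MultiMap k H M) {X Y : Ob} :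
    IsAdditive fun a : Chain H X Y => σ.app a :=
  fun _ _ p f g r => σ.app_add p f g r

theorem part_vanishBelow (d : ℕ) (σ : MultiMap k H M) : (part d σ).VanishBelow d :=
  fun _ _ _ h => part_app_of_ne σ h.ne

theorem app_nil_of_length {τ : MultiMap k H M} (hτ : ∀ X, τ.app (nil X) = 0) {X Y : Ob}
    {q : Chain H X Y} (hq : q.length = 0) : τ.app q = 0 := by
  cases q with
  | nil => exact hτ _
  | cons q f => simp [length] at hq

theorem VanishBelow.ins {d : ℕ} {σ : MultiMap k H M} (hσ : σ.VanishBelow d) (α β : EndFam k H)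
    {τ : MultiMap k H H} (hτ : ∀ X, τ.app (nil X) = 0) : (ins α σ τ β).VanishBelow d := by
  intro X Y a ha
  rw [ins_app]
  refine (sumSplits₃_congr a fun V W p q r h => ?_).trans (sumSplits₃_zero a)
  by_cases hq : q.length = 0
  · rw [app_nil_of_length hτ hq, σ.app_zero]
  · apply hσ
    rw [← h] at ha
    simp only [length_comp, length, length_mapEnd] at ha ⊢
    omega

/-- In the lowest arity of `σ`, only the unary part of `τ` contributes to the insertion. -/
theorem VanishBelow.ins_app_eq {d : ℕ} {σ : MultiMap k H M} (hσ : σ.VanishBelow d)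
    (α β : EndFam k H) {τ : MultiMap k H H} (hτ : ∀ X, τ.app (nil X) = 0) {X Y : Ob}
    {a : Chain H X Y} (ha : a.length = d) :
    (MultiMap.ins α σ τ β).app a = insLin α (fun X Y => τ.lin X Y) β σ.app a := by
  rw [ins_app, sumSplits₃_eq_sumEntries]
  · rfl
  · intro V W p q r h hq
    by_cases hq0 : q.length = 0
    · rw [app_nil_of_length hτ hq0, σ.app_zero]
    · apply hσ
      rw [← h] at ha
      simp only [length_comp, length, length_mapEnd] at ha ⊢
      omega

theorem star_app_of_left {m : ∀ X Y Z, M Y Z →ₗ[k] M X Y →ₗ[k] M X Z} {d : ℕ}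
    {φ ψ : MultiMap k H M} (hφ : φ.VanishBelow d) (hψ : ∀ X, ψ.app (nil X) = 0) {X Y : Ob}
    {a : Chain H X Y} (ha : a.length ≤ d) : (star m φ ψ).app a = 0 := by
  rw [star_app]
  refine (sumSplits_congr a fun V p q h => ?_).trans (sumSplits_zero a)
  by_cases hp : p.length = 0
  · rw [app_nil_of_length hψ hp, map_zero]
  · rw [hφ q, map_zero, LinearMap.zero_apply]
    rw [← h, length_comp] at ha
    omega

theorem star_app_of_right {m : ∀ X Y Z, M Y Z →ₗ[k] M X Y →ₗ[k] M X Z} {d : ℕ}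
    {φ ψ : MultiMap k H M} (hφ : ∀ X, φ.app (nil X) = 0) (hψ : ψ.VanishBelow d) {X Y : Ob}
    {a : Chain H X Y} (ha : a.length ≤ d) : (star m φ ψ).app a = 0 := by
  rw [star_app]
  refine (sumSplits_congr a fun V p q h => ?_).trans (sumSplits_zero a)
  by_cases hq : q.length = 0
  · rw [app_nil_of_length hφ hq, map_zero, LinearMap.zero_apply]
  · rw [hψ p, map_zero]
    rw [← h, length_comp] at ha
    omega

theorem ins_ofLin_app (α β t : EndFam k H) (σ : MultiMap k H M) {X Y : Ob} (a : Chain H X Y) :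
    (ins α σ (ofLin t) β).app a = insLin α t β σ.app a := by
  rw [ins_app, sumSplits₃_eq_sumEntries]
  · rfl
  · intro V W p q r _ hq
    rw [ofLin_app_of_length t hq, σ.app_zero]

end MultiMap

namespace Chain

variable {k : Type w} [Field k] {Ob : Type u} {H : Ob → Ob → Type v}
  [∀ X Y, AddCommGroup (H X Y)] [∀ X Y, Module k (H X Y)] {N : Type*} [AddCommGroup N]

theorem insLin_congr (α t β : EndFam k H) {X Y : Ob} {σ σ' : Chain H X Y → N} (a : Chain H X Y)
    (h : ∀ c : Chain H X Y, c.length = a.length → σ c = σ' c) :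
    insLin α t β σ a = insLin α t β σ' a :=
  sumEntries_congr a fun V W p f r e => h _ <| by
    rw [← e]
    simp only [length_comp, length, length_mapEnd]

theorem insLin_eq_zero (α t β : EndFam k H) {X Y : Ob} {σ : Chain H X Y → N} (a : Chain H X Y)
    (h : ∀ c : Chain H X Y, c.length = a.length → σ c = 0) : insLin α t β σ a = 0 :=
  (insLin_congr α t β a h).trans (insLin_zero α t β a)

/-- If all the entries of the chain are annihilated by `t`, then so is the chain. -/
theorem insLin_of_all (α t β : EndFam k H) {X Y : Ob} {σ : Chain H X Y → N} (hσ : IsAdditive σ)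
    {a : Chain H X Y} (ha : a.All fun _ _ f => t _ _ f = 0) : insLin α t β σ a = 0 := by
  refine (sumEntries_congr a fun V W p f r e => ?_).trans (sumEntries_zero a)
  subst e
  rw [ha.of_cons_comp.2.1, hσ.zero]

theorem all_mapEnd (α : EndFam k H) {P : ∀ X Y, H X Y → Prop} (h : ∀ X Y f, P X Y (α X Y f))
    {X Y : Ob} (a : Chain H X Y) : (a.mapEnd α).All P := by
  induction a with
  | nil => trivial
  | cons p f ih => exact ⟨ih, h _ _ _⟩

end Chain

namespace GradedQuiver

open Chain MultiMap

variable {k : Type w} [Field k] {Q : GradedQuiver.{u, v, w} k}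

/-- If `t` is `β` composed with the Euler operator, then the insertion of `t` multiplies by the
total degree. -/
theorem insLin_euler (β t : EndFam k Q.Hom)
    (ht : ∀ X Y (m : ℤ) (f : Q.hom X Y m), t X Y (Q.of m f) = (m : k) • β X Y (Q.of m f))
    {N : Type*} [AddCommGroup N] [Module k N] {X Z : Q.Ob} (σ : Chain Q.Hom X Z → N)
    (hσ : ∀ ⦃V W : Q.Ob⦄ (p : Chain Q.Hom X V) (c : k) (f : Q.Hom V W) (r : Chain Q.Hom W Z),
      σ ((p.cons (c • f)).comp r) = c • σ ((p.cons f).comp r))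
    {a : Chain Q.Hom X Z} {n : ℤ} (ha : Q.IsHomog a n) :
    insLin β t β σ a = ((n + a.length : ℤ) : k) • σ (a.mapEnd β) := by
  induction ha with
  | nil => simp [insLin, sumEntries, length]
  | @cons Y Y' p n hp m f ih =>
    rw [insLin_cons, ih (fun q => σ (q.cons (β _ _ (Q.of m f))))
      (fun _ _ q c g r => hσ q c g (r.cons (β _ _ (Q.of m f)))), ht]
    have e := hσ (p.mapEnd β) (m : k) (β _ _ (Q.of m f)) (nil _)
    simp only [comp] at e
    rw [e, mapEnd, ← add_smul, length]
    congr 1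
    push_cast
    ring

end GradedQuiver

end AInf

namespace AInf

/-! ### Inductive construction of the functor -/

open Chain MultiMap GradedQuiver

/-- The data from which a functor is constructed: a derivation `b` of `A` without constant term, a
graded associative target, a chain map `p` to it, compatible with products of cocycles and with
`b` acting as the Euler field on cohomology, and a partial inverse `h` of the differential. -/
structure FormalityData {k : Type w} [Field k] (A : AInfCategory.{u, v, w} k)
    (Q' : GradedQuiver.{u', v', w} k) (o : A.Ob → Q'.Ob) where
  P : AssocProduct Q'
  b : MultiMap k A.Hom A.Hom
  b_degree : A.HasDegree (Q' := A.toGradedQuiver) (o := id) b 1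
  b_nil : ∀ X, b.app (nil X) = 0
  b_closed : ins 1 A.μ b 1 = ins (A.koszulEnd 1) b A.μ 1
  b_euler : ∀ X Y (n : ℤ) (f : A.hom X Y n), A.d X Y (A.of n f) = 0 →
    b.lin X Y (A.of n f) - (n : k) • A.of n f ∈ LinearMap.range (A.d X Y)
  h : EndFam k A.Hom
  h_mem : ∀ X Y (n : ℤ) (f : A.hom X Y n), h X Y (A.of n f) ∈
    LinearMap.range (A.of (X := X) (Y := Y) (n - 1))
  d_h_d : ∀ X Y (f : A.Hom X Y), A.d X Y (h X Y (A.d X Y f)) = A.d X Y f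
  p : ∀ X Y, A.Hom X Y →ₗ[k] Q'.Hom (o X) (o Y)
  p_mem : ∀ X Y (n : ℤ) (f : A.hom X Y n), p X Y (A.of n f) ∈
    LinearMap.range (Q'.of (X := o X) (Y := o Y) n)
  p_d : ∀ X Y (f : A.Hom X Y), p X Y (A.d X Y f) = 0
  p_mul : ∀ X Y Z (m n : ℤ) (g : A.hom Y Z m) (f : A.hom X Y n), A.d Y Z (A.of m g) = 0 →
    A.d X Y (A.of n f) = 0 →
    p X Z (A.mul (A.of m g) (A.of n f)) = P.mul _ _ _ (p Y Z (A.of m g)) (p X Y (A.of n f))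

namespace AInfCategory

variable {k : Type w} [Field k] (A : AInfCategory.{u, v, w} k)

/-- The differentials of all the morphism spaces. -/
def dEnd : EndFam k A.Hom := fun X Y => A.d X Y

theorem koszulEnd_mul_dEnd : A.koszulEnd 1 * A.dEnd = -(A.dEnd * A.koszulEnd 1) := by
  funext X Y
  refine linearMap_ext fun n f => ?_
  change A.koszul 1 (A.d X Y (A.of n f)) = -(A.d X Y (A.koszul 1 (A.of n f)))
  rw [koszul_of_mem 1 (A.d_of_mem f), koszul_of, map_smul, ← neg_smul]
  congr 1
  have e : (1 * (n + 1 - 1) : ℤ) = 1 * (n - 1) + 1 := by ring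
  rw [e, zpow_add₀ (by simp), zpow_one, mul_neg_one]

end AInfCategory

namespace FormalityData

variable {k : Type w} [Field k] {A : AInfCategory.{u, v, w} k}
  {Q' : GradedQuiver.{u', v', w} k} {o : A.Ob → Q'.Ob} (D : FormalityData A Q' o)

/-- The chain map `1 - dh - hd`, which is homotopic to the identity and takes values in cocycles. -/
def π : EndFam k A.Hom := 1 - A.dEnd * D.h - D.h * A.dEnd

theorem π_apply {X Y : A.Ob} (f : A.Hom X Y) :
    D.π X Y f = f - A.d X Y (D.h X Y f) - D.h X Y (A.d X Y f) := rfl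

theorem d_π {X Y : A.Ob} (f : A.Hom X Y) : A.d X Y (D.π X Y f) = 0 := by
  rw [π_apply, map_sub, map_sub, A.d_d, D.d_h_d, sub_zero, sub_self]

theorem π_d {X Y : A.Ob} (f : A.Hom X Y) : D.π X Y (A.d X Y f) = 0 := by
  rw [π_apply, A.d_d, map_zero, D.d_h_d, sub_self, sub_zero]

theorem h_mem_of_mem {X Y : A.Ob} {n : ℤ} {f : A.Hom X Y}
    (hf : f ∈ LinearMap.range (A.of (X := X) (Y := Y) n)) :
    D.h X Y f ∈ LinearMap.range (A.of (X := X) (Y := Y) (n - 1)) := by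
  obtain ⟨f, rfl⟩ := hf
  exact D.h_mem _ _ _ _

theorem isGraded_π : IsGraded D.π := by
  intro X Y n f
  rw [π_apply]
  refine sub_mem (sub_mem ⟨f, rfl⟩ ?_) ?_
  · obtain ⟨g, hg⟩ := D.h_mem X Y n f
    rw [← hg]
    exact mem_range_of_congr (A.d_of_mem g) (by ring)
  · exact mem_range_of_congr (D.h_mem_of_mem (A.d_of_mem f)) (by ring)

theorem p_mul_π {X Y Z : A.Ob} (g : A.Hom Y Z) (f : A.Hom X Y) :
    D.p X Z (A.mul (D.π Y Z g) (D.π X Y f)) =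
      D.P.mul _ _ _ (D.p Y Z (D.π Y Z g)) (D.p X Y (D.π X Y f)) := by
  induction g using DirectSum.induction_on with
  | zero => simp [A.zero_mul]
  | add x y hx hy => simp only [map_add, A.add_mul, LinearMap.add_apply, hx, hy]
  | of m g =>
  induction f using DirectSum.induction_on with
  | zero => simp
  | add x y hx hy => simp only [map_add, hx, hy]
  | of n f =>
  obtain ⟨g', hg⟩ := D.isGraded_π Y Z m g
  obtain ⟨f', hf⟩ := D.isGraded_π X Y n f
  have h1 := D.d_π (A.of m g)
  have h2 := D.d_π (A.of n f)
  change D.p X Z (A.mul (D.π Y Z (A.of m g)) (D.π X Y (A.of n f))) =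
    D.P.mul _ _ _ (D.p Y Z (D.π Y Z (A.of m g))) (D.p X Y (D.π X Y (A.of n f)))
  rw [← hg] at h1 ⊢
  rw [← hf] at h2 ⊢
  exact D.p_mul _ _ _ _ _ g' f' h1 h2

theorem all_mapEnd_π {X Y : A.Ob} (a : Chain A.Hom X Y) :
    (a.mapEnd D.π).All fun X Y f => A.dEnd X Y f = 0 :=
  all_mapEnd D.π (fun _ _ f => D.d_π f) a

section Homotopy

variable {N : Type*} [AddCommGroup N] {X Y : A.Ob} {σ : Chain A.Hom X Y → N}

theorem insLin_homotopy (hσ : IsAdditive σ) (a : Chain A.Hom X Y) :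
    insLin (A.koszulEnd 1) A.dEnd 1 (insLin (A.koszulEnd 1) D.h D.π σ) a +
      insLin (A.koszulEnd 1) D.h D.π (insLin (A.koszulEnd 1) A.dEnd 1 σ) a =
        σ a - σ (a.mapEnd D.π) :=
  Chain.insLin_homotopy _ _ _ _ koszulEnd_one_mul_self A.koszulEnd_mul_dEnd rfl
    (funext₂ fun _ _ => LinearMap.ext fun f => D.π_d f)
    (funext₂ fun _ _ => LinearMap.ext fun f => D.d_π f) σ hσ a

end Homotopy

section Closed

variable {M : A.Ob → A.Ob → Type v'} [∀ X Y, AddCommGroup (M X Y)] [∀ X Y, Module k (M X Y)]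

/-- The arity `d` part of `σ` is closed for the differential induced by `μ¹`. -/
def ClosedIn (_D : FormalityData A Q' o) (d : ℕ) (σ : MultiMap k A.Hom M) : Prop :=
  ∀ ⦃X Y : A.Ob⦄ (a : Chain A.Hom X Y), a.length = d →
    insLin (A.koszulEnd 1) A.dEnd 1 σ.app a = 0

variable {D} {d : ℕ} {σ : MultiMap k A.Hom M}

/-- A closed operation which vanishes on cohomology is a coboundary; `K` is its primitive. -/
theorem ClosedIn.exists_primitive (hσ : D.ClosedIn d σ)
    (h0 : ∀ {X Y : A.Ob} (a : Chain A.Hom X Y), a.length = d → σ.app (a.mapEnd D.π) = 0)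
    {X Y : A.Ob} {a : Chain A.Hom X Y} (ha : a.length = d) :
    insLin (A.koszulEnd 1) A.dEnd 1
      (part d (ins (A.koszulEnd 1) σ (ofLin D.h) D.π)).app a = σ.app a := by
  have h1 := D.insLin_homotopy σ.isAdditive a
  rw [h0 a ha, sub_zero, insLin_eq_zero (A.koszulEnd 1) D.h D.π a
    fun c hc => hσ c (hc.trans ha), add_zero] at h1
  rw [← h1]
  refine insLin_congr _ _ _ a fun c hc => ?_
  rw [part_app_self _ (hc.trans ha), ins_ofLin_app]

/-- On cocycles, a closed operation does not change under the projection to representatives. -/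
theorem ClosedIn.app_mapEnd_π (hσ : D.ClosedIn d σ) {X Y : A.Ob} {a : Chain A.Hom X Y}
    (ha : a.length = d) (hc : a.All fun X Y f => A.dEnd X Y f = 0) :
    σ.app (a.mapEnd D.π) = σ.app a := by
  have h1 := D.insLin_homotopy σ.isAdditive a
  have h2 : IsAdditive fun a : Chain A.Hom X Y =>
      insLin (A.koszulEnd 1) D.h D.π σ.app a := by
    have e : (fun a : Chain A.Hom X Y => insLin (A.koszulEnd 1) D.h D.π σ.app a) =
        fun a => (ins (A.koszulEnd 1) σ (ofLin D.h) D.π).app a :=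
      funext fun a => (ins_ofLin_app _ _ _ σ a).symm
    rw [e]
    exact isAdditive _
  rw [insLin_eq_zero (A.koszulEnd 1) D.h D.π a fun c hc => hσ c (hc.trans ha), add_zero,
    insLin_of_all _ _ _ h2 hc] at h1
  exact (sub_eq_zero.1 h1.symm).symm

/-- On cohomology, the insertion of `b` into a closed operation multiplies by the total degree of
the arguments. -/
theorem ClosedIn.insLin_b (hσ : D.ClosedIn d σ) {X Y : A.Ob} {a : Chain A.Hom X Y}
    (ha : a.length = d) {n : ℤ} (hn : A.IsHomog a n) :
    insLin 1 (fun X Y => D.b.lin X Y) 1 σ.app (a.mapEnd D.π) =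
      ((n + d : ℤ) : k) • σ.app (a.mapEnd D.π) := by
  -- `b¹` acts on cocycles as the Euler field, up to coboundaries
  have key : ∀ X Y (m : ℤ) (f : A.hom X Y m), ∃ x, D.b.lin X Y (D.π X Y (A.of m f)) =
      (m : k) • D.π X Y (A.of m f) + A.d X Y x := by
    intro X Y m f
    obtain ⟨g, hg⟩ := D.isGraded_π X Y m f
    have h0 := D.d_π (A.of m f)
    rw [← hg] at h0 ⊢
    obtain ⟨x, hx⟩ := D.b_euler X Y m g h0
    exact ⟨x, by rw [hx]; abel⟩
  have hd : ∀ X Y (f : A.Hom X Y), A.d X Y (D.b.lin X Y (D.π X Y f)) = 0 := by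
    intro X Y f
    have : A.d X Y ∘ₗ D.b.lin X Y ∘ₗ D.π X Y = 0 := by
      refine linearMap_ext fun m f => ?_
      obtain ⟨x, hx⟩ := key X Y m f
      change A.d X Y (D.b.lin X Y (D.π X Y (A.of m f))) = 0
      rw [hx, map_add, map_smul, D.d_π, A.d_d, smul_zero, add_zero]
    exact LinearMap.congr_fun this f
  have h1 := insLin_euler (D.π * D.π) (fun X Y => D.π X Y ∘ₗ D.b.lin X Y ∘ₗ D.π X Y)
    (fun X Y m f => by
      obtain ⟨x, hx⟩ := key X Y m f
      change D.π X Y (D.b.lin X Y (D.π X Y (A.of m f))) = _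
      rw [hx, map_add, map_smul, D.π_d, add_zero]
      rfl) (fun c : Chain A.Hom X Y => σ.app c)
    (fun _ _ p c f r => σ.app_smul p c f r) hn
  rw [mapEnd_mul, hσ.app_mapEnd_π ((length_mapEnd _ a).trans ha) (D.all_mapEnd_π a), ha] at h1
  rw [← h1, insLin, sumEntries_mapEnd]
  refine sumEntries_congr a fun V W p f r e => ?_
  have h2 := hσ.app_mapEnd_π
    (a := ((p.mapEnd D.π).cons (D.b.lin V W (D.π V W f))).comp (r.mapEnd D.π))
    (by
      rw [← ha, ← e]
      simp only [length_comp, length, length_mapEnd])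
    ((D.all_mapEnd_π p).cons_comp (hd _ _ f) (D.all_mapEnd_π r))
  rw [mapEnd_comp, mapEnd] at h2
  rw [mapEnd_one, mapEnd_one, mapEnd_mul, mapEnd_mul]
  exact h2.symm

end Closed

end FormalityData

end AInf

namespace AInf

open Chain MultiMap GradedQuiver

namespace FormalityData

variable {k : Type w} [Field k] {A : AInfCategory.{u, v, w} k}
  {Q' : GradedQuiver.{u', v', w} k} {o : A.Ob → Q'.Ob} (D : FormalityData A Q' o)

/-- Operations `F` of the degree of an `A∞`-functor, with linear part `p`, and `T` of the degree of
a homotopy, both without constant term. -/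
structure IsPair (F T : MultiMap k A.Hom fun X Y => Q'.Hom (o X) (o Y)) : Prop where
  F_degree : A.HasDegree (Q' := Q') (o := o) F 1
  T_degree : A.HasDegree (Q' := Q') (o := o) T 0
  F_nil : ∀ X, F.app (nil X) = 0
  T_nil : ∀ X, T.app (nil X) = 0
  F_single : ∀ {X Y} (f : A.Hom X Y), F.app (single f) = D.p X Y f

variable {F T G U : MultiMap k A.Hom fun X Y => Q'.Hom (o X) (o Y)} {d : ℕ}

theorem sgn_nil {φ : MultiMap k A.Hom fun X Y => Q'.Hom (o X) (o Y)}
    (h : ∀ X, φ.app (nil X) = 0) (X : A.Ob) : φ.sgn.app (nil X) = 0 := by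
  change Q'.koszul 1 (φ.app (nil X)) = 0
  rw [h, map_zero]

theorem vanishBelow_sgn {φ : MultiMap k A.Hom fun X Y => Q'.Hom (o X) (o Y)}
    (h : φ.VanishBelow d) : φ.sgn.VanishBelow d := fun _ _ a ha => by
  change Q'.koszul 1 (φ.app a) = 0
  rw [h a ha, map_zero]

theorem vanishBelow_eul {φ : MultiMap k A.Hom fun X Y => Q'.Hom (o X) (o Y)}
    (h : φ.VanishBelow d) : φ.eul.VanishBelow d := fun _ _ a ha => by
  change Q'.euler _ _ (φ.app a) = 0
  rw [h a ha, map_zero]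

variable {D}

theorem starMul_app_left {φ ψ : MultiMap k A.Hom fun X Y => Q'.Hom (o X) (o Y)}
    (hφ : φ.VanishBelow d) (hψ : ∀ X, ψ.app (nil X) = 0) {X Y : A.Ob} {a : Chain A.Hom X Y}
    (ha : a.length ≤ d) : (D.P.starMul φ ψ).app a = 0 :=
  star_app_of_left (M := fun X Y => Q'.Hom (o X) (o Y)) hφ hψ ha

theorem starMul_app_right {φ ψ : MultiMap k A.Hom fun X Y => Q'.Hom (o X) (o Y)}
    (hφ : ∀ X, φ.app (nil X) = 0) (hψ : ψ.VanishBelow d) {X Y : A.Ob} {a : Chain A.Hom X Y}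
    (ha : a.length ≤ d) : (D.P.starMul φ ψ).app a = 0 :=
  star_app_of_right (M := fun X Y => Q'.Hom (o X) (o Y)) hφ hψ ha

namespace IsPair

theorem functorDefect_degree (h : D.IsPair F T) :
    A.HasDegree (Q' := Q') (o := o) (A.functorDefect D.P F) 2 :=
  HasDegree.sub (HasDegree.congr (HasDegree.star h.F_degree h.F_degree D.P.mul_mem) (by norm_num))
    (HasDegree.congr
      (HasDegree.ins h.F_degree (isGraded_koszulEnd 1) isGraded_one A.μ_degree) (by norm_num))

theorem eulerDefect_degree (h : D.IsPair F T) :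
    A.HasDegree (Q' := Q') (o := o) (A.eulerDefect D.P D.b F T) 1 := by
  have hs : A.HasDegree (Q' := Q') (o := o) F.sgn 1 :=
    HasDegree.post h.F_degree fun X Y n f => isGraded_koszulEnd 1 _ _ n f
  have he : A.HasDegree (Q' := Q') (o := o) F.eul 1 :=
    HasDegree.post h.F_degree fun X Y n f => by
      rw [euler_of]
      exact Submodule.smul_mem _ _ ⟨f, rfl⟩
  have h1 : A.HasDegree (Q' := Q') (o := o) (ins 1 F D.b 1) 1 :=
    HasDegree.congr (HasDegree.ins h.F_degree isGraded_one isGraded_one D.b_degree) (by norm_num)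
  have h2 : A.HasDegree (Q' := Q') (o := o) (ins (A.koszulEnd 1) T A.μ 1) 1 :=
    HasDegree.congr (HasDegree.ins h.T_degree (isGraded_koszulEnd 1) isGraded_one A.μ_degree)
      (by norm_num)
  have h3 : A.HasDegree (Q' := Q') (o := o) (D.P.starMul F T) 1 :=
    HasDegree.congr (HasDegree.star h.F_degree h.T_degree D.P.mul_mem) (by norm_num)
  have h4 : A.HasDegree (Q' := Q') (o := o) (D.P.starMul T F.sgn) 1 :=
    HasDegree.congr (HasDegree.star h.T_degree hs D.P.mul_mem) (by norm_num)
  intro X Y a n ha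
  simp only [AInfCategory.eulerDefect, sub_app]
  exact sub_mem (sub_mem (sub_mem (sub_mem (he a n ha) (h1 a n ha)) (h3 a n ha))
    (h4 a n ha)) (h2 a n ha)

theorem closedIn_functorDefect (h : D.IsPair F T) (hE : (A.functorDefect D.P F).VanishBelow d) :
    D.ClosedIn d (A.functorDefect D.P F) := by
  intro X Y a ha
  have h1 := congrArg (fun σ => σ.app a) (A.ins_functorDefect (P := D.P) h.F_degree)
  simp only [sub_app, neg_app, starMul_app_left hE (sgn_nil h.F_nil) ha.le,
    starMul_app_right h.F_nil hE ha.le] at h1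
  rw [hE.ins_app_eq _ _ A.μ_nil ha] at h1
  rw [neg_zero, sub_zero] at h1
  exact h1

/-- In lowest arity, the Lie derivative of the functor defect along the Euler field is the
coboundary of the Euler defect. -/
theorem insLin_eulerDefect (h : D.IsPair F T) (hE : (A.functorDefect D.P F).VanishBelow d)
    (hS : (A.eulerDefect D.P D.b F T).VanishBelow d) {X Y : A.Ob} {a : Chain A.Hom X Y}
    (ha : a.length = d) :
    insLin (A.koszulEnd 1) A.dEnd 1 (A.eulerDefect D.P D.b F T).app a =
      insLin 1 (fun X Y => D.b.lin X Y) 1 (A.functorDefect D.P F).app a -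
        Q'.euler _ _ ((A.functorDefect D.P F).app a) := by
  have h1 := congrArg (fun σ => σ.app a)
    (A.ins_eulerDefect (P := D.P) D.b_degree D.b_closed h.F_degree h.T_degree)
  simp only [sub_app, add_app, starMul_app_left hS h.F_nil ha.le,
    starMul_app_right h.F_nil hS ha.le, starMul_app_left hE (sgn_nil h.T_nil) ha.le,
    starMul_app_right h.T_nil (vanishBelow_sgn hE) ha.le] at h1
  rw [hS.ins_app_eq _ _ A.μ_nil ha, hE.ins_app_eq _ _ D.b_nil ha] at h1
  refine h1.trans ?_
  change _ = _ - (A.functorDefect D.P F).eul.app a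
  abel

/-- Changing `F` in arity `d` changes the functor defect by a coboundary. -/
theorem functorDefect_add (h : D.IsPair F T) (hG : G.VanishBelow d) (hd : 0 < d) {X Y : A.Ob}
    {a : Chain A.Hom X Y} (ha : a.length ≤ d) :
    (A.functorDefect D.P (F + G)).app a =
      (A.functorDefect D.P F).app a - (ins (A.koszulEnd 1) G A.μ 1).app a := by
  have hG0 : ∀ X, G.app (nil X) = 0 := fun X => hG _ hd
  have e : D.P.starMul (F + G) (F + G) = D.P.starMul F F + D.P.starMul F G +
      (D.P.starMul G F + D.P.starMul G G) :=
    (add_star _ _ _ _).trans (congrArg₂ _ (star_add _ _ _ _) (star_add _ _ _ _))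
  simp only [AInfCategory.functorDefect, e, add_ins, sub_app, add_app,
    starMul_app_left hG h.F_nil ha, starMul_app_left hG hG0 ha, starMul_app_right h.F_nil hG ha]
  abel

/-- The effect on the Euler defect of changing `F` in arity `d`. -/
theorem eulerDefect_add_left (h : D.IsPair F T) (hG : G.VanishBelow d) {X Y : A.Ob}
    {a : Chain A.Hom X Y} (ha : a.length ≤ d) :
    (A.eulerDefect D.P D.b (F + G) T).app a =
      (A.eulerDefect D.P D.b F T).app a + G.eul.app a - (ins 1 G D.b 1).app a := by
  have e1 : D.P.starMul (F + G) T = D.P.starMul F T + D.P.starMul G T := add_star _ _ _ _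
  have e2 : (F + G).sgn = F.sgn + G.sgn := post_add (M := fun X Y => Q'.Hom (o X) (o Y)) _ _ _
  have e3 : (F + G).eul = F.eul + G.eul := post_add (M := fun X Y => Q'.Hom (o X) (o Y)) _ _ _
  have e4 : D.P.starMul T (F.sgn + G.sgn) = D.P.starMul T F.sgn + D.P.starMul T G.sgn :=
    star_add _ _ _ _
  simp only [AInfCategory.eulerDefect, e1, e2, e3, e4, add_ins, sub_app, add_app,
    starMul_app_left hG h.T_nil ha, starMul_app_right h.T_nil (vanishBelow_sgn hG) ha]
  abel

/-- Changing `T` in arity `d` changes the Euler defect by a coboundary. -/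
theorem eulerDefect_add_right (h : D.IsPair F T) (hU : U.VanishBelow d) {X Y : A.Ob}
    {a : Chain A.Hom X Y} (ha : a.length ≤ d) :
    (A.eulerDefect D.P D.b F (T + U)).app a =
      (A.eulerDefect D.P D.b F T).app a - (ins (A.koszulEnd 1) U A.μ 1).app a := by
  have e1 : D.P.starMul F (T + U) = D.P.starMul F T + D.P.starMul F U := star_add _ _ _ _
  have e2 : D.P.starMul (T + U) F.sgn = D.P.starMul T F.sgn + D.P.starMul U F.sgn :=
    add_star _ _ _ _
  simp only [AInfCategory.eulerDefect, e1, e2, add_ins, sub_app, add_app,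
    starMul_app_left hU (sgn_nil h.F_nil) ha, starMul_app_right h.F_nil hU ha]
  abel

theorem add_left (h : D.IsPair F T) (hG : G.VanishBelow d) (hd : 2 ≤ d)
    (hdeg : A.HasDegree (Q' := Q') (o := o) G 1) : D.IsPair (F + G) T where
  F_degree := HasDegree.add h.F_degree hdeg
  T_degree := h.T_degree
  F_nil X := by rw [add_app, h.F_nil, hG (nil X) (Nat.lt_of_lt_of_le Nat.zero_lt_two hd),
    add_zero]
  T_nil := h.T_nil
  F_single f := by rw [add_app, h.F_single, hG (single f) hd, add_zero]

theorem add_right (h : D.IsPair F T) (hU : U.VanishBelow d) (hd : 0 < d)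
    (hdeg : A.HasDegree (Q' := Q') (o := o) U 0) : D.IsPair F (T + U) where
  F_degree := h.F_degree
  T_degree := HasDegree.add h.T_degree hdeg
  F_nil := h.F_nil
  T_nil X := by rw [add_app, h.T_nil, hU (nil X) hd, add_zero]
  F_single := h.F_single

theorem primitive_degree {σ : MultiMap k A.Hom fun X Y => Q'.Hom (o X) (o Y)} {e : ℤ}
    (hσ : A.HasDegree (Q' := Q') (o := o) σ (e + 1)) (d : ℕ) :
    A.HasDegree (Q' := Q') (o := o) (part d (ins (A.koszulEnd 1) σ (ofLin D.h) D.π)) e :=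
  HasDegree.part (HasDegree.congr (HasDegree.ins (e := 0) hσ (isGraded_koszulEnd 1) D.isGraded_π
    (HasDegree.ofLin (o := id) fun X Y n f => mem_range_of_congr (D.h_mem X Y n f) (by simp)))
    (by ring)) d

/-- If the Euler defect vanishes on cohomology, it can be killed by changing `T`. -/
theorem exists_right (h : D.IsPair F T) (hd : 0 < d)
    (hE : (A.functorDefect D.P F).VanishBelow (d + 1))
    (hS : (A.eulerDefect D.P D.b F T).VanishBelow d)
    (h0 : ∀ {X Y : A.Ob} (a : Chain A.Hom X Y), a.length = d →
      (A.eulerDefect D.P D.b F T).app (a.mapEnd D.π) = 0) :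
    ∃ T', D.IsPair F T' ∧ (A.eulerDefect D.P D.b F T').VanishBelow (d + 1) := by
  have hE' : (A.functorDefect D.P F).VanishBelow d := fun _ _ a ha =>
    hE a (ha.trans (Nat.lt_succ_self d))
  have hc : D.ClosedIn d (A.eulerDefect D.P D.b F T) := by
    intro X Y a ha
    rw [h.insLin_eulerDefect hE' hS ha, hE a (by omega), map_zero, sub_zero]
    exact insLin_eq_zero _ _ _ a fun c hc => hE c (by omega)
  set U := part d (ins (A.koszulEnd 1) (A.eulerDefect D.P D.b F T) (ofLin D.h) D.π) with hU
  have hUv : U.VanishBelow d := part_vanishBelow d _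
  refine ⟨T + U, h.add_right hUv hd
    (primitive_degree (HasDegree.congr h.eulerDefect_degree (by ring)) d),
    fun _ _ a ha => ?_⟩
  rw [h.eulerDefect_add_right hUv (by omega)]
  rcases Nat.lt_succ_iff_lt_or_eq.1 ha with ha | ha
  · rw [hS a ha, hUv.ins _ _ A.μ_nil a ha, sub_zero]
  · rw [hUv.ins_app_eq _ _ A.μ_nil ha]
    exact sub_eq_zero.2 (hc.exists_primitive h0 ha).symm

/-- An operation which vanishes on homogeneous representatives of cohomology classes vanishes on
all of them. -/
theorem app_mapEnd_π_eq_zero {σ : MultiMap k A.Hom fun X Y => Q'.Hom (o X) (o Y)}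
    (h : ∀ {X Y : A.Ob} (a : Chain A.Hom X Y) (n : ℤ), A.IsHomog a n → a.length = d →
      σ.app (a.mapEnd D.π) = 0) {X Y : A.Ob} (a : Chain A.Hom X Y) (ha : a.length = d) :
    σ.app (a.mapEnd D.π) = 0 := by
  have e : (part d σ).pre D.π = 0 := by
    refine ext_homog fun X Y a n hn => ?_
    change (part d σ).app (a.mapEnd D.π) = 0
    by_cases hd : a.length = d
    · rw [part_app_self _ ((length_mapEnd _ a).trans hd), h a n hn hd]
    · rw [part_app_of_ne _ (by rwa [length_mapEnd])]
  have := congrArg (fun τ => τ.app a) e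
  exact (part_app_self σ ((length_mapEnd _ a).trans ha)).symm.trans this

theorem functorDefect_app_pair (h : D.IsPair F T) {X Y : A.Ob} {a : Chain A.Hom X Y}
    (ha : a.length = 2) : (A.functorDefect D.P F).app (a.mapEnd D.π) = 0 := by
  rcases a with _ | ⟨_ | ⟨_ | ⟨p, e⟩, f⟩, g⟩
  · simp [length] at ha
  · simp [length] at ha
  · rename_i Y Z
    simp only [mapEnd]
    set f' := D.π _ _ f with hf
    set g' := D.π _ _ g with hg
    have h0 : A.μ.app (single f') = 0 := D.d_π f
    have h1 : A.μ.app (single g') = 0 := D.d_π g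
    have h2 : A.μ.app (pair g' f') = A.mul g' f' := rfl
    have h3 : F.app (single (A.mul g' f')) =
        D.P.mul _ _ _ (F.app (single g')) (F.app (single f')) := by
      rw [h.F_single, h.F_single, h.F_single, hg, hf, D.p_mul_π]
    have z1 := F.app_zero (Y := X) (nil X) ((single f').cons g')
    have z2 := F.app_zero (Y := Z) (single (A.koszulEnd 1 X Z f')) (single g')
    have z3 := F.app_zero (Y := Y) ((single (A.koszulEnd 1 X Z f')).cons (A.koszulEnd 1 _ _ g'))
      (nil Y)
    have z4 := F.app_zero (Y := Z) (nil X) (single g')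
    have z5 := F.app_zero (Y := Y) (single (A.koszulEnd 1 X Z f')) (nil Y)
    rw [AInfCategory.functorDefect, sub_app, sub_eq_zero, AssocProduct.starMul, star_app, ins_app]
    simp only [single, pair, comp] at h0 h1 h2 h3 z1 z2 z3 z4 z5
    simp only [sumSplits₃, sumSplits_cons, sumSplits_nil, mapEnd, mapEnd_one, comp, A.μ_nil,
      h.F_nil, h0, h1, h2, h3, z1, z2, z3, z4, z5, map_zero, LinearMap.zero_apply, add_zero,
      zero_add]
  · simp [length] at ha

/-- The functor defect vanishes on cohomology: there the Euler field acts on its arity `d` part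
with weight `2 - d`, which is not zero for `d ≥ 3`. -/
theorem functorDefect_app_π [CharZero k] (h : D.IsPair F T) (hd : 2 ≤ d)
    (hE : (A.functorDefect D.P F).VanishBelow d)
    (hS : (A.eulerDefect D.P D.b F T).VanishBelow d) {X Y : A.Ob} (a : Chain A.Hom X Y)
    (ha : a.length = d) : (A.functorDefect D.P F).app (a.mapEnd D.π) = 0 := by
  rcases hd.eq_or_lt with rfl | hd
  · exact h.functorDefect_app_pair ha
  refine app_mapEnd_π_eq_zero (fun a n hn ha => ?_) a ha
  have h1 := h.insLin_eulerDefect hE hS ((length_mapEnd D.π a).trans ha)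
  rw [insLin_of_all _ _ _ (isAdditive _) (D.all_mapEnd_π a),
    (h.closedIn_functorDefect hE).insLin_b ha hn,
    euler_of_mem (h.functorDefect_degree _ _ (hn.mapEnd D.isGraded_π)), ← sub_smul] at h1
  have h2 : ((n + d : ℤ) : k) - ((n + 2 : ℤ) : k) ≠ 0 := by
    rw [← Int.cast_sub, Int.cast_ne_zero]
    omega
  exact (smul_eq_zero.1 h1.symm).resolve_left h2

/-- The Euler defect can be made to vanish on cohomology by changing `F` by a closed operation:
there the Euler field acts on the arity `d` part of `F` with weight `1 - d`. -/
theorem exists_left [CharZero k] (h : D.IsPair F T) (hd : 2 ≤ d)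
    (hE : (A.functorDefect D.P F).VanishBelow (d + 1))
    (hS : (A.eulerDefect D.P D.b F T).VanishBelow d) :
    ∃ G : MultiMap k A.Hom fun X Y => Q'.Hom (o X) (o Y), G.VanishBelow d ∧
      D.IsPair (F + G) T ∧
      (A.functorDefect D.P (F + G)).VanishBelow (d + 1) ∧
      (A.eulerDefect D.P D.b (F + G) T).VanishBelow d ∧
      ∀ {X Y : A.Ob} (a : Chain A.Hom X Y), a.length = d →
        (A.eulerDefect D.P D.b (F + G) T).app (a.mapEnd D.π) = 0 := by
  have hE' : (A.functorDefect D.P F).VanishBelow d := fun _ _ a ha =>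
    hE a (ha.trans (Nat.lt_succ_self d))
  have hc : D.ClosedIn d (A.eulerDefect D.P D.b F T) := by
    intro X Y a ha
    rw [h.insLin_eulerDefect hE' hS ha, hE a (by omega), map_zero, sub_zero]
    exact insLin_eq_zero _ _ _ a fun c hc => hE c (by omega)
  -- division by the weight
  set c : k := ((d : k) - 1)⁻¹ with hcd
  have hd1 : (d : k) - 1 ≠ 0 := by
    rw [sub_ne_zero]
    exact_mod_cast (show d ≠ 1 by omega)
  set G : MultiMap k A.Hom fun X Y => Q'.Hom (o X) (o Y) :=
    part d (post (M := fun X Y => Q'.Hom (o X) (o Y)) (M' := fun X Y => Q'.Hom (o X) (o Y))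
      (fun _ _ => c • LinearMap.id) (A.eulerDefect D.P D.b F T)) with hG
  have hGapp : ∀ {X Y : A.Ob} (a : Chain A.Hom X Y), a.length = d →
      G.app a = c • (A.eulerDefect D.P D.b F T).app a := fun a ha => part_app_self _ ha
  have hGv : G.VanishBelow d := part_vanishBelow d _
  have hGd : A.HasDegree (Q' := Q') (o := o) G 1 :=
    HasDegree.part (HasDegree.post h.eulerDefect_degree fun X Y n f =>
      Submodule.smul_mem (LinearMap.range (Q'.of n)) c ⟨f, rfl⟩) d
  have hGc : D.ClosedIn d G := by
    intro X Y a ha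
    have e := map_sumEntries (DistribSMul.toAddMonoidHom (Q'.Hom (o X) (o Y)) c) a
      fun _ _ p f r => (A.eulerDefect D.P D.b F T).app
        (((p.mapEnd (A.koszulEnd 1)).cons (A.dEnd _ _ f)).comp (r.mapEnd (1 : EndFam k A.Hom)))
    refine (insLin_congr _ _ _ a fun b hb => hGapp b (hb.trans ha)).trans (e.symm.trans ?_)
    exact (congrArg (c • ·) (hc a ha)).trans (smul_zero c)
  have hp := h.add_left hGv hd hGd
  refine ⟨G, hGv, hp, fun _ _ a ha => ?_, fun _ _ a ha => ?_, ?_⟩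
  · rw [h.functorDefect_add hGv (by omega) (by omega), hE a ha]
    rcases Nat.lt_succ_iff_lt_or_eq.1 ha with ha | ha
    · rw [hGv.ins _ _ A.μ_nil a ha, sub_zero]
    · rw [hGv.ins_app_eq _ _ A.μ_nil ha, zero_sub, neg_eq_zero]
      exact hGc a ha
  · rw [h.eulerDefect_add_left hGv ha.le, hS a ha, vanishBelow_eul hGv a ha,
      hGv.ins _ _ D.b_nil a ha, add_zero, sub_zero]
  · refine app_mapEnd_π_eq_zero fun a n hn ha => ?_
    have ha' : (a.mapEnd D.π).length = d := (length_mapEnd D.π a).trans ha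
    rw [h.eulerDefect_add_left hGv ha'.le, hGv.ins_app_eq _ _ D.b_nil ha', hGc.insLin_b ha hn]
    change _ + Q'.euler _ _ (G.app _) - _ = _
    rw [euler_of_mem (hGd _ _ (hn.mapEnd D.isGraded_π)), hGapp _ ha', smul_smul, smul_smul,
      add_sub_assoc, ← sub_smul, ← sub_mul]
    have e : (((n + 1 : ℤ) : k) - ((n + d : ℤ) : k)) * c = -1 := by
      rw [hcd]
      push_cast
      field_simp
      ring
    rw [e, neg_one_smul, add_neg_cancel]

/-- The induction step of the construction of the functor. -/
theorem exists_next [CharZero k] (h : D.IsPair F T) (hd : 2 ≤ d)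
    (hE : (A.functorDefect D.P F).VanishBelow d)
    (hS : (A.eulerDefect D.P D.b F T).VanishBelow d) :
    ∃ F' T', D.IsPair F' T' ∧ (∀ {X Y : A.Ob} (a : Chain A.Hom X Y), a.length < d →
      F'.app a = F.app a) ∧ (A.functorDefect D.P F').VanishBelow (d + 1) ∧
      (A.eulerDefect D.P D.b F' T').VanishBelow (d + 1) := by
  have hc := h.closedIn_functorDefect hE
  set G := part d (ins (A.koszulEnd 1) (A.functorDefect D.P F) (ofLin D.h) D.π) with hG
  have hGv : G.VanishBelow d := part_vanishBelow d _
  have hp := h.add_left hGv hd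
    (primitive_degree (HasDegree.congr h.functorDefect_degree (by ring)) d)
  have hE' : (A.functorDefect D.P (F + G)).VanishBelow (d + 1) := fun _ _ a ha => by
    rw [h.functorDefect_add hGv (by omega) (by omega)]
    rcases Nat.lt_succ_iff_lt_or_eq.1 ha with ha | ha
    · rw [hE a ha, hGv.ins _ _ A.μ_nil a ha, sub_zero]
    · rw [hGv.ins_app_eq _ _ A.μ_nil ha]
      exact sub_eq_zero.2 (hc.exists_primitive (h.functorDefect_app_π hd hE hS) ha).symm
  have hS' : (A.eulerDefect D.P D.b (F + G) T).VanishBelow d := fun _ _ a ha => by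
    rw [h.eulerDefect_add_left hGv ha.le, hS a ha, vanishBelow_eul hGv a ha,
      hGv.ins _ _ D.b_nil a ha, add_zero, sub_zero]
  obtain ⟨G', hGv', hp', hE'', hS'', h0⟩ := hp.exists_left hd hE' hS'
  obtain ⟨T', hp'', hS'''⟩ := hp'.exists_right (by omega) hE'' hS'' h0
  refine ⟨_, T', hp'', fun a ha => ?_, hE'', hS'''⟩
  rw [add_app, add_app, hGv a ha, hGv' a ha, add_zero, add_zero]

end IsPair

end FormalityData

end AInf

namespace AInf

open Chain MultiMap GradedQuiver

namespace FormalityData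

variable {k : Type w} [Field k] {A : AInfCategory.{u, v, w} k}
  {Q' : GradedQuiver.{u', v', w} k} {o : A.Ob → Q'.Ob} (D : FormalityData A Q' o)

/-- The start of the induction: the functor whose only term is `p`. On cohomology, its Euler defect
vanishes because `b` acts as the Euler field. -/
theorem exists_base : ∃ F T, D.IsPair F T ∧ (A.functorDefect D.P F).VanishBelow 2 ∧
    (A.eulerDefect D.P D.b F T).VanishBelow 2 := by
  set F : MultiMap k A.Hom fun X Y => Q'.Hom (o X) (o Y) :=
    ofLin (M := fun X Y => Q'.Hom (o X) (o Y)) D.p with hF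
  have hF1 : F.VanishBelow 1 := fun X Y a ha => ofLin_app_of_length _ ha.ne
  have h : D.IsPair F 0 :=
    { F_degree := HasDegree.ofLin fun X Y n f => mem_range_of_congr (D.p_mem X Y n f) (by ring)
      T_degree := HasDegree.zero
      F_nil := fun X => hF1 (nil X) Nat.zero_lt_one
      T_nil := fun X => rfl
      F_single := fun f => rfl }
  have h0v : ∀ d, (0 : MultiMap k A.Hom fun X Y => Q'.Hom (o X) (o Y)).VanishBelow d :=
    fun _ _ _ _ _ => rfl
  have hE : (A.functorDefect D.P F).VanishBelow 2 := fun X Y a ha => by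
    rw [AInfCategory.functorDefect, sub_app, starMul_app_left hF1 h.F_nil (by omega), zero_sub,
      neg_eq_zero]
    rcases Nat.lt_succ_iff_lt_or_eq.1 ha with ha | ha
    · exact hF1.ins _ _ A.μ_nil a ha
    · rw [hF1.ins_app_eq _ _ A.μ_nil ha]
      rcases a with _ | ⟨_ | ⟨p, e⟩, f⟩
      · simp [length] at ha
      · rw [insLin_cons]
        exact (zero_add _).trans (D.p_d _ _ f)
      · simp [length] at ha
  -- with `T = 0`, only the first two terms of the Euler defect are left
  have hS : ∀ {X Y : A.Ob} (a : Chain A.Hom X Y), a.length < 2 →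
      (A.eulerDefect D.P D.b F 0).app a = F.eul.app a - (ins 1 F D.b 1).app a := by
    intro X Y a ha
    simp only [AInfCategory.eulerDefect, sub_app]
    rw [starMul_app_right h.F_nil (h0v _) le_rfl, starMul_app_left (h0v _) (sgn_nil h.F_nil) le_rfl,
      (h0v 2).ins _ _ A.μ_nil a ha, sub_zero, sub_zero, sub_zero]
  have hS1 : (A.eulerDefect D.P D.b F 0).VanishBelow 1 := fun X Y a ha => by
    rw [hS a (by omega), vanishBelow_eul hF1 a ha, hF1.ins _ _ D.b_nil a ha, sub_zero]
  obtain ⟨T, hT, hST⟩ := h.exists_right Nat.zero_lt_one hE hS1 fun a ha => by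
    refine IsPair.app_mapEnd_π_eq_zero (d := 1) (fun a n hn ha => ?_) a ha
    have ha' := (length_mapEnd D.π a).trans ha
    rw [hS _ (by omega), hF1.ins_app_eq _ _ D.b_nil ha', sub_eq_zero]
    rcases hn with _ | ⟨_ | ⟨hp, j, e⟩, m, f⟩
    · simp [length] at ha
    · rw [mapEnd, insLin_cons]
      refine Eq.trans ?_ (zero_add _).symm
      obtain ⟨g, hg⟩ := D.isGraded_π _ _ m f
      have h1 := D.d_π (A.of m f)
      change Q'.euler _ _ (D.p _ _ (D.π _ _ (A.of m f))) =
        D.p _ _ (D.b.lin _ _ (D.π _ _ (A.of m f)))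
      rw [← hg] at h1 ⊢
      obtain ⟨x, hx⟩ := D.b_euler _ _ m g h1
      rw [euler_of_mem (D.p_mem _ _ m g), ← sub_add_cancel (D.b.lin _ _ _) ((m : k) • A.of m g),
        ← hx, map_add, D.p_d, zero_add, map_smul]
    · simp [length] at ha
  exact ⟨F, T, hT, hE, hST⟩

/-- The chain map `p` extends to an `A∞`-functor. -/
theorem exists_functor [CharZero k] :
    ∃ F : MultiMap k A.Hom fun X Y => Q'.Hom (o X) (o Y),
      A.HasDegree (Q' := Q') (o := o) F 1 ∧ (∀ X, F.app (nil X) = 0) ∧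
      (∀ X Y (f : A.Hom X Y), F.app (single f) = D.p X Y f) ∧ A.functorDefect D.P F = 0 := by
  let S : ℕ → Type _ := fun n =>
    {q : (MultiMap k A.Hom fun X Y => Q'.Hom (o X) (o Y)) ×
        (MultiMap k A.Hom fun X Y => Q'.Hom (o X) (o Y)) //
      D.IsPair q.1 q.2 ∧ (A.functorDefect D.P q.1).VanishBelow (n + 2) ∧
        (A.eulerDefect D.P D.b q.1 q.2).VanishBelow (n + 2)}
  have next : ∀ n (s : S n), ∃ s' : S (n + 1), ∀ {X Y : A.Ob} (a : Chain A.Hom X Y),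
      a.length < n + 2 → s'.1.1.app a = s.1.1.app a := by
    rintro n ⟨⟨F, T⟩, h, hE, hS⟩
    obtain ⟨F', T', h', e, hE', hS'⟩ := h.exists_next (by omega) hE hS
    exact ⟨⟨⟨F', T'⟩, h', hE', hS'⟩, e⟩
  choose nxt hnxt using next
  obtain ⟨F₀, T₀, h₀, hE₀, hS₀⟩ := D.exists_base
  let s : ∀ n, S n := fun n => Nat.rec ⟨⟨F₀, T₀⟩, h₀, hE₀, hS₀⟩ nxt n
  have stable : ∀ n m {X Y : A.Ob} (a : Chain A.Hom X Y), a.length < n + 2 →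
      (s (n + m)).1.1.app a = (s n).1.1.app a := by
    intro n m X Y a ha
    induction m with
    | zero => rfl
    | succ m ih => exact (hnxt (n + m) (s (n + m)) a (by omega)).trans ih
  let F := glue fun n => (s n).1.1
  refine ⟨F, HasDegree.glue fun n => (s n).2.1.F_degree, fun X => (s 0).2.1.F_nil X,
    fun X Y f => (s 1).2.1.F_single f, ext_app fun X Y a => ?_⟩
  -- up to the arity of `a`, the limit agrees with one of the approximations
  set N := a.length with hN
  have hG : (F - (s N).1.1).VanishBelow (N + 1) := fun X Y c hc => by
    rw [sub_app, sub_eq_zero]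
    change (s c.length).1.1.app c = _
    obtain ⟨m, hm⟩ := Nat.exists_eq_add_of_le (Nat.lt_succ_iff.1 hc)
    rw [hm]
    exact (stable _ m c (by omega)).symm
  have e := (s N).2.1.functorDefect_add hG (Nat.succ_pos N) (a := a) (Nat.le_succ N)
  rw [add_sub_cancel, (s N).2.2.1 a (by omega), hG.ins _ _ A.μ_nil a (Nat.lt_succ_self N),
    sub_zero] at e
  exact e

end FormalityData

end AInf

namespace AInf

open Chain MultiMap GradedQuiver

/-! ### Sums over blocks for a binary operation -/

namespace Chain

variable {Ob : Type u} {H : Ob → Ob → Type v} {N : Type*} [AddCommMonoid N] {X Y Z : Ob}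

/-- The value of `G` on sequences of one block, and zero otherwise. -/
def onOneBlock (G : Chain H X Y → N) : Chain (fun A B => Chain H A B) X Y → N
  | cons (nil _) q => G q
  | _ => 0

/-- The value of `G` on sequences of two blocks, and zero otherwise. -/
def onTwoBlocks (G : ∀ V, Chain H X V → Chain H V Y → N) :
    Chain (fun A B => Chain H A B) X Y → N
  | cons (cons (nil _) p) q => G _ p q
  | _ => 0

theorem sum_blocks_cons (p : Chain H X Y) (f : H Y Z)
    (G : Chain (fun A B => Chain H A B) X Z → N) :
    ((p.cons f).blocks.map G).sum =
      (p.blocks.map fun P => ((addToBlocks P f).map G).sum).sum := by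
  simp only [blocks, List.map_flatMap]
  induction p.blocks with
  | nil => rfl
  | cons P L ih => simp [ih]

theorem length_ne_zero_of_mem_blocks (p : Chain H X Y) (f : H Y Z) :
    ∀ P ∈ (p.cons f).blocks, P.length ≠ 0 := by
  intro P hP
  obtain ⟨P', -, hP'⟩ := List.mem_flatMap.1 hP
  cases P' <;> simp only [addToBlocks, List.mem_cons, List.not_mem_nil, or_false] at hP'
  · subst hP'
    simp [length]
  · rcases hP' with rfl | rfl <;> simp [length]

theorem sum_onOneBlock (G : Chain H X Y → N) (a : Chain H X Y) :
    (a.blocks.map (onOneBlock G)).sum = if a.length = 0 then 0 else G a := by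
  induction a with
  | nil => simp [blocks, onOneBlock, length]
  | cons p f ih =>
    cases p with
    | nil => simp [blocks, addToBlocks, onOneBlock, length, single]
    | cons p g =>
      rw [sum_blocks_cons, List.map_congr_left
        (g := onOneBlock fun q => G (q.cons f)), ih]
      · simp [length]
      · intro P hP
        have := length_ne_zero_of_mem_blocks p g P hP
        rcases P with _ | ⟨_ | ⟨P, q⟩, q'⟩
        · simp [length] at this
        · simp [addToBlocks, onOneBlock]
        · simp [addToBlocks, onOneBlock]

theorem sum_onTwoBlocks (G : ∀ V, Chain H X V → Chain H V Y → N) (a : Chain H X Y)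
    (hG : ∀ q, G X (nil X) q = 0) :
    (a.blocks.map (onTwoBlocks G)).sum + G Y a (nil Y) = a.sumSplits G := by
  induction a with
  | nil => simp [blocks, onTwoBlocks, sumSplits_nil]
  | cons p f ih =>
    have e : ∀ P : Chain (fun A B => Chain H A B) X _,
        ((addToBlocks P f).map (onTwoBlocks G)).sum =
        onTwoBlocks (fun V q₁ q₂ => G V q₁ (q₂.cons f)) P +
          onOneBlock (fun q => G _ q (single f)) P := by
      intro P
      rcases P with _ | ⟨_ | ⟨_ | ⟨P, q⟩, q'⟩, q''⟩ <;>
        simp [addToBlocks, onTwoBlocks, onOneBlock]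
    rw [sum_blocks_cons, sumSplits_cons, ← ih _ fun q => hG _]
    simp only [e, List.sum_map_add, sum_onOneBlock]
    rw [add_comm (G _ _ _)]
    congr 2
    cases p with
    | nil => simp [length, hG]
    | cons p g => simp [length, single]

end Chain

end AInf

namespace AInf

open Chain MultiMap GradedQuiver

/-! ### Removing the constant term of an nc-vector field -/

namespace MultiMap

variable {k : Type w} [Field k] {Ob : Type u} {H : Ob → Ob → Type v}
    {M : Ob → Ob → Type v'} [∀ X Y, AddCommGroup (H X Y)] [∀ X Y, Module k (H X Y)]
    [∀ X Y, AddCommGroup (M X Y)] [∀ X Y, Module k (M X Y)]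

/-- The values of `ofConst x`. -/
def ofConstApp (x : ∀ X, M X X) {X Y : Ob} : Chain H X Y → M X Y
  | .nil _ => x _
  | _ => 0

omit [∀ X Y, AddCommGroup (H X Y)] in
theorem ofConstApp_of_length (x : ∀ X, M X X) {X Y : Ob} (a : Chain H X Y) (h : a.length ≠ 0) :
    ofConstApp x a = 0 := by
  cases a with
  | nil => simp [length] at h
  | cons p f => rfl

/-- The family of operations whose only non-zero terms are given constants. -/
def ofConst (x : ∀ X, M X X) : MultiMap k H M where
  app a := ofConstApp x a
  app_add p f g r := by
    rw [ofConstApp_of_length, ofConstApp_of_length, ofConstApp_of_length, add_zero] <;>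
      simp only [length_comp, length] <;> omega
  app_smul p c f r := by
    rw [ofConstApp_of_length, ofConstApp_of_length, smul_zero] <;>
      simp only [length_comp, length] <;> omega

theorem ofConst_app_of_length (x : ∀ X, M X X) {X Y : Ob} {a : Chain H X Y} (h : a.length ≠ 0) :
    (ofConst (k := k) x).app a = 0 := ofConstApp_of_length x a h

end MultiMap

namespace AInfCategory

variable {k : Type w} [Field k] {A : AInfCategory.{u, v, w} k}

namespace NCVectorField

variable (V : A.NCVectorField) (c : ∀ X, V.EquivariantStructure X)

/-- The equivariant structures, as a Hochschild cochain of degree zero. -/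
def constCochain : MultiMap k A.Hom A.Hom :=
  ofConst (M := A.Hom) fun X => A.of 0 (c X).c

/-- The nc-vector field minus the Hochschild differential of the equivariant structures. -/
def reduced : MultiMap k A.Hom A.Hom := V.b - ins (A.koszulEnd 1) A.μ (V.constCochain c) 1

theorem constCochain_degree :
    A.HasDegree (Q' := A.toGradedQuiver) (o := id) (V.constCochain c) 0 := by
  intro X Y p n hp
  rcases hp with _ | ⟨hp, m, f⟩
  · exact ⟨(c _).c, rfl⟩
  · exact zero_mem _

theorem reduced_degree : A.HasDegree (Q' := A.toGradedQuiver) (o := id) (V.reduced c) 1 :=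
  HasDegree.sub (o := id) V.b_degree (HasDegree.congr (o := id) (HasDegree.ins (o := id) A.μ_degree
    (isGraded_koszulEnd 1) isGraded_one (V.constCochain_degree c)) (by norm_num))

theorem reduced_nil (X : A.Ob) : (V.reduced c).app (nil X) = 0 := by
  rw [reduced, sub_app, ins_app, sub_eq_zero]
  simp only [sumSplits₃, sumSplits_nil]
  exact (c X).d_c.symm

theorem reduced_lin {X Y : A.Ob} (f : A.Hom X Y) :
    (V.reduced c).lin X Y f = V.endo (c X) (c Y) f := by
  change (V.reduced c).app (single f) = _
  have z : A.μ.app (((nil X).cons ((V.constCochain c).app (single f)))) = 0 := by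
    rw [constCochain, ofConst_app_of_length _ (by simp [single, length])]
    exact A.μ_zero (nil X) (nil Y)
  simp only [single] at z
  rw [reduced, sub_app, ins_app, endo, sub_sub]
  simp only [sumSplits₃, single, sumSplits_cons, sumSplits_nil, mapEnd, mapEnd_one, comp, z,
    add_zero]
  rw [add_comm]
  rfl

theorem ins_b : ins 1 A.μ V.b 1 = ins (A.koszulEnd 1) V.b A.μ 1 := by
  refine ext_app fun X Y a => ?_
  have h := V.b_closed a
  rw [hochschildDiff, conv_eq_ins, conv_eq_ins, sub_self, koszulEnd_of_even (by decide), zpow_one,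
    neg_one_smul, ← sub_eq_add_neg, sub_eq_zero] at h
  exact h

theorem reduced_closed : ins 1 A.μ (V.reduced c) 1 = ins (A.koszulEnd 1) (V.reduced c) A.μ 1 := by
  have h0 : ins (A.koszulEnd 1) (V.constCochain c) A.μ 1 = 0 := by
    refine ext_app fun X Y a => ?_
    rw [ins_app]
    refine (sumSplits₃_congr a fun _ _ p q r _ => ?_).trans (sumSplits₃_zero a)
    exact ofConst_app_of_length _ (by simp only [length_comp, length]; omega)
  have h1 : ins 1 A.μ (ins (A.koszulEnd 1) A.μ (V.constCochain c) 1) 1 =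
      ins (A.koszulEnd 1) (ins (A.koszulEnd 1) A.μ (V.constCochain c) 1) A.μ 1 := by
    refine ext_app fun X Y a => ?_
    have h := ins_ins (A.koszulEnd 1) (A.koszulEnd 1) rfl (-1) (by ring) A.μ (V.constCochain c) A.μ
      (fun X Y a => (HasDegree.app_mapEnd_koszulEnd (o := id) (V.constCochain_degree c) 1 a).trans
        (by norm_num; rfl))
      (fun _ _ => A.μ_app_mapEnd) a
    rw [A.ins_μ_μ, h0, ins_zero, koszulEnd_one_mul_self, zero_app, neg_one_smul, neg_one_smul,
      zero_sub, neg_neg, sub_neg_eq_add] at h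
    rw [← h]
    have : ins (A.koszulEnd 1) (0 : MultiMap k A.Hom A.Hom) (V.constCochain c) 1 = 0 := by
      simpa using add_ins (A.koszulEnd 1) 1 (0 : MultiMap k A.Hom A.Hom) 0 (V.constCochain c)
    rw [this, zero_app, add_zero]
  rw [reduced, ins_sub, sub_ins, V.ins_b, h1]

end NCVectorField

/-! ### Contraction onto cohomology -/

/-- Every linear map has a generalized inverse. -/
theorem _root_.LinearMap.exists_generalizedInverse {V W : Type*} [AddCommGroup V] [Module k V]
    [AddCommGroup W] [Module k W] (φ : V →ₗ[k] W) : ∃ g : W →ₗ[k] V, φ ∘ₗ g ∘ₗ φ = φ := by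
  obtain ⟨s, hs⟩ := φ.rangeRestrict.exists_rightInverse_of_surjective φ.range_rangeRestrict
  obtain ⟨r, hr⟩ := φ.range.subtype.exists_leftInverse_of_injective φ.range.ker_subtype
  refine ⟨s ∘ₗ r, LinearMap.ext fun x => ?_⟩
  have h1 : r (φ x) = φ.rangeRestrict x := LinearMap.congr_fun hr (φ.rangeRestrict x)
  have h2 := congrArg Subtype.val (LinearMap.congr_fun hs (φ.rangeRestrict x))
  change φ (s (r (φ x))) = φ x
  rw [h1]
  exact h2

variable (A)

/-- A generalized inverse of the differential can be chosen of degree `-1`. -/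
theorem exists_homotopy : ∃ h : EndFam k A.Hom,
    (∀ X Y (n : ℤ) (f : A.hom X Y n), h X Y (A.of n f) ∈
      LinearMap.range (A.of (X := X) (Y := Y) (n - 1))) ∧
    ∀ X Y (f : A.Hom X Y), A.d X Y (h X Y (A.d X Y f)) = A.d X Y f := by
  have key : ∀ X Y (n : ℤ), ∃ g : A.hom X Y n →ₗ[k] A.hom X Y (n - 1),
      (A.proj n ∘ₗ A.d X Y ∘ₗ A.of (n - 1)) ∘ₗ g ∘ₗ (A.proj n ∘ₗ A.d X Y ∘ₗ A.of (n - 1)) =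
        A.proj n ∘ₗ A.d X Y ∘ₗ A.of (n - 1) := fun X Y n =>
    LinearMap.exists_generalizedInverse _
  choose g hg using key
  have hd : ∀ X Y (n : ℤ) (f : A.hom X Y (n - 1)),
      A.of n (A.proj n (A.d X Y (A.of (n - 1) f))) = A.d X Y (A.of (n - 1) f) := fun X Y n f =>
    A.of_proj (mem_range_of_congr (A.d_of_mem f) (by ring))
  have hh : ∀ X Y (n : ℤ) (f : A.hom X Y n), DirectSum.toModule k ℤ (A.Hom X Y)
      (fun n => A.of (n - 1) ∘ₗ g X Y n) (A.of n f) = A.of (n - 1) (g X Y n f) := fun X Y n f =>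
    DirectSum.toModule_lof k n f
  refine ⟨fun X Y => DirectSum.toModule k ℤ _ fun n => A.of (n - 1) ∘ₗ g X Y n,
    fun X Y n f => ⟨_, (hh X Y n f).symm⟩, fun X Y => ?_⟩
  refine LinearMap.congr_fun (f := A.d X Y ∘ₗ (DirectSum.toModule k ℤ (A.Hom X Y) fun n =>
    A.of (n - 1) ∘ₗ g X Y n) ∘ₗ A.d X Y) (linearMap_ext fun m f => ?_)
  obtain ⟨n, rfl⟩ : ∃ n, m = n - 1 := ⟨m + 1, by ring⟩
  change A.d X Y (DirectSum.toModule k ℤ (A.Hom X Y) (fun n => A.of (n - 1) ∘ₗ g X Y n)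
    (A.d X Y (A.of (n - 1) f))) = _
  rw [← hd, hh, ← hd]
  exact congrArg (A.of n) (LinearMap.congr_fun (hg X Y n) f)

/-- There is a chain map from the morphism spaces to their cohomology which sends each cocycle to
its class. -/
theorem exists_projection : ∃ p : ∀ X Y, A.Hom X Y →ₗ[k] A.cohomologyQuiver.Hom X Y,
    (∀ X Y (n : ℤ) (f : A.hom X Y n), p X Y (A.of n f) ∈
      LinearMap.range (A.cohomologyQuiver.of (X := X) (Y := Y) n)) ∧
    (∀ X Y f, p X Y (A.d X Y f) = 0) ∧
    ∀ X Y (n : ℤ) (z : A.cocycles X Y n), p X Y (A.of n (z : A.hom X Y n)) =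
      A.cohomologyQuiver.of (X := X) (Y := Y) n (A.cls n z) := by
  have key : ∀ X Y (n : ℤ), ∃ r : A.hom X Y n →ₗ[k] A.cocycles X Y n,
      ∀ z : A.cocycles X Y n, r z = z := fun X Y n => by
    obtain ⟨r, hr⟩ := (A.cocycles X Y n).subtype.exists_leftInverse_of_injective
      (Submodule.ker_subtype _)
    exact ⟨r, fun z => LinearMap.congr_fun hr z⟩
  choose r hr using key
  have hp : ∀ X Y (n : ℤ) (f : A.hom X Y n), DirectSum.toModule k ℤ (A.cohomologyQuiver.Hom X Y)
      (fun n => A.cohomologyQuiver.of (X := X) (Y := Y) n ∘ₗ A.cls n ∘ₗ r X Y n) (A.of n f) =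
        A.cohomologyQuiver.of (X := X) (Y := Y) n (A.cls n (r X Y n f)) := fun X Y n f =>
    DirectSum.toModule_lof k n f
  refine ⟨fun X Y => DirectSum.toModule k ℤ _ fun n =>
    A.cohomologyQuiver.of (X := X) (Y := Y) n ∘ₗ A.cls n ∘ₗ r X Y n,
    fun X Y n f => ⟨_, (hp X Y n f).symm⟩, fun X Y => ?_, fun X Y n z => ?_⟩
  · refine LinearMap.congr_fun (f := (DirectSum.toModule k ℤ (A.cohomologyQuiver.Hom X Y) fun n =>
      A.cohomologyQuiver.of (X := X) (Y := Y) n ∘ₗ A.cls n ∘ₗ r X Y n) ∘ₗ A.d X Y) (g := 0)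
      (linearMap_ext fun n f => ?_)
    obtain ⟨g, hg⟩ := A.d_of_mem f
    have hz : g ∈ A.cocycles X Y (n + 1) := by
      change A.d X Y (A.of (n + 1) g) = 0
      rw [hg, A.d_d]
    change DirectSum.toModule k ℤ (A.cohomologyQuiver.Hom X Y)
      (fun n => A.cohomologyQuiver.of (X := X) (Y := Y) n ∘ₗ A.cls n ∘ₗ r X Y n)
      (A.d X Y (A.of n f)) = 0
    rw [← hg, hp, hr X Y (n + 1) ⟨g, hz⟩, A.cls_eq_zero.2 ⟨_, hg.symm⟩]
    exact map_zero _
  · rw [hp, hr]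

theorem cls_surjective (X Y : A.Ob) (n : ℤ) :
    Function.Surjective (A.cls n : A.cocycles X Y n →ₗ[k] A.Cohomology X Y n) :=
  Submodule.mkQ_surjective _

/-- The product on cohomology. -/
def cohomologyProduct : AssocProduct A.cohomologyQuiver where
  mul := A.cohomologyTotalMul
  mul_mem _ _ _ _ _ g f := A.cohomologyCategory.mul_of_mem g f
  assoc W X Y Z c b a := by
    obtain ⟨x, hx⟩ := A.cohomologyCategory.mul_mul c b a rfl rfl rfl
    exact hx.symm

/-- If `A` is pure, then all the data needed to construct a functor from `A` to its cohomological
category are available. -/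
theorem IsPure.exists_formalityData (hA : A.IsPure) :
    ∃ D : FormalityData A A.cohomologyQuiver id, D.P = A.cohomologyProduct ∧
      ∀ X Y (n : ℤ) (z : A.cocycles X Y n), D.p X Y (A.of n (z : A.hom X Y n)) =
        A.cohomologyQuiver.of (X := X) (Y := Y) n (A.cls n z) := by
  obtain ⟨V, c, hV⟩ := hA
  obtain ⟨h, h_mem, d_h_d⟩ := A.exists_homotopy
  obtain ⟨p, p_mem, p_d, hp⟩ := A.exists_projection
  refine ⟨{ P := A.cohomologyProduct
            b := V.reduced c
            b_degree := V.reduced_degree c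
            b_nil := V.reduced_nil c
            b_closed := V.reduced_closed c
            b_euler := fun X Y n f hf => ?_
            h := h
            h_mem := h_mem
            d_h_d := d_h_d
            p := p
            p_mem := p_mem
            p_d := p_d
            p_mul := fun X Y Z m n g f hg hf => ?_ }, rfl, hp⟩
  · rw [V.reduced_lin]
    exact hV X Y n ⟨f, hf⟩
  · have h1 := A.of_cocycleMul (⟨g, hg⟩ : A.cocycles Y Z m) (⟨f, hf⟩ : A.cocycles X Y n)
    have h2 := hp Y Z m ⟨g, hg⟩
    have h3 := hp X Y n ⟨f, hf⟩
    simp only at h1 h2 h3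
    rw [← h1, hp, h2, h3]
    exact (A.cohomologyTotalMul_of (A.cls m ⟨g, hg⟩) (A.cls n ⟨f, hf⟩)).symm

end AInfCategory

end AInf

theorem mainTheorem3 {k : Type w} [Field k] [CharZero k] (A : AInf.AInfCategory.{u, v, w} k)
    (hA : A.IsPure) : A.IsFormal := by
  obtain ⟨D, hP, hp⟩ := hA.exists_formalityData
  obtain ⟨F, hF, hF0, hF1, hE⟩ := D.exists_functor
  have hFz : ∀ X Y (n : ℤ) (z : A.cocycles X Y n),
      F.app (AInf.Chain.single (A.of n (z : A.hom X Y n))) =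
        A.cohomologyQuiver.of (X := X) (Y := Y) n (A.cls n z) := fun X Y n z =>
    (hF1 X Y _).trans (hp X Y n z)
  have hFs : ∀ X Y (n : ℤ) (y : A.Cohomology X Y n), ∃ x : A.cocycles X Y n,
      F.app (AInf.Chain.single (A.of n (x : A.hom X Y n))) =
        A.cohomologyQuiver.of (X := X) (Y := Y) n y := fun X Y n y => by
    obtain ⟨x, rfl⟩ := A.cls_surjective X Y n y
    exact ⟨x, hFz X Y n x⟩
  refine ⟨{ obj := id, F := F, F_degree := hF, F_nil := hF0, F_eq := fun {X Y} a => ?_ }, ?_⟩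
  · have h1 := AInf.Chain.sum_onTwoBlocks
      (fun V p q => A.cohomologyTotalMul X V Y (F.app q) (F.app p)) a
      (fun q => by rw [hF0]; exact map_zero _)
    have h2 : ∀ P : AInf.Chain (fun X Y => AInf.Chain A.Hom X Y) X Y,
        A.cohomologyCategory.μ.app (P.map id fun q => F.app q) = AInf.Chain.onTwoBlocks
          (fun V p q => A.cohomologyTotalMul X V Y (F.app q) (F.app p)) P := by
      rintro (_ | ⟨_ | ⟨_ | ⟨P, q⟩, q'⟩, q''⟩) <;> rfl
    have h3 := congrArg (fun σ => σ.app a) hE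
    rw [AInf.AInfCategory.functorDefect, AInf.MultiMap.sub_app, AInf.MultiMap.zero_app, sub_eq_zero,
      hP] at h3
    rw [AInf.GradedQuiver.conv_eq_ins, List.map_congr_left fun P _ => h2 P]
    refine Eq.trans ?_ h3
    refine Eq.trans ?_ h1
    rw [hF0, map_zero, LinearMap.zero_apply, add_zero]
  · refine ⟨Function.bijective_id, fun X Y n x hx => ?_, fun X Y n y => ?_⟩
    · obtain ⟨y, hy⟩ := hx
      have h1 : A.cohomologyQuiver.of (X := X) (Y := Y) n (A.cls n x) = 0 :=
        (hFz X Y n x).symm.trans hy.symm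
      rw [← A.cls_eq_zero]
      exact DirectSum.of_injective n (h1.trans (map_zero _).symm)
    · exact (hFs X Y n y.1).imp fun x hx => ⟨0, (map_zero _).trans (sub_eq_zero.2 hx).symm⟩
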